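/- Let $(\Sigma,\sigma)$ be a compact smooth $n$-dimensional Riemannian manifold without boundary, and let $D$ be its Levi-Civita connection with Christoffel symbols $\Lambda_{ij}^k$. On $N=T^*\Sigma$, with canonical coordinates $(q^i,p_i)$, let $\lambda=p_i\,dq^i$ be the Liouville form and $\omega=-d\lambda=\sum_i dq^i\wedge dp_i$. Put $\theta_i=dp_i-\Lambda_{ih}^kp_k\,dq^h$ and $X_i=\frac{\partial}{\partial q^i}+\Lambda_{ih}^kp_k\frac{\partial}{\partial p_h}$. Let $\langle\cdot,\cdot\rangle=\sigma_{ij}\,dq^i\otimes dq^j+\sigma^{ij}\,\theta_i\otimes\theta_j$ be the Sasaki metric, let $J$ be the almost complex structure with $JX_i=\sigma_{ij}\frac{\partial}{\partial p_j}$ and $J\frac{\partial}{\partial p_i}=-\sigma^{ij}X_j$, and let $\widehat\nabla$ be the connection on $TN$ with $\widehat\nabla X_i=\Lambda_{ji}^k\,dq^j\otimes X_k$ and $\widehat\nabla\frac{\partial}{\partial p_i}=-\Lambda_{jk}^i\,dq^j\otimes\frac{\partial}{\partial p_k}$. Let $\Omega=\sqrt{\det\sigma_{ij}}\,\bigwedge_k\bigl(dq^k+\sqrt{-1}\,\sigma^{kj}\theta_j\bigr)$,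 which is defined up to sign (orientation). For a Lagrangian immersion $F:M\to N$ of an $n$-manifold $M$, the generalized mean curvature form is $\mu(u)=\sum_k\langle\widehat\nabla_u e_k,Je_k\rangle$ and the generalized mean curvature vector is $\widehat H=\sum_i\mu(e_i)Je_i$, where $(e_k)$ is a local orthonormal tangent frame of $F$. The local Lagrangian angle $\theta$ is given by $e^{\sqrt{-1}\theta}=\Omega(e_1,\dots,e_n)$. It is defined modulo $\pi$, so that the Maslov form $d\theta$ is a well-defined closed 1-form on $M$. The immersion $F$ is exact if $F^*\lambda=df$ for some smooth function $f:M\to\mathbb R$. It has vanishing Maslov class if the Maslov form $d\theta$ is the differential of a smooth function on $M$. **Theorem 2.** Let $M$ be a compact smooth $n$-manifold without boundary, let $0<T\le\infty$, and let $F:M\times[0,T)\to T^*\Sigma$ be a smooth family of Lagrangian immersions $F_t=F(\cdot,t)$ that satisfies the generalized mean curvature flow $\frac{\partial F}{\partial t}(x,t)=\widehat H(x,t)$, where $\widehat H(\cdot,t)$ is the generalized mean curvature vector of $F_t$. If $F_0$ is exact and has vanishing Maslov class, then for every $t\in[0,T)$ the immersion $F_t$ is exact and has vanishing Maslov class. 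-/

import Mathlib

open scoped Manifold ContDiff Matrix

noncomputable section

/-- The cotangent bundle `T*S` of an `n`-dimensional manifold `S`, with the manifold structure that
Mathlib puts on the bundle of continuous linear forms on the tangent spaces. A point `z` of it is a
point `z.proj` of `S` together with a linear form `z.snd` on the tangent space of `S` there. -/
abbrev CotangentBundle (n : ℕ) (S : Type*) [TopologicalSpace S]
    [ChartedSpace (EuclideanSpace ℝ (Fin n)) S] [IsManifold (𝓡 n) ∞ S] : Type _ :=
  Bundle.TotalSpace (EuclideanSpace ℝ (Fin n) →L[ℝ] ℝ)
    (fun x : S => TangentSpace (𝓡 n) x →L[ℝ] Bundle.Trivial S ℝ x)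

/-- The model with corners of the cotangent bundle of an `n`-dimensional manifold. -/
abbrev cotangentModel (n : ℕ) :
    ModelWithCorners ℝ (EuclideanSpace ℝ (Fin n) × (EuclideanSpace ℝ (Fin n) →L[ℝ] ℝ))
      (ModelProd (EuclideanSpace ℝ (Fin n)) (EuclideanSpace ℝ (Fin n) →L[ℝ] ℝ)) :=
  (𝓡 n).prod 𝓘(ℝ, EuclideanSpace ℝ (Fin n) →L[ℝ] ℝ)

/-- A smooth Riemannian metric on an `n`-dimensional manifold. -/
abbrev SmoothMetric (n : ℕ) (S : Type*) [TopologicalSpace S]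
    [ChartedSpace (EuclideanSpace ℝ (Fin n)) S] [IsManifold (𝓡 n) ∞ S] : Type _ :=
  Bundle.ContMDiffRiemannianMetric (𝓡 n) ∞ (EuclideanSpace ℝ (Fin n))
    (fun x : S => TangentSpace (𝓡 n) x)

/-- The `i`-th coordinate vector field `∂/∂x^i` of the preferred chart around `c`, at a point `x`
of the domain of that chart. -/
def coordVec {n : ℕ} {M : Type*} [TopologicalSpace M]
    [ChartedSpace (EuclideanSpace ℝ (Fin n)) M] [IsManifold (𝓡 n) ∞ M]
    (c : M) (i : Fin n) (x : M) : TangentSpace (𝓡 n) x :=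
  (trivializationAt (EuclideanSpace ℝ (Fin n)) (TangentSpace (𝓡 n) : M → Type _) c).symmL ℝ x
    (EuclideanSpace.single i (1 : ℝ))

namespace Cotangent

/-- The derivative `u(f)` of a real function `f` on a manifold along a tangent vector `u` at `x`. -/
abbrev dirDeriv {n : ℕ} {M : Type*} [TopologicalSpace M]
    [ChartedSpace (EuclideanSpace ℝ (Fin n)) M]
    (f : M → ℝ) (x : M) (u : TangentSpace (𝓡 n) x) : ℝ :=
  mfderiv (𝓡 n) 𝓘(ℝ, ℝ) f x u

/-- The derivative `u(f)` of a complex function `f` on a manifold along a tangent vector `u`. -/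
abbrev dirDerivC {n : ℕ} {M : Type*} [TopologicalSpace M]
    [ChartedSpace (EuclideanSpace ℝ (Fin n)) M]
    (f : M → ℂ) (x : M) (u : TangentSpace (𝓡 n) x) : ℂ :=
  mfderiv (𝓡 n) 𝓘(ℝ, ℂ) f x u

section Geometry

variable {n : ℕ} {S : Type*} [TopologicalSpace S]
  [ChartedSpace (EuclideanSpace ℝ (Fin n)) S] [IsManifold (𝓡 n) ∞ S]

/-! ### The base metric in the chart around `c` -/

/-- The matrix `σ_{ij}` of the metric in the chart around `c`, at a point `x` of its domain. -/
def metricMatrix (g : SmoothMetric n S) (c x : S) : Matrix (Fin n) (Fin n) ℝ :=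
  Matrix.of fun i j => g.inner x (coordVec c i x) (coordVec c j x)

/-- `∂σ_{ij}/∂q^k` in the chart around `c`, at `x`. -/
def metricDeriv (g : SmoothMetric n S) (c x : S) (k i j : Fin n) : ℝ :=
  dirDeriv (fun y => metricMatrix g c y i j) x (coordVec c k x)

/-- The Christoffel symbol `Λ_{ij}^k` of the Levi-Civita connection in the chart around `c`. -/
def christoffel (g : SmoothMetric n S) (c x : S) (k i j : Fin n) : ℝ :=
  (1 / 2 : ℝ) * ∑ l, (metricMatrix g c x)⁻¹ k l *
    (metricDeriv g c x i j l + metricDeriv g c x j i l - metricDeriv g c x l i j)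

/-! ### Canonical coordinates on the cotangent bundle -/

/-- The coordinate function `q^i` on the cotangent bundle, from the chart around `c`. -/
def q (c : S) (i : Fin n) (z : CotangentBundle n S) : ℝ := extChartAt (𝓡 n) c z.proj i

/-- The coordinate function `p_i` on the cotangent bundle, from the chart around `c`. -/
def p (c : S) (i : Fin n) (z : CotangentBundle n S) : ℝ := z.snd (coordVec c i z.proj)

/-- The form `dq^i`. -/
def dq (c : S) (i : Fin n) (z : CotangentBundle n S) (V : TangentSpace (cotangentModel n) z) : ℝ :=
  mfderiv (cotangentModel n) 𝓘(ℝ, ℝ) (q c i) z V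

/-- The form `dp_i`. -/
def dp (c : S) (i : Fin n) (z : CotangentBundle n S) (V : TangentSpace (cotangentModel n) z) : ℝ :=
  mfderiv (cotangentModel n) 𝓘(ℝ, ℝ) (p c i) z V

/-- The form `θ_i = dp_i - Λ_{ih}^k p_k dq^h`. -/
def theta (g : SmoothMetric n S) (c : S) (i : Fin n) (z : CotangentBundle n S)
    (V : TangentSpace (cotangentModel n) z) : ℝ :=
  dp c i z V - ∑ h, ∑ k, christoffel g c z.proj k i h * p c k z * dq c h z V

/-- The coordinate vector field `∂/∂q^i` of the canonical coordinates `(q, p)` over the chart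
around `c`. (The chart of the cotangent bundle around a point depends only on the base point.) -/
def delQ (c : S) (i : Fin n) (z : CotangentBundle n S) : TangentSpace (cotangentModel n) z :=
  (trivializationAt (EuclideanSpace ℝ (Fin n) × (EuclideanSpace ℝ (Fin n) →L[ℝ] ℝ))
    (TangentSpace (cotangentModel n) : CotangentBundle n S → Type _) ⟨c, 0⟩).symmL ℝ z
    (EuclideanSpace.single i (1 : ℝ), 0)

/-- The coordinate vector field `∂/∂p_i` of the canonical coordinates `(q, p)` over the chart
around `c`. -/
def delP (c : S) (i : Fin n) (z : CotangentBundle n S) : TangentSpace (cotangentModel n) z :=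
  (trivializationAt (EuclideanSpace ℝ (Fin n) × (EuclideanSpace ℝ (Fin n) →L[ℝ] ℝ))
    (TangentSpace (cotangentModel n) : CotangentBundle n S → Type _) ⟨c, 0⟩).symmL ℝ z
    (0, EuclideanSpace.proj i)

/-- The horizontal vector field `X_i = ∂/∂q^i + Λ_{ih}^k p_k ∂/∂p_h`. -/
def horX (g : SmoothMetric n S) (c : S) (i : Fin n) (z : CotangentBundle n S) :
    TangentSpace (cotangentModel n) z :=
  delQ c i z + ∑ h, (∑ k, christoffel g c z.proj k i h * p c k z) • delP c h z

/-! ### The Liouville form and the almost Kähler structure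

The tensors at `z` are written in the preferred chart around `z.proj`; they do not depend on
that choice. -/

/-- The Liouville form `λ = p_i dq^i`, that is `λ_z(V) = z(dπ(V))`. -/
def liouville (z : CotangentBundle n S) (V : TangentSpace (cotangentModel n) z) : ℝ :=
  z.snd (mfderiv (cotangentModel n) (𝓡 n)
    (fun w : CotangentBundle n S => w.proj) z V)

/-- The canonical symplectic form `ω = -dλ = ∑ dq^i ∧ dp_i`. -/
def omega (z : CotangentBundle n S) (V W : TangentSpace (cotangentModel n) z) : ℝ :=
  ∑ i, (dq z.proj i z V * dp z.proj i z W - dp z.proj i z V * dq z.proj i z W)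

/-- The Sasaki metric `σ_{ij} dq^i ⊗ dq^j + σ^{ij} θ_i ⊗ θ_j` on the cotangent bundle. -/
def sasaki (g : SmoothMetric n S) (z : CotangentBundle n S)
    (V W : TangentSpace (cotangentModel n) z) : ℝ :=
  ∑ i, ∑ j, (metricMatrix g z.proj z.proj i j * dq z.proj i z V * dq z.proj j z W +
    (metricMatrix g z.proj z.proj)⁻¹ i j * theta g z.proj i z V * theta g z.proj j z W)

/-- The almost complex structure: `J X_i = σ_{ij} ∂/∂p_j` and `J ∂/∂p_i = -σ^{ij} X_j`. -/
def complexJ (g : SmoothMetric n S) (z : CotangentBundle n S)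
    (V : TangentSpace (cotangentModel n) z) : TangentSpace (cotangentModel n) z :=
  ∑ i, ∑ j, ((metricMatrix g z.proj z.proj i j * dq z.proj i z V) • delP z.proj j z -
    ((metricMatrix g z.proj z.proj)⁻¹ i j * theta g z.proj i z V) • horX g z.proj j z)

/-- The `n`-form `Ω = √(det σ) (dq^1 - √-1 J dq^1) ∧ ⋯ ∧ (dq^n - √-1 J dq^n)` evaluated on `n`
tangent vectors, where `J dq^k = -σ^{kj} θ_j`. Its sign depends on the orientation of the chart. -/
def OmegaForm (g : SmoothMetric n S) (z : CotangentBundle n S)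
    (V : Fin n → TangentSpace (cotangentModel n) z) : ℂ :=
  (Real.sqrt (metricMatrix g z.proj z.proj).det : ℂ) *
    (Matrix.of fun i k : Fin n => (dq z.proj k z (V i) : ℂ) + Complex.I *
      ((∑ j, (metricMatrix g z.proj z.proj)⁻¹ k j * theta g z.proj j z (V i) : ℝ) : ℂ)).det

end Geometry

section Immersed

variable {n : ℕ} {S : Type*} [TopologicalSpace S]
  [ChartedSpace (EuclideanSpace ℝ (Fin n)) S] [IsManifold (𝓡 n) ∞ S]
  {M : Type*} [TopologicalSpace M]
  [ChartedSpace (EuclideanSpace ℝ (Fin n)) M] [IsManifold (𝓡 n) ∞ M]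

/-- The differential of `F : M → T*S` at `x`. -/
abbrev dF (F : M → CotangentBundle n S) (x : M) (u : TangentSpace (𝓡 n) x) :
    TangentSpace (cotangentModel n) (F x) :=
  mfderiv (𝓡 n) (cotangentModel n) F x u

/-- `F` is a Lagrangian immersion of the `n`-manifold `M` into `T*S`: its differential is injective
at every point, and the symplectic form vanishes on its tangent spaces. -/
structure IsLagrangianImmersion (F : M → CotangentBundle n S) : Prop where
  contMDiff : ContMDiff (𝓡 n) (cotangentModel n) ∞ F
  injective : ∀ x : M, Function.Injective (dF F x)
  isotropic : ∀ (x : M) (u v : TangentSpace (𝓡 n) x), omega (F x) (dF F x u) (dF F x v) = 0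

/-- The canonical connection `∇̂` of `T*S`, acting on vector fields along a map `F : M → T*S`:
`nablaAlong g F x u Y = ∇̂_u Y` for a tangent vector `u` of `M` at `x`. With respect to the frame
`X_k, ∂/∂p_k` around `F x`, the connection is given by `∇̂ X_i = Λ_{ji}^k dq^j ⊗ X_k` and
`∇̂ ∂/∂p_i = -Λ_{jk}^i dq^j ⊗ ∂/∂p_k`. -/
def nablaAlong (g : SmoothMetric n S) (F : M → CotangentBundle n S) (x : M)
    (u : TangentSpace (𝓡 n) x) (Y : (y : M) → TangentSpace (cotangentModel n) (F y)) :
    TangentSpace (cotangentModel n) (F x) :=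
  let c : S := (F x).proj
  (∑ k, (dirDeriv (fun y => dq c k (F y) (Y y)) x u +
      ∑ i, ∑ j, christoffel g c c k j i * dq c j (F x) (dF F x u) * dq c i (F x) (Y x)) •
        horX g c k (F x)) +
  ∑ k, (dirDeriv (fun y => theta g c k (F y) (Y y)) x u -
      ∑ i, ∑ j, christoffel g c c i j k * dq c j (F x) (dF F x u) * theta g c i (F x) (Y x)) •
        delP c k (F x)

/-- The tangential frame `F_i = dF(∂/∂x^i)` along `F`, for the chart of `M` around `c`. -/
def frame (F : M → CotangentBundle n S) (c : M) (i : Fin n) (y : M) :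
    TangentSpace (cotangentModel n) (F y) :=
  dF F y (coordVec c i y)

/-- The matrix `G_{ij} = ⟨F_i, F_j⟩` of the induced metric at `x`, in the chart of `M` around `x`. -/
def inducedMatrix (g : SmoothMetric n S) (F : M → CotangentBundle n S) (x : M) :
    Matrix (Fin n) (Fin n) ℝ :=
  Matrix.of fun i j => sasaki g (F x) (frame F x i x) (frame F x j x)

/-- The generalized mean curvature form `μ(u) = ∑_k ⟨∇̂_u e_k, J e_k⟩`, `e_k` orthonormal: the trace
with respect to the induced metric of the tensor `(Y, Z) ↦ ⟨∇̂_u Y, J Z⟩`, computed as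
`G^{kl} ⟨∇̂_u F_k, J F_l⟩`. -/
def meanCurvatureForm (g : SmoothMetric n S) (F : M → CotangentBundle n S) (x : M)
    (u : TangentSpace (𝓡 n) x) : ℝ :=
  ∑ k, ∑ l, (inducedMatrix g F x)⁻¹ k l *
    sasaki g (F x) (nablaAlong g F x u (frame F x k)) (complexJ g (F x) (frame F x l x))

/-- The generalized mean curvature vector `Ĥ = ∑_i μ(e_i) J e_i = G^{ij} μ(∂/∂x^i) J F_j`. -/
def meanCurvatureVector (g : SmoothMetric n S) (F : M → CotangentBundle n S) (x : M) :
    TangentSpace (cotangentModel n) (F x) :=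
  ∑ i, ∑ j, ((inducedMatrix g F x)⁻¹ i j * meanCurvatureForm g F x (coordVec x i x)) •
    complexJ g (F x) (frame F x j x)

/-- The square `e^{2√-1θ}` of the phase `e^{√-1θ} = Ω(F_1, …, F_n) / √(det G_{ij})` of a Lagrangian
immersion, `θ` being its Lagrangian angle with respect to the horizontal distribution. The phase
itself is determined by the tangent space up to sign only (reversal of orientation). -/
def phaseSq (g : SmoothMetric n S) (F : M → CotangentBundle n S) (x : M) : ℂ :=
  OmegaForm g (F x) (fun i => frame F x i x) ^ 2 / ((inducedMatrix g F x).det : ℂ)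

/-- The Maslov form `dθ` of a Lagrangian immersion, `θ` the local Lagrangian angle. As
`e^{2√-1θ} = phaseSq` has modulus one, it equals `Im(conj(phaseSq) d(phaseSq)) / 2`. -/
def maslovForm (g : SmoothMetric n S) (F : M → CotangentBundle n S) (x : M)
    (u : TangentSpace (𝓡 n) x) : ℝ :=
  (1 / 2 : ℝ) * (starRingEnd ℂ (phaseSq g F x) * dirDerivC (phaseSq g F) x u).im

/-- The 1-form `α` on `M` is exact: the differential of a smooth function. -/
def IsExactForm (α : (x : M) → TangentSpace (𝓡 n) x → ℝ) : Prop :=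
  ∃ f : M → ℝ, ContMDiff (𝓡 n) 𝓘(ℝ, ℝ) ∞ f ∧
    ∀ (x : M) (u : TangentSpace (𝓡 n) x), dirDeriv f x u = α x u

/-- The Lagrangian immersion `F` is exact: the pulled-back Liouville form is exact. -/
def IsExactLagrangian (F : M → CotangentBundle n S) : Prop :=
  IsExactForm fun (x : M) (u : TangentSpace (𝓡 n) x) => liouville (F x) (dF F x u)

/-- The Maslov class of `F`, that is the de Rham class of its Maslov form, vanishes. -/
def HasVanishingMaslovClass (g : SmoothMetric n S) (F : M → CotangentBundle n S) : Prop :=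
  IsExactForm fun (x : M) (u : TangentSpace (𝓡 n) x) => maslovForm g F x u

end Immersed

/-- The time interval `[0, T)`, where `T` may be `∞`. -/
def timeInterval (T : EReal) : Set ℝ := {t : ℝ | 0 ≤ t ∧ (t : EReal) < T}

/-- `F : M × [0, T) → T*S` is a smooth generalized Lagrangian mean curvature flow. -/
structure IsGeneralizedLagrangianMCF {n : ℕ} {S : Type*} [TopologicalSpace S]
    [ChartedSpace (EuclideanSpace ℝ (Fin n)) S] [IsManifold (𝓡 n) ∞ S]
    {M : Type*} [TopologicalSpace M]
    [ChartedSpace (EuclideanSpace ℝ (Fin n)) M] [IsManifold (𝓡 n) ∞ M]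
    (g : SmoothMetric n S) (T : EReal) (F : M × ℝ → CotangentBundle n S) : Prop where
  smooth : ContMDiffOn ((𝓡 n).prod 𝓘(ℝ, ℝ)) (cotangentModel n) ∞ F
    (Set.univ ×ˢ timeInterval T)
  lagrangian : ∀ t ∈ timeInterval T, IsLagrangianImmersion fun x : M => F (x, t)
  evolution : ∀ (x : M), ∀ t ∈ timeInterval T,
    mfderivWithin 𝓘(ℝ, ℝ) (cotangentModel n) (fun s : ℝ => F (x, s)) (timeInterval T) t (1 : ℝ) =
      meanCurvatureVector g (fun y : M => F (y, t)) x

end Cotangent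

end

set_option linter.unusedSectionVars false

noncomputable section

namespace Cotangent

/-! Both forms start out exact, and their time derivatives are exact with explicit primitives, so
the primitives can be integrated in time.

For the Maslov form this is homotopy invariance. The squared phase `e^{2√-1θ}` is a global function
of modulus one, so its angular speed `phaseSpeed` is a global function, and the differential of that
function is the time derivative of `dθ` (`hasDerivWithinAt_maslovForm`). No flow equation is needed.
Hence `θ_t = θ_0 + ∫ phaseSpeed` is a primitive at time `t`.

For the Liouville form, Cartan's formula reads `∂_t(F^*λ) = d(λ(∂_t F)) - ω(∂_t F, dF ·)`. Along the
flow `∂_t F = Ĥ`, and `ω(Ĥ, dF u) = -μ(u)` by the definition of `Ĥ` and the compatibility of `J`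
with `ω`. The geometric core is the identity `μ = dθ` (`meanCurvatureForm_eq_maslovForm`). It gives
`∂_t(F^*λ) = d(λ(Ĥ) + θ_t)`, so `f_t = f_0 + ∫ (λ(Ĥ) + θ_s) ds` is a primitive.

The identity `μ = dθ` is linear algebra. Let `A`, `B` be the components of a tangent frame under
`dq` and `θ`, and put `W = Aσ + √-1 B`. The Lagrangian condition makes the induced metric equal to
`W σ⁻¹ Wᴴ`; the squared phase is `det W / conj (det W)`, hence `dθ = Im tr(W⁻¹ dW)`. Since the base
connection is metric, the covariant derivative of `W` is `dW - W L` with a real connection matrix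
`L`. Therefore `μ = Im tr(W⁻¹ dW - L)`, and the real number `tr L` drops out (`trace_inv_gram`).

All tensors are written in charts that move with the point. To differentiate them one must pass to
fixed charts: `θ` is tensorial (`thetaForm_transition`), so `det W` changes only by a real factor
(`phaseMatrix_own_factor`), which the squared phase does not see (`phaseSq_eq`). -/

/-- The model space `ℝⁿ`. -/
abbrev Model (n : ℕ) : Type := EuclideanSpace ℝ (Fin n)

/-- The model space of the cotangent bundle. -/
abbrev PhaseModel (n : ℕ) : Type := Model n × (Model n →L[ℝ] ℝ)

/-! ### Coordinate vectors and canonical coordinates in terms of Fréchet derivatives. -/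

section Dictionary

variable {n : ℕ} {S : Type*} [TopologicalSpace S]
  [ChartedSpace (EuclideanSpace ℝ (Fin n)) S] [IsManifold (𝓡 n) ∞ S]

/-- The tangent vector at `x` with coordinates `v` in the chart around `c`. -/
def vec (c x : S) (v : Model n) : TangentSpace (𝓡 n) x :=
  (trivializationAt (EuclideanSpace ℝ (Fin n)) (TangentSpace (𝓡 n) : S → Type _) c).symmL ℝ x v

theorem coordVec_eq_vec (c x : S) (i : Fin n) :
    coordVec c i x = vec c x (EuclideanSpace.single i 1) := rfl

theorem vec_eq_mfderiv {c x : S} (hx : x ∈ (chartAt (Model n) c).source) (v : Model n) :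
    vec c x v = mfderiv 𝓘(ℝ, Model n) (𝓡 n) (extChartAt (𝓡 n) c).symm (extChartAt (𝓡 n) c x) v := by
  unfold vec
  rw [TangentBundle.symmL_trivializationAt hx, modelWithCornersSelf_coe, Set.range_id,
    mfderivWithin_univ]
  rfl

theorem vec_surjective {c x : S} (hx : x ∈ (chartAt (Model n) c).source)
    (u : TangentSpace (𝓡 n) x) : ∃ v, vec c x v = u := by
  refine ⟨(trivializationAt (EuclideanSpace ℝ (Fin n)) (TangentSpace (𝓡 n) : S → Type _)
    c).continuousLinearMapAt ℝ x u, ?_⟩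
  unfold vec
  exact Bundle.Trivialization.symmL_continuousLinearMapAt _ (by simpa using hx) u

theorem vec_injective {c x : S} (hx : x ∈ (chartAt (Model n) c).source) :
    Function.Injective (vec c x : Model n → TangentSpace (𝓡 n) x) := by
  intro v w h
  have := congrArg ((trivializationAt (EuclideanSpace ℝ (Fin n))
    (TangentSpace (𝓡 n) : S → Type _) c).continuousLinearMapAt ℝ x) h
  unfold vec at this
  rwa [Bundle.Trivialization.continuousLinearMapAt_symmL _ (by simpa using hx),
    Bundle.Trivialization.continuousLinearMapAt_symmL _ (by simpa using hx)] at this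

section

variable {E' : Type*} [NormedAddCommGroup E'] [NormedSpace ℝ E'] {H' : Type*} [TopologicalSpace H']
  {I' : ModelWithCorners ℝ E' H'} {N : Type*} [TopologicalSpace N] [ChartedSpace H' N]

/-- Chain rule along the inverse chart: derivatives along coordinate vectors become derivatives on
`ℝⁿ`. -/
theorem mfderiv_vec {f : S → N} {c x : S} (hx : x ∈ (chartAt (Model n) c).source)
    (hf : MDifferentiableAt (𝓡 n) I' f x) (v : Model n) :
    mfderiv (𝓡 n) I' f x (vec c x v) =
      mfderiv 𝓘(ℝ, Model n) I' (f ∘ (extChartAt (𝓡 n) c).symm) (extChartAt (𝓡 n) c x) v := by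
  have hx' : x ∈ (extChartAt (𝓡 n) c).source := by simpa using hx
  have h1 : MDifferentiableAt 𝓘(ℝ, Model n) (𝓡 n) (extChartAt (𝓡 n) c).symm
      (extChartAt (𝓡 n) c x) := by
    have := mdifferentiableWithinAt_extChartAt_symm (I := 𝓡 n)
      ((extChartAt (𝓡 n) c).map_source hx')
    simpa [mdifferentiableWithinAt_univ] using this
  have h2 : (extChartAt (𝓡 n) c).symm (extChartAt (𝓡 n) c x) = x :=
    (extChartAt (𝓡 n) c).left_inv hx'
  rw [vec_eq_mfderiv hx, mfderiv_comp (I' := 𝓡 n) _ (by rw [h2]; exact hf) h1]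
  erw [h2]
  rfl

end

theorem mfderiv_real_vec {E' : Type*} [NormedAddCommGroup E'] [NormedSpace ℝ E']
    {f : S → E'} {c x : S} (hx : x ∈ (chartAt (Model n) c).source)
    (hf : MDifferentiableAt (𝓡 n) 𝓘(ℝ, E') f x) (v : Model n) :
    mfderiv (𝓡 n) 𝓘(ℝ, E') f x (vec c x v) =
      fderiv ℝ (f ∘ (extChartAt (𝓡 n) c).symm) (extChartAt (𝓡 n) c x) v := by
  rw [mfderiv_vec hx hf, mfderiv_eq_fderiv]
  rfl

/-- The canonical chart `(q, p)` of the cotangent bundle over the chart around `c`. -/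
def cotChart (c : S) : CotangentBundle n S → PhaseModel n :=
  extChartAt (cotangentModel n) (⟨c, 0⟩ : CotangentBundle n S)

theorem mem_chart_source_iff (c : S) (z : CotangentBundle n S) :
    z ∈ (chartAt (ModelProd (Model n) (Model n →L[ℝ] ℝ)) (⟨c, 0⟩ : CotangentBundle n S)).source ↔
      z.proj ∈ (chartAt (Model n) c).source := by
  have h' (hz : z.proj ∈ (chartAt (Model n) c).source) :
      (trivializationAt (Model n →L[ℝ] ℝ)
        (fun x : S => TangentSpace (𝓡 n) x →L[ℝ] Bundle.Trivial S ℝ x) c z).1 = z.proj :=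
    (trivializationAt (Model n →L[ℝ] ℝ)
      (fun x : S => TangentSpace (𝓡 n) x →L[ℝ] Bundle.Trivial S ℝ x) c).coe_fst' (by simpa using hz)
  simp only [FiberBundle.chartedSpace_chartAt, mfld_simps]
  constructor
  · rintro ⟨h1, h2⟩
    simpa using h1
  · intro h1
    refine ⟨by simpa using h1, ?_⟩
    rw [h' h1]
    exact h1

theorem cotChart_fst (c : S) (z : CotangentBundle n S) :
    (cotChart c z).1 = extChartAt (𝓡 n) c z.proj := by
  unfold cotChart
  rw [FiberBundle.extChartAt]
  rfl

/-- The trivialization of the dual bundle is precomposition with the inverse trivialization of the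
tangent bundle. -/
theorem cotChart_snd {c : S} {z : CotangentBundle n S}
    (hz : z.proj ∈ (chartAt (Model n) c).source) (v : Model n) :
    (cotChart c z).2 v = z.snd (vec c z.proj v) := by
  unfold cotChart
  rw [FiberBundle.extChartAt]
  have h := hom_trivializationAt_apply (RingHom.id ℝ) (F₁ := Model n) (F₂ := ℝ)
    (E₁ := (TangentSpace (𝓡 n) : S → Type _)) (E₂ := Bundle.Trivial S ℝ) c z
  change (trivializationAt (Model n →L[ℝ] ℝ)
    (fun x : S => TangentSpace (𝓡 n) x →L[ℝ] Bundle.Trivial S ℝ x) c z).2 v = _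
  rw [h]
  dsimp only
  rw [ContinuousLinearMap.inCoordinates_eq (by simpa using hz) (by simp)]
  unfold vec
  rw [Bundle.Trivialization.symmL_apply _ (by simpa using hz)]
  simp

theorem q_eq (c : S) (i : Fin n) (z : CotangentBundle n S) : q c i z = (cotChart c z).1 i := by
  rw [cotChart_fst]; rfl

theorem p_eq {c : S} {z : CotangentBundle n S} (hz : z.proj ∈ (chartAt (Model n) c).source)
    (i : Fin n) : p c i z = (cotChart c z).2 (EuclideanSpace.single i 1) := by
  rw [cotChart_snd hz]; rfl

theorem contMDiffAt_cotChart {c : S} {z : CotangentBundle n S}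
    (hz : z.proj ∈ (chartAt (Model n) c).source) :
    ContMDiffAt (cotangentModel n) 𝓘(ℝ, PhaseModel n) ∞ (cotChart c) z := by
  have := contMDiffAt_extChartAt' (I := cotangentModel n) (n := ∞)
    ((mem_chart_source_iff c z).2 hz)
  exact this

theorem mdifferentiableAt_cotChart {c : S} {z : CotangentBundle n S}
    (hz : z.proj ∈ (chartAt (Model n) c).source) :
    MDifferentiableAt (cotangentModel n) 𝓘(ℝ, PhaseModel n) (cotChart c) z :=
  (contMDiffAt_cotChart hz).mdifferentiableAt (by simp)

theorem isOpen_proj_preimage (c : S) :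
    IsOpen {z : CotangentBundle n S | z.proj ∈ (chartAt (Model n) c).source} :=
  (chartAt (Model n) c).open_source.preimage (FiberBundle.continuous_proj _ _)

/-- The differential of the canonical chart. -/
def dCot (c : S) (z : CotangentBundle n S) (V : TangentSpace (cotangentModel n) z) :
    PhaseModel n :=
  mfderiv (cotangentModel n) 𝓘(ℝ, PhaseModel n) (cotChart c) z V

theorem dq_eq {c : S} {z : CotangentBundle n S} (hz : z.proj ∈ (chartAt (Model n) c).source)
    (i : Fin n) (V : TangentSpace (cotangentModel n) z) : dq c i z V = (dCot c z V).1 i := by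
  unfold dq dCot
  let L : PhaseModel n →L[ℝ] ℝ := (EuclideanSpace.proj i).comp (ContinuousLinearMap.fst ℝ _ _)
  have h1 : q c i = L ∘ cotChart (n := n) c := by
    funext w; rw [q_eq]; rfl
  rw [h1, mfderiv_comp (I' := 𝓘(ℝ, PhaseModel n)) z L.mdifferentiableAt
    (mdifferentiableAt_cotChart hz), ContinuousLinearMap.mfderiv_eq]
  rfl

theorem dp_eq {c : S} {z : CotangentBundle n S} (hz : z.proj ∈ (chartAt (Model n) c).source)
    (i : Fin n) (V : TangentSpace (cotangentModel n) z) :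
    dp c i z V = (dCot c z V).2 (EuclideanSpace.single i 1) := by
  unfold dp dCot
  let L : PhaseModel n →L[ℝ] ℝ :=
    (ContinuousLinearMap.apply ℝ ℝ (EuclideanSpace.single i (1 : ℝ))).comp
      (ContinuousLinearMap.snd ℝ _ _)
  -- Unlike `q^i`, the function `p_i` is identified with a component of the chart only over the
  -- chart domain, hence the local equality.
  have h1 : p c i =ᶠ[nhds z] L ∘ cotChart (n := n) c := by
    filter_upwards [(isOpen_proj_preimage c).mem_nhds hz] with w hw
    rw [p_eq hw]; rfl
  rw [h1.mfderiv_eq, mfderiv_comp (I' := 𝓘(ℝ, PhaseModel n)) z L.mdifferentiableAt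
    (mdifferentiableAt_cotChart hz), ContinuousLinearMap.mfderiv_eq]
  rfl

theorem dCot_symmL {c : S} {z : CotangentBundle n S}
    (hz : z.proj ∈ (chartAt (Model n) c).source) (w : PhaseModel n) :
    dCot c z ((trivializationAt (EuclideanSpace ℝ (Fin n) × (EuclideanSpace ℝ (Fin n) →L[ℝ] ℝ))
    (TangentSpace (cotangentModel n) : CotangentBundle n S → Type _) ⟨c, 0⟩).symmL ℝ z w) = w := by
  have h := TangentBundle.continuousLinearMapAt_trivializationAt (I := cotangentModel n)
    ((mem_chart_source_iff c z).2 hz)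
  have h2 := Bundle.Trivialization.continuousLinearMapAt_symmL (R := ℝ)
    (trivializationAt (EuclideanSpace ℝ (Fin n) × (EuclideanSpace ℝ (Fin n) →L[ℝ] ℝ))
    (TangentSpace (cotangentModel n) : CotangentBundle n S → Type _) ⟨c, 0⟩) (b := z)
    (by rw [TangentBundle.trivializationAt_baseSet, mem_chart_source_iff]; exact hz) w
  rw [h] at h2
  exact h2

theorem dCot_injective {c : S} {z : CotangentBundle n S}
    (hz : z.proj ∈ (chartAt (Model n) c).source) {V : TangentSpace (cotangentModel n) z}
    (h : dCot c z V = 0) : V = 0 := by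
  have h1 := TangentBundle.continuousLinearMapAt_trivializationAt (I := cotangentModel n)
    ((mem_chart_source_iff c z).2 hz)
  have h2 := Bundle.Trivialization.symmL_continuousLinearMapAt (R := ℝ)
    (trivializationAt (EuclideanSpace ℝ (Fin n) × (EuclideanSpace ℝ (Fin n) →L[ℝ] ℝ))
    (TangentSpace (cotangentModel n) : CotangentBundle n S → Type _) ⟨c, 0⟩) (b := z)
    (by rw [TangentBundle.trivializationAt_baseSet, mem_chart_source_iff]; exact hz) V
  rw [h1] at h2
  rw [← h2]
  have h3 : mfderiv (cotangentModel n) 𝓘(ℝ, PhaseModel n)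
    (extChartAt (cotangentModel n) (⟨c, 0⟩ : CotangentBundle n S)) z V = 0 := h
  erw [h3]
  exact map_zero _

theorem dCot_add (c : S) (z : CotangentBundle n S) (V W : TangentSpace (cotangentModel n) z) :
    dCot c z (V + W) = dCot c z V + dCot c z W := map_add _ _ _

theorem dCot_smul (c : S) (z : CotangentBundle n S) (r : ℝ)
    (V : TangentSpace (cotangentModel n) z) : dCot c z (r • V) = r • dCot c z V := map_smul _ _ _

theorem dCot_delQ {c : S} {z : CotangentBundle n S}
    (hz : z.proj ∈ (chartAt (Model n) c).source) (i : Fin n) :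
    dCot c z (delQ c i z) = (EuclideanSpace.single i 1, 0) := dCot_symmL hz _

theorem dCot_delP {c : S} {z : CotangentBundle n S}
    (hz : z.proj ∈ (chartAt (Model n) c).source) (i : Fin n) :
    dCot c z (delP c i z) = (0, EuclideanSpace.proj i) := dCot_symmL hz _

end Dictionary

/-! ### The base metric and its Christoffel symbols in a chart. -/

section MetricInCharts

variable {n : ℕ} {S : Type*} [TopologicalSpace S]
  [ChartedSpace (EuclideanSpace ℝ (Fin n)) S] [IsManifold (𝓡 n) ∞ S]

/-- The metric in the chart around `c`, as a field of bilinear forms on the model space. -/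
def gform (g : SmoothMetric n S) (c : S) (y : Model n) : Model n →L[ℝ] Model n →L[ℝ] ℝ :=
  let x := (extChartAt (𝓡 n) c).symm y
  let L : Model n →L[ℝ] TangentSpace (𝓡 n) x :=
    (trivializationAt (EuclideanSpace ℝ (Fin n)) (TangentSpace (𝓡 n) : S → Type _) c).symmL ℝ x
  (ContinuousLinearMap.precomp ℝ L).comp ((g.inner x).comp L)

theorem gform_apply (g : SmoothMetric n S) (c : S) (y v w : Model n) :
    gform g c y v w = g.inner ((extChartAt (𝓡 n) c).symm y)
      (vec c ((extChartAt (𝓡 n) c).symm y) v) (vec c ((extChartAt (𝓡 n) c).symm y) w) := rfl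

theorem gform_extChartAt (g : SmoothMetric n S) {c x : S}
    (hx : x ∈ (chartAt (Model n) c).source) (v w : Model n) :
    gform g c (extChartAt (𝓡 n) c x) v w = g.inner x (vec c x v) (vec c x w) := by
  rw [gform_apply, (extChartAt (𝓡 n) c).left_inv (by simpa using hx)]

theorem gform_symm (g : SmoothMetric n S) (c : S) (y v w : Model n) :
    gform g c y v w = gform g c y w v := g.symm _ _ _

theorem contMDiffOn_vec (c : S) (v : Model n) :
    ContMDiffOn (𝓡 n) ((𝓡 n).prod 𝓘(ℝ, Model n)) ∞
      (fun x : S => Bundle.TotalSpace.mk' (Model n) x (vec c x v))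
      (chartAt (Model n) c).source := by
  have h := (trivializationAt (EuclideanSpace ℝ (Fin n)) (TangentSpace (𝓡 n) : S → Type _)
    c).contMDiffOn_section_baseSet_iff (IB := 𝓡 n) (n := ∞) (s := fun x => vec c x v)
  rw [TangentBundle.trivializationAt_baseSet] at h
  rw [h]
  refine (contMDiffOn_const (c := v)).congr fun x hx => ?_
  have hx' : x ∈ (trivializationAt (EuclideanSpace ℝ (Fin n))
    (TangentSpace (𝓡 n) : S → Type _) c).baseSet := by simpa using hx
  have := Bundle.Trivialization.continuousLinearMapAt_symmL (R := ℝ)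
    (trivializationAt (EuclideanSpace ℝ (Fin n)) (TangentSpace (𝓡 n) : S → Type _) c) hx' v
  rw [Bundle.Trivialization.continuousLinearMapAt_apply_of_mem _ _ hx'] at this
  exact this

theorem contMDiffOn_inner_vec (g : SmoothMetric n S) (c : S) (v w : Model n) :
    ContMDiffOn (𝓡 n) 𝓘(ℝ, ℝ) ∞ (fun x => g.inner x (vec c x v) (vec c x w))
      (chartAt (Model n) c).source := by
  intro x hx
  have := (g.contMDiff x).contMDiffWithinAt (s := (chartAt (Model n) c).source)
    |>.clm_bundle_apply₂ (F₃ := ℝ) (E₃ := Bundle.Trivial S ℝ) (contMDiffOn_vec c v x hx)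
      (contMDiffOn_vec c w x hx)
  rw [Bundle.contMDiffWithinAt_totalSpace] at this
  exact this.2

/-- In finite dimension smoothness may be tested on fixed vectors, whose coordinate extensions are
smooth sections. -/
theorem contDiffOn_gform (g : SmoothMetric n S) (c : S) :
    ContDiffOn ℝ ∞ (gform g c) (extChartAt (𝓡 n) c).target := by
  rw [contDiffOn_clm_apply]
  intro v
  rw [contDiffOn_clm_apply]
  intro w
  have h1 := contMDiffOn_extChartAt_symm (I := 𝓡 n) (n := ∞) c
  have h2 := (contMDiffOn_inner_vec g c v w).comp h1 (fun y hy => by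
    have := (extChartAt (𝓡 n) c).map_target hy
    simpa using this)
  rw [contMDiffOn_iff_contDiffOn] at h2
  exact h2

theorem differentiableAt_gform (g : SmoothMetric n S) {c x : S}
    (hx : x ∈ (chartAt (Model n) c).source) :
    DifferentiableAt ℝ (gform g c) (extChartAt (𝓡 n) c x) :=
  ((contDiffOn_gform g c).contDiffAt ((isOpen_extChartAt_target c).mem_nhds
    ((extChartAt (𝓡 n) c).map_source (by simpa using hx)))).differentiableAt (by simp)

theorem gform_pos (g : SmoothMetric n S) {c x : S}
    (hx : x ∈ (chartAt (Model n) c).source) {v : Model n} (hv : v ≠ 0) :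
    0 < gform g c (extChartAt (𝓡 n) c x) v v := by
  rw [gform_extChartAt g hx]
  refine g.pos _ _ fun h => hv (vec_injective hx ?_)
  rw [h]
  simp [vec]

theorem metricMatrix_eq (g : SmoothMetric n S) {c x : S}
    (hx : x ∈ (chartAt (Model n) c).source) (i j : Fin n) :
    metricMatrix g c x i j = gform g c (extChartAt (𝓡 n) c x)
      (EuclideanSpace.single i 1) (EuclideanSpace.single j 1) := by
  rw [gform_extChartAt g hx]; rfl

theorem metricDeriv_eq (g : SmoothMetric n S) {c x : S}
    (hx : x ∈ (chartAt (Model n) c).source) (k i j : Fin n) :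
    metricDeriv g c x k i j = fderiv ℝ (gform g c) (extChartAt (𝓡 n) c x)
      (EuclideanSpace.single k 1) (EuclideanSpace.single i 1) (EuclideanSpace.single j 1) := by
  unfold metricDeriv dirDeriv
  have hd : MDifferentiableAt (𝓡 n) 𝓘(ℝ, ℝ) (fun y => metricMatrix g c y i j) x :=
    ((contMDiffOn_inner_vec g c _ _).contMDiffAt
      ((chartAt (Model n) c).open_source.mem_nhds hx)).mdifferentiableAt (by simp)
  rw [coordVec_eq_vec, mfderiv_real_vec hx hd]
  have h1 : ((fun y => metricMatrix g c y i j) ∘ (extChartAt (𝓡 n) c).symm) =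
      fun y => gform g c y (EuclideanSpace.single i 1) (EuclideanSpace.single j 1) := rfl
  have h2 := (((differentiableAt_gform g hx).hasFDerivAt.clm_apply
    (hasFDerivAt_const (EuclideanSpace.single i (1 : ℝ)) _)).clm_apply
    (hasFDerivAt_const (EuclideanSpace.single j (1 : ℝ)) _)).fderiv
  rw [h1, h2]
  simp

/-- The Christoffel symbols of the first kind of a field of bilinear forms. -/
def christoffelForm (G : Model n → Model n →L[ℝ] Model n →L[ℝ] ℝ) (y v u w : Model n) : ℝ :=
  (1 / 2 : ℝ) * (fderiv ℝ G y u w v + fderiv ℝ G y w u v - fderiv ℝ G y v u w)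

/-- The symbols of the first kind take arbitrary vectors as arguments and involve no inverse matrix.
This is what makes the change of charts manageable. -/
theorem christoffel_eq (g : SmoothMetric n S) {c x : S}
    (hx : x ∈ (chartAt (Model n) c).source) (k i j : Fin n) :
    christoffel g c x k i j = ∑ l, (metricMatrix g c x)⁻¹ k l *
      christoffelForm (gform g c) (extChartAt (𝓡 n) c x) (EuclideanSpace.single l 1)
        (EuclideanSpace.single i 1) (EuclideanSpace.single j 1) := by
  unfold christoffel christoffelForm
  rw [Finset.mul_sum]
  refine Finset.sum_congr rfl fun l _ => ?_
  rw [metricDeriv_eq g hx, metricDeriv_eq g hx, metricDeriv_eq g hx]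
  ring

theorem metricMatrix_posDef (g : SmoothMetric n S) {c x : S}
    (hx : x ∈ (chartAt (Model n) c).source) : (metricMatrix g c x).PosDef := by
  refine Matrix.PosDef.of_dotProduct_mulVec_pos ?_ ?_
  · ext i j
    simp only [Matrix.conjTranspose_apply, star_trivial]
    rw [metricMatrix_eq g hx, metricMatrix_eq g hx, gform_symm]
  · intro v hv
    have h := gform_pos g hx (v := WithLp.toLp 2 v) (by simpa using hv)
    have h2 : (WithLp.toLp 2 v : Model n) = ∑ i, v i • EuclideanSpace.single i (1 : ℝ) := by
      ext j; simp [Finset.sum_apply, Pi.single_apply]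
    rw [h2] at h
    simp only [map_sum, map_smul, sum_apply, smul_apply,
      smul_eq_mul] at h
    refine lt_of_lt_of_eq h ?_
    simp only [dotProduct, Matrix.mulVec, star_trivial, Finset.mul_sum]
    refine Finset.sum_congr rfl fun i _ => Finset.sum_congr rfl fun j _ => ?_
    rw [metricMatrix_eq g hx, gform_symm]
    ring

theorem isUnit_det_metricMatrix (g : SmoothMetric n S) {c x : S}
    (hx : x ∈ (chartAt (Model n) c).source) : IsUnit (metricMatrix g c x).det :=
  (metricMatrix_posDef g hx).det_pos.ne'.isUnit

theorem metricMatrix_symm (g : SmoothMetric n S) (c x : S) (i j : Fin n) :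
    metricMatrix g c x i j = metricMatrix g c x j i := g.symm _ _ _

theorem metricDeriv_symm (g : SmoothMetric n S) (c x : S) (k i j : Fin n) :
    metricDeriv g c x k i j = metricDeriv g c x k j i := by
  unfold metricDeriv
  simp_rw [fun y => metricMatrix_symm g c y i j]

/-- Lowering the upper index cancels the inverse metric; two such expressions add up to metric
compatibility. -/
theorem sum_metricMatrix_mul_christoffel (g : SmoothMetric n S) {c x : S}
    (hx : x ∈ (chartAt (Model n) c).source) (k i j : Fin n) :
    ∑ m, metricMatrix g c x k m * christoffel g c x m i j =
      (1 / 2 : ℝ) * (metricDeriv g c x i j k + metricDeriv g c x j i k -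
        metricDeriv g c x k i j) := by
  let w : Fin n → ℝ := fun l => (1 / 2 : ℝ) * (metricDeriv g c x i j l + metricDeriv g c x j i l -
        metricDeriv g c x l i j)
  have h1 : ∀ m, christoffel g c x m i j = ((metricMatrix g c x)⁻¹ *ᵥ w) m := by
    intro m
    simp only [christoffel, Matrix.mulVec, dotProduct, w, Finset.mul_sum]
    exact Finset.sum_congr rfl fun l _ => by ring
  simp_rw [h1]
  change (metricMatrix g c x *ᵥ ((metricMatrix g c x)⁻¹ *ᵥ w)) k = w k
  rw [Matrix.mulVec_mulVec, Matrix.mul_nonsing_inv _ (isUnit_det_metricMatrix g hx),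
    Matrix.one_mulVec]

/-- The Levi-Civita connection is compatible with the metric. -/
theorem metricDeriv_eq_christoffel (g : SmoothMetric n S) {c x : S}
    (hx : x ∈ (chartAt (Model n) c).source) (j i k : Fin n) :
    metricDeriv g c x j i k = ∑ m, metricMatrix g c x k m * christoffel g c x m j i +
      ∑ m, metricMatrix g c x i m * christoffel g c x m j k := by
  rw [sum_metricMatrix_mul_christoffel g hx, sum_metricMatrix_mul_christoffel g hx,
    metricDeriv_symm g c x j k i, metricDeriv_symm g c x i j k, metricDeriv_symm g c x k j i]
  ring

theorem christoffel_symm (g : SmoothMetric n S) (c x : S) (k i j : Fin n) :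
    christoffel g c x k i j = christoffel g c x k j i := by
  unfold christoffel
  congr 1
  refine Finset.sum_congr rfl fun l _ => ?_
  rw [metricDeriv_symm g c x l i j]
  ring

end MetricInCharts

/-! ### Tensoriality of `θ` under changes of charts of the base. -/

section ChangeOfCharts

variable {n : ℕ} {S : Type*} [TopologicalSpace S]
  [ChartedSpace (EuclideanSpace ℝ (Fin n)) S] [IsManifold (𝓡 n) ∞ S]

theorem sum_smul_single (v : Model n) : ∑ i, v i • EuclideanSpace.single i (1 : ℝ) = v := by
  ext j; simp [Finset.sum_apply, Pi.single_apply]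

theorem christoffelForm_sum_left (G : Model n → Model n →L[ℝ] Model n →L[ℝ] ℝ) (y u w : Model n)
    (a : Fin n → ℝ) (v : Fin n → Model n) :
    christoffelForm G y (∑ i, a i • v i) u w = ∑ i, a i * christoffelForm G y (v i) u w := by
  simp only [christoffelForm, map_sum, map_smul, sum_apply, smul_apply, smul_eq_mul,
    ← Finset.sum_add_distrib, ← Finset.sum_sub_distrib, Finset.mul_sum]
  exact Finset.sum_congr rfl fun i _ => by ring

theorem christoffelForm_sum_right (G : Model n → Model n →L[ℝ] Model n →L[ℝ] ℝ) (y v u : Model n)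
    (a : Fin n → ℝ) (w : Fin n → Model n) :
    christoffelForm G y v u (∑ i, a i • w i) = ∑ i, a i * christoffelForm G y v u (w i) := by
  simp only [christoffelForm, map_sum, map_smul, sum_apply, smul_apply, smul_eq_mul,
    ← Finset.sum_add_distrib, ← Finset.sum_sub_distrib, Finset.mul_sum]
  exact Finset.sum_congr rfl fun i _ => by ring

theorem christoffelForm_sum_mid (G : Model n → Model n →L[ℝ] Model n →L[ℝ] ℝ) (y v w : Model n)
    (a : Fin n → ℝ) (u : Fin n → Model n) :
    christoffelForm G y v (∑ i, a i • u i) w = ∑ i, a i * christoffelForm G y v (u i) w := by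
  simp only [christoffelForm, map_sum, map_smul, sum_apply, smul_apply, smul_eq_mul,
    ← Finset.sum_add_distrib, ← Finset.sum_sub_distrib, Finset.mul_sum]
  exact Finset.sum_congr rfl fun i _ => by ring

/-- The coordinates of the vector that is dual to the covector `z`, in the chart around `c`. -/
def raise (g : SmoothMetric n S) (c : S) (z : CotangentBundle n S) : Model n :=
  WithLp.toLp 2 ((metricMatrix g c z.proj)⁻¹ *ᵥ fun k => p c k z)

/-- Metric duality characterizes `raise` without inverse matrices, by `σσ⁻¹ = 1`. -/
theorem gform_raise (g : SmoothMetric n S) {c : S} {z : CotangentBundle n S}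
    (hz : z.proj ∈ (chartAt (Model n) c).source) (w : Model n) :
    gform g c (extChartAt (𝓡 n) c z.proj) (raise g c z) w = (cotChart c z).2 w := by
  have key : ∀ i : Fin n, gform g c (extChartAt (𝓡 n) c z.proj) (raise g c z)
      (EuclideanSpace.single i 1) = (cotChart c z).2 (EuclideanSpace.single i 1) := by
    intro i
    rw [← p_eq hz, gform_symm, ← sum_smul_single (raise g c z)]
    simp only [map_sum, map_smul, smul_eq_mul, ← metricMatrix_eq g hz]
    have h := congrFun (Matrix.mulVec_mulVec (fun k => p c k z) (metricMatrix g c z.proj)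
      (metricMatrix g c z.proj)⁻¹) i
    rw [Matrix.mul_nonsing_inv _ (isUnit_det_metricMatrix g hz), Matrix.one_mulVec] at h
    rw [← h]
    simp only [Matrix.mulVec, dotProduct, raise]
    exact Finset.sum_congr rfl fun j _ => mul_comm _ _
  rw [← sum_smul_single w]
  simp only [map_sum, map_smul, key]

theorem gform_left_injective (g : SmoothMetric n S) {c x : S}
    (hx : x ∈ (chartAt (Model n) c).source) {v v' : Model n}
    (h : ∀ w, gform g c (extChartAt (𝓡 n) c x) v w = gform g c (extChartAt (𝓡 n) c x) v' w) :
    v = v' := by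
  by_contra hne
  have := gform_pos g hx (sub_ne_zero.2 hne)
  have h2 := h (v - v')
  simp only [map_sub, sub_apply] at this h2
  linarith

/-- The covector `θ(V)`, in the chart around `c`. -/
def thetaForm (g : SmoothMetric n S) (c : S) (z : CotangentBundle n S)
    (V : TangentSpace (cotangentModel n) z) (u : Model n) : ℝ :=
  (dCot c z V).2 u - christoffelForm (gform g c) (extChartAt (𝓡 n) c z.proj) (raise g c z) u
    (dCot c z V).1

/-- The contraction `Λ_{ih}^k p_k dq^h` is the symbol of the first kind with the raised covector in
its first slot. This frees `θ` of indices. -/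
theorem theta_eq (g : SmoothMetric n S) {c : S} {z : CotangentBundle n S}
    (hz : z.proj ∈ (chartAt (Model n) c).source) (i : Fin n)
    (V : TangentSpace (cotangentModel n) z) :
    theta g c i z V = thetaForm g c z V (EuclideanSpace.single i 1) := by
  unfold theta thetaForm
  rw [dp_eq hz]
  congr 1
  rw [← sum_smul_single (dCot c z V).1, christoffelForm_sum_right]
  refine Finset.sum_congr rfl fun h _ => ?_
  rw [← sum_smul_single (raise g c z), christoffelForm_sum_left, Finset.mul_sum]
  simp_rw [christoffel_eq g hz, raise, Matrix.mulVec, dotProduct, Finset.sum_mul, dq_eq hz,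
    Finset.mul_sum]
  rw [Finset.sum_comm]
  refine Finset.sum_congr rfl fun l _ => Finset.sum_congr rfl fun k _ => ?_
  have hs : (metricMatrix g c z.proj)⁻¹ k l = (metricMatrix g c z.proj)⁻¹ l k := by
    have := (metricMatrix_posDef g hz).isHermitian.inv
    have h2 := congrFun (congrFun this l) k
    simpa using h2
  rw [hs]
  ring

theorem thetaForm_sum (g : SmoothMetric n S) (c : S) (z : CotangentBundle n S)
    (V : TangentSpace (cotangentModel n) z) (a : Fin n → ℝ) (u : Fin n → Model n) :
    thetaForm g c z V (∑ i, a i • u i) = ∑ i, a i * thetaForm g c z V (u i) := by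
  unfold thetaForm
  rw [christoffelForm_sum_mid]
  simp only [map_sum, map_smul, smul_eq_mul, mul_sub, Finset.sum_sub_distrib]

/-- The change of coordinates between the charts around `c` and `c'`. -/
def transition (c c' : S) : Model n → Model n :=
  extChartAt (𝓡 n) c' ∘ (extChartAt (𝓡 n) c).symm

theorem contDiffAt_transition {c c' x : S} (hx : x ∈ (chartAt (Model n) c).source)
    (hx' : x ∈ (chartAt (Model n) c').source) :
    ContDiffAt ℝ ∞ (transition (n := n) c c') (extChartAt (𝓡 n) c x) := by
  have h := contDiffWithinAt_ext_coord_change (I := 𝓡 n) (n := ∞) c' c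
    (y := extChartAt (𝓡 n) c x) (by
      rw [PartialEquiv.trans_source, PartialEquiv.symm_source]
      refine ⟨(extChartAt (𝓡 n) c).map_source (by simpa using hx), ?_⟩
      rw [Set.mem_preimage, (extChartAt (𝓡 n) c).left_inv (by simpa using hx)]
      simpa using hx')
  rwa [modelWithCornersSelf_coe, Set.range_id, contDiffWithinAt_univ] at h

theorem transition_extChartAt {c x : S} (c' : S) (hx : x ∈ (chartAt (Model n) c).source) :
    transition c c' (extChartAt (𝓡 n) c x) = extChartAt (𝓡 n) c' x := by
  simp only [transition, Function.comp_apply]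
  rw [(extChartAt (𝓡 n) c).left_inv (by simpa using hx)]

theorem eventually_overlap {c c' x : S} (hx : x ∈ (chartAt (Model n) c).source)
    (hx' : x ∈ (chartAt (Model n) c').source) :
    ∀ᶠ y in nhds (extChartAt (𝓡 n) c x), ∃ x₁ ∈ (chartAt (Model n) c).source,
      x₁ ∈ (chartAt (Model n) c').source ∧ y = extChartAt (𝓡 n) c x₁ := by
  have h1 : (extChartAt (𝓡 n) c).target ∈ nhds (extChartAt (𝓡 n) c x) :=
    (isOpen_extChartAt_target c).mem_nhds ((extChartAt (𝓡 n) c).map_source (by simpa using hx))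
  have h2 := continuousAt_extChartAt_symm' (I := 𝓡 n) (x := c) (x' := x) (by simpa using hx)
  have h3 : ∀ᶠ y in nhds (extChartAt (𝓡 n) c x),
      (extChartAt (𝓡 n) c).symm y ∈ (chartAt (Model n) c').source := by
    refine h2.eventually ((chartAt (Model n) c').open_source.mem_nhds ?_)
    rwa [(extChartAt (𝓡 n) c).left_inv (by simpa using hx)]
  filter_upwards [h1, h3] with y hy1 hy3
  refine ⟨(extChartAt (𝓡 n) c).symm y, ?_, hy3, ((extChartAt (𝓡 n) c).right_inv hy1).symm⟩
  simpa using (extChartAt (𝓡 n) c).map_target hy1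

theorem vec_transition {c c' x : S} (hx : x ∈ (chartAt (Model n) c).source)
    (hx' : x ∈ (chartAt (Model n) c').source) (v : Model n) :
    vec c x v = vec c' x (fderiv ℝ (transition c c') (extChartAt (𝓡 n) c x) v) := by
  obtain ⟨w, hw⟩ := vec_surjective hx' (vec c x v)
  have hd : MDifferentiableAt (𝓡 n) 𝓘(ℝ, Model n) (extChartAt (𝓡 n) c') x :=
    mdifferentiableAt_extChartAt hx'
  have h1 := mfderiv_real_vec hx hd v
  have h2 := mfderiv_real_vec hx' hd w
  have h3 : (extChartAt (𝓡 n) c' ∘ (extChartAt (𝓡 n) c').symm) =ᶠ[nhds (extChartAt (𝓡 n) c' x)]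
      id := by
    filter_upwards [(isOpen_extChartAt_target c').mem_nhds
      ((extChartAt (𝓡 n) c').map_source (by simpa using hx'))] with y hy
    exact (extChartAt (𝓡 n) c').right_inv hy
  rw [h3.fderiv_eq, fderiv_id, hw, h1] at h2
  rw [← hw]
  congr 1
  exact h2.symm

theorem gform_transition (g : SmoothMetric n S) {c c' x : S}
    (hx : x ∈ (chartAt (Model n) c).source) (hx' : x ∈ (chartAt (Model n) c').source)
    (v w : Model n) :
    gform g c (extChartAt (𝓡 n) c x) v w = gform g c' (extChartAt (𝓡 n) c' x)
      (fderiv ℝ (transition c c') (extChartAt (𝓡 n) c x) v)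
      (fderiv ℝ (transition c c') (extChartAt (𝓡 n) c x) w) := by
  rw [gform_extChartAt g hx, gform_extChartAt g hx', ← vec_transition hx hx',
    ← vec_transition hx hx']

theorem minSmoothness_two_le : minSmoothness ℝ 2 ≤ (∞ : WithTop ℕ∞) := by
  rw [minSmoothness_of_isRCLikeNormedField]
  exact WithTop.coe_le_coe.2 (le_top : (2 : ℕ∞) ≤ ⊤)

/-- Leibniz and chain rule for the pullback of a bilinear form. The two terms with the second
derivative of `τ` are the source of the inhomogeneous term in the law for the Christoffel symbols.
-/
theorem fderiv_pullback_bilinear {E : Type*} [NormedAddCommGroup E] [NormedSpace ℝ E]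
    {G G' : E → E →L[ℝ] E →L[ℝ] ℝ} {τ : E → E} {y : E}
    (hG : DifferentiableAt ℝ G y) (hG' : DifferentiableAt ℝ G' (τ y))
    (hτ : DifferentiableAt ℝ τ y) (hτ' : DifferentiableAt ℝ (fderiv ℝ τ) y)
    (h : ∀ v w, ∀ᶠ y in nhds y, G y v w = G' (τ y) (fderiv ℝ τ y v) (fderiv ℝ τ y w))
    (k v w : E) :
    fderiv ℝ G y k v w = fderiv ℝ G' (τ y) (fderiv ℝ τ y k) (fderiv ℝ τ y v) (fderiv ℝ τ y w) +
      G' (τ y) (fderiv ℝ (fderiv ℝ τ) y k v) (fderiv ℝ τ y w) +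
      G' (τ y) (fderiv ℝ τ y v) (fderiv ℝ (fderiv ℝ τ) y k w) := by
  have h3 : HasFDerivAt (fun y => G' (τ y)) _ y := 
    HasFDerivAt.comp (g := G') y hG'.hasFDerivAt hτ.hasFDerivAt
  have h4 := ((h3.clm_apply
    (hτ'.hasFDerivAt.clm_apply (hasFDerivAt_const v y))).clm_apply
    (hτ'.hasFDerivAt.clm_apply (hasFDerivAt_const w y)))
  have h6 := (hG.hasFDerivAt.clm_apply (hasFDerivAt_const v _)).clm_apply (hasFDerivAt_const w _)
  have h7 := congrArg (fun L => L k) (h6.unique (h4.congr_of_eventuallyEq (h v w)))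
  simp at h7
  rw [h7]
  ring

theorem fderiv_gform_transition (g : SmoothMetric n S) {c c' x : S}
    (hx : x ∈ (chartAt (Model n) c).source) (hx' : x ∈ (chartAt (Model n) c').source)
    (k v w : Model n) :
    fderiv ℝ (gform g c) (extChartAt (𝓡 n) c x) k v w =
      fderiv ℝ (gform g c') (extChartAt (𝓡 n) c' x)
        (fderiv ℝ (transition c c') (extChartAt (𝓡 n) c x) k)
        (fderiv ℝ (transition c c') (extChartAt (𝓡 n) c x) v)
        (fderiv ℝ (transition c c') (extChartAt (𝓡 n) c x) w) +
      gform g c' (extChartAt (𝓡 n) c' x)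
        (fderiv ℝ (fderiv ℝ (transition c c')) (extChartAt (𝓡 n) c x) k v)
        (fderiv ℝ (transition c c') (extChartAt (𝓡 n) c x) w) +
      gform g c' (extChartAt (𝓡 n) c' x)
        (fderiv ℝ (transition c c') (extChartAt (𝓡 n) c x) v)
        (fderiv ℝ (fderiv ℝ (transition c c')) (extChartAt (𝓡 n) c x) k w) := by
  have hτd := contDiffAt_transition (n := n) hx hx'
  have hτy := transition_extChartAt (n := n) c' hx
  have h := fderiv_pullback_bilinear (G' := gform g c') (differentiableAt_gform g hx)
    (by rw [hτy]; exact differentiableAt_gform g hx') (hτd.differentiableAt (by simp))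
    ((hτd.fderiv_right (m := 1) (by norm_cast)).differentiableAt (by simp)) (fun v w => by
      filter_upwards [eventually_overlap hx hx'] with y₁ ⟨x₁, h, h', e⟩
      rw [e, gform_transition g h h', transition_extChartAt c' h]) k v w
  rwa [hτy] at h

/-- The transformation law of the Christoffel symbols. -/
theorem christoffelForm_transition (g : SmoothMetric n S) {c c' x : S}
    (hx : x ∈ (chartAt (Model n) c).source) (hx' : x ∈ (chartAt (Model n) c').source)
    (v u w : Model n) :
    christoffelForm (gform g c) (extChartAt (𝓡 n) c x) v u w =
      christoffelForm (gform g c') (extChartAt (𝓡 n) c' x)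
        (fderiv ℝ (transition c c') (extChartAt (𝓡 n) c x) v)
        (fderiv ℝ (transition c c') (extChartAt (𝓡 n) c x) u)
        (fderiv ℝ (transition c c') (extChartAt (𝓡 n) c x) w) +
      gform g c' (extChartAt (𝓡 n) c' x)
        (fderiv ℝ (transition c c') (extChartAt (𝓡 n) c x) v)
        (fderiv ℝ (fderiv ℝ (transition c c')) (extChartAt (𝓡 n) c x) u w) := by
  -- By symmetry of the second derivative, four of the six second-order terms cancel and the other
  -- two coincide, which absorbs the factor `1/2`.
  have hs : ∀ a b, fderiv ℝ (fderiv ℝ (transition (n := n) c c')) (extChartAt (𝓡 n) c x) a b =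
      fderiv ℝ (fderiv ℝ (transition c c')) (extChartAt (𝓡 n) c x) b a :=
    (contDiffAt_transition hx hx').isSymmSndFDerivAt minSmoothness_two_le
  unfold christoffelForm
  rw [fderiv_gform_transition g hx hx', fderiv_gform_transition g hx hx',
    fderiv_gform_transition g hx hx', hs w u, hs v u, hs v w]
  simp only [gform_symm g c' _ (fderiv ℝ (fderiv ℝ (transition c c')) _ _ _)]
  ring

theorem cotChart_fst_transition {c c' : S} {z : CotangentBundle n S}
    (hz : z.proj ∈ (chartAt (Model n) c).source) :
    (cotChart c' z).1 = transition c c' (cotChart c z).1 := by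
  rw [cotChart_fst, cotChart_fst, transition_extChartAt c' hz]

theorem cotChart_snd_transition {c c' : S} {z : CotangentBundle n S}
    (hz : z.proj ∈ (chartAt (Model n) c).source) (hz' : z.proj ∈ (chartAt (Model n) c').source)
    (u : Model n) :
    (cotChart c z).2 u = (cotChart c' z).2 (fderiv ℝ (transition c c') (cotChart c z).1 u) := by
  rw [cotChart_snd hz, cotChart_snd hz', cotChart_fst, vec_transition hz hz']

theorem hasMFDerivAt_cotChart {c : S} {z : CotangentBundle n S}
    (hz : z.proj ∈ (chartAt (Model n) c).source) :
    HasMFDerivAt (cotangentModel n) 𝓘(ℝ, PhaseModel n) (cotChart c) z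
      (mfderiv (cotangentModel n) 𝓘(ℝ, PhaseModel n) (cotChart c) z) :=
  (mdifferentiableAt_cotChart hz).hasMFDerivAt

theorem dCot_fst_transition {c c' : S} {z : CotangentBundle n S}
    (hz : z.proj ∈ (chartAt (Model n) c).source) (hz' : z.proj ∈ (chartAt (Model n) c').source)
    (V : TangentSpace (cotangentModel n) z) :
    (dCot c' z V).1 =
      fderiv ℝ (transition c c') (extChartAt (𝓡 n) c z.proj) (dCot c z V).1 := by
  have h1 := (hasFDerivAt_fst (𝕜 := ℝ) (p := cotChart c' z)).hasMFDerivAt.comp z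
    (hasMFDerivAt_cotChart hz')
  have h2 : HasFDerivAt (fun a : PhaseModel n => transition c c' a.1) _ (cotChart c z) :=
    HasFDerivAt.comp (g := transition c c') (cotChart c z)
      (by rw [cotChart_fst]
          exact ((contDiffAt_transition hz hz').differentiableAt (by simp)).hasFDerivAt)
      hasFDerivAt_fst
  have h3 := h2.hasMFDerivAt.comp z (hasMFDerivAt_cotChart hz)
  have h4 := hasMFDerivAt_unique h1 (h3.congr_of_eventuallyEq (by
    filter_upwards [(isOpen_proj_preimage c).mem_nhds hz] with w hw
    exact cotChart_fst_transition hw))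
  exact congrArg (fun L => L V) h4

theorem hasMFDerivAt_prodMk_space {E H X F₁ F₂ : Type*} [NormedAddCommGroup E] [NormedSpace ℝ E]
    [TopologicalSpace H] {I : ModelWithCorners ℝ E H} [TopologicalSpace X] [ChartedSpace H X]
    [NormedAddCommGroup F₁] [NormedSpace ℝ F₁] [NormedAddCommGroup F₂] [NormedSpace ℝ F₂]
    {f₁ : X → F₁} {f₂ : X → F₂} {x : X} {L₁ : TangentSpace I x →L[ℝ] F₁}
    {L₂ : TangentSpace I x →L[ℝ] F₂} (h₁ : HasMFDerivAt I 𝓘(ℝ, F₁) f₁ x L₁)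
    (h₂ : HasMFDerivAt I 𝓘(ℝ, F₂) f₂ x L₂) :
    HasMFDerivAt I 𝓘(ℝ, F₁ × F₂) (fun y => (f₁ y, f₂ y)) x (L₁.prod L₂) :=
  ⟨h₁.1.prodMk h₂.1, h₁.2.prodMk h₂.2⟩

/-- Differentiate `p(u) = p'(Dτ(q) u)` for fixed `u`: besides `dp'` there appears the derivative of
`Dτ` along the motion of the base point. -/
theorem dCot_snd_transition {c c' : S} {z : CotangentBundle n S}
    (hz : z.proj ∈ (chartAt (Model n) c).source) (hz' : z.proj ∈ (chartAt (Model n) c').source)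
    (V : TangentSpace (cotangentModel n) z) (u : Model n) :
    (dCot c z V).2 u =
      (dCot c' z V).2 (fderiv ℝ (transition c c') (extChartAt (𝓡 n) c z.proj) u) +
      (cotChart c' z).2 (fderiv ℝ (fderiv ℝ (transition c c')) (extChartAt (𝓡 n) c z.proj)
        (dCot c z V).1 u) := by
  have e := cotChart_fst c z
  have hτd := contDiffAt_transition (n := n) hz hz'
  rw [← e] at hτd ⊢
  have h2 : HasFDerivAt (fderiv ℝ (transition c c')) (fderiv ℝ (fderiv ℝ (transition c c'))
      (cotChart c z).1) (cotChart c z).1 :=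
    ((hτd.fderiv_right (m := 1) (by norm_cast)).differentiableAt (by simp)).hasFDerivAt
  have h3 : HasFDerivAt (fun a : PhaseModel n × PhaseModel n =>
      a.2.2 (fderiv ℝ (transition c c') a.1.1 u)) _ (cotChart c z, cotChart c' z) :=
    (hasFDerivAt_snd.comp _ hasFDerivAt_snd).clm_apply
      ((HasFDerivAt.comp (g := fderiv ℝ (transition c c')) (cotChart c z, cotChart c' z) h2
        (hasFDerivAt_fst.comp _ hasFDerivAt_fst)).clm_apply (hasFDerivAt_const u _))
  have h4 := h3.hasMFDerivAt.comp z (f := fun w => (cotChart c w, cotChart c' w))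
    (hasMFDerivAt_prodMk_space (hasMFDerivAt_cotChart hz) (hasMFDerivAt_cotChart hz'))
  have h5 : HasFDerivAt (fun a : PhaseModel n => a.2 u) _ (cotChart c z) :=
    hasFDerivAt_snd.clm_apply (hasFDerivAt_const u _)
  have h6 := h5.hasMFDerivAt.comp z (hasMFDerivAt_cotChart hz)
  have h7 := hasMFDerivAt_unique h6 (h4.congr_of_eventuallyEq (by
    filter_upwards [(isOpen_proj_preimage c).mem_nhds hz,
      (isOpen_proj_preimage c').mem_nhds hz'] with w hw hw'
    exact cotChart_snd_transition hw hw' u))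
  have h8 : (cotChart c z).2 0 + (dCot c z V).2 u = _ := congrArg (fun L => L V) h7
  rw [map_zero, zero_add] at h8
  rw [h8]
  change (cotChart c' z).2 (fderiv ℝ (transition c c') (cotChart c z).1 0 +
    fderiv ℝ (fderiv ℝ (transition c c')) (cotChart c z).1 (dCot c z V).1 u) +
    (dCot c' z V).2 (fderiv ℝ (transition c c') (cotChart c z).1 u) = _
  rw [map_zero, zero_add, add_comm]

/-- Both vectors are dual to the same covector, and the metric is nondegenerate. -/
theorem raise_transition (g : SmoothMetric n S) {c c' : S} {z : CotangentBundle n S}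
    (hz : z.proj ∈ (chartAt (Model n) c).source) (hz' : z.proj ∈ (chartAt (Model n) c').source) :
    raise g c' z = fderiv ℝ (transition c c') (extChartAt (𝓡 n) c z.proj) (raise g c z) := by
  refine gform_left_injective g hz' fun w => ?_
  obtain ⟨w', hw'⟩ := vec_surjective hz (vec c' z.proj w)
  rw [vec_transition hz hz'] at hw'
  rw [gform_raise g hz', ← vec_injective hz' hw', ← gform_transition g hz hz', gform_raise g hz,
    cotChart_snd_transition hz hz', cotChart_fst]

/-- The second-order term in the transformation of `dp` cancels against the inhomogeneous term of
the Christoffel symbols, because pairing with the raised covector is evaluation of `p'`. So `θ` is a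
tensor although `dp` is not. -/
theorem thetaForm_transition (g : SmoothMetric n S) {c c' : S} {z : CotangentBundle n S}
    (hz : z.proj ∈ (chartAt (Model n) c).source) (hz' : z.proj ∈ (chartAt (Model n) c').source)
    (V : TangentSpace (cotangentModel n) z) (u : Model n) :
    thetaForm g c z V u = thetaForm g c' z V
      (fderiv ℝ (transition c c') (extChartAt (𝓡 n) c z.proj) u) := by
  unfold thetaForm
  have hs : ∀ a b, fderiv ℝ (fderiv ℝ (transition (n := n) c c')) (extChartAt (𝓡 n) c z.proj) a b =
      fderiv ℝ (fderiv ℝ (transition c c')) (extChartAt (𝓡 n) c z.proj) b a :=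
    (contDiffAt_transition hz hz').isSymmSndFDerivAt minSmoothness_two_le
  rw [dCot_snd_transition hz hz', christoffelForm_transition g hz hz',
    ← dCot_fst_transition hz hz', ← raise_transition g hz hz', gform_raise g hz', hs u]
  ring

end ChangeOfCharts

/-! ### Linear algebra of the matrix `W = Aσ + √-1 B`. -/

section PhaseAlgebra

variable {n : ℕ}

/-- A real matrix as a complex matrix. -/
abbrev complexify : Matrix (Fin n) (Fin n) ℝ →+* Matrix (Fin n) (Fin n) ℂ :=
  Complex.ofRealHom.mapMatrix

theorem conjTranspose_complexify (A : Matrix (Fin n) (Fin n) ℝ) :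
    (complexify A)ᴴ = complexify Aᵀ := by
  ext i j; simp

theorem det_complexify (A : Matrix (Fin n) (Fin n) ℝ) :
    (complexify A).det = (A.det : ℂ) := (Complex.ofRealHom.map_det A).symm

/-- The matrix of `dq + √-1 σ⁻¹ θ` on a frame with components `A`, `B`, multiplied by `σ`. -/
def hermMatrix (σ A B : Matrix (Fin n) (Fin n) ℝ) : Matrix (Fin n) (Fin n) ℂ :=
  complexify (A * σ) + Complex.I • complexify B

theorem hermMatrix_conjTranspose {σ : Matrix (Fin n) (Fin n) ℝ} (hσ : σᵀ = σ)
    (A B : Matrix (Fin n) (Fin n) ℝ) :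
    (hermMatrix σ A B)ᴴ = complexify (σ * Aᵀ) - Complex.I • complexify Bᵀ := by
  unfold hermMatrix
  rw [Matrix.conjTranspose_add, Matrix.conjTranspose_smul, conjTranspose_complexify,
    conjTranspose_complexify, Matrix.transpose_mul, hσ]
  simp [sub_eq_add_neg]

/-- Expanding `(Aσ + √-1 B) σ⁻¹ (σAᵀ - √-1 Bᵀ)` gives the Gram matrix plus `√-1 (BAᵀ - ABᵀ)`. The
imaginary part is, up to sign, the symplectic form on the frame, which vanishes in the Lagrangian
case. -/
theorem gram_eq_herm {σ : Matrix (Fin n) (Fin n) ℝ} (hσ : σᵀ = σ) (hu : IsUnit σ.det)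
    {A B : Matrix (Fin n) (Fin n) ℝ} (hAB : A * Bᵀ = B * Aᵀ) :
    complexify (A * σ * Aᵀ + B * σ⁻¹ * Bᵀ) =
      hermMatrix σ A B * complexify σ⁻¹ * (hermMatrix σ A B)ᴴ := by
  rw [hermMatrix_conjTranspose hσ]
  unfold hermMatrix
  have h1 : A * σ * σ⁻¹ = A := by rw [Matrix.mul_assoc, Matrix.mul_nonsing_inv _ hu, Matrix.mul_one]
  have h2 : B * σ⁻¹ * (σ * Aᵀ) = B * Aᵀ := by
    rw [Matrix.mul_assoc, ← Matrix.mul_assoc σ⁻¹, Matrix.nonsing_inv_mul _ hu, Matrix.one_mul]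
  have h3 : Complex.I • Complex.I • complexify (B * σ⁻¹ * Bᵀ) = - complexify (B * σ⁻¹ * Bᵀ) := by
    rw [smul_smul, Complex.I_mul_I, neg_smul, one_smul]
  simp only [add_mul, mul_sub, Matrix.smul_mul, Matrix.mul_smul, ← map_mul, h1, h2]
  rw [h3, ← Matrix.mul_assoc, hAB, map_add]
  abel

theorem hermMatrix_eq_mul {σ : Matrix (Fin n) (Fin n) ℝ} (hu : IsUnit σ.det)
    (A B : Matrix (Fin n) (Fin n) ℝ) :
    hermMatrix σ A B = (complexify A + Complex.I • complexify (B * σ⁻¹)) * complexify σ := by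
  rw [hermMatrix, add_mul, Matrix.smul_mul, ← map_mul, ← map_mul, Matrix.mul_assoc B,
    Matrix.nonsing_inv_mul _ hu, Matrix.mul_one]

theorem det_gram {σ : Matrix (Fin n) (Fin n) ℝ} (hσ : σᵀ = σ) (hu : IsUnit σ.det)
    {A B : Matrix (Fin n) (Fin n) ℝ} (hAB : A * Bᵀ = B * Aᵀ) :
    (((A * σ * Aᵀ + B * σ⁻¹ * Bᵀ).det : ℝ) : ℂ) = (hermMatrix σ A B).det * (σ.det : ℂ)⁻¹ *
      starRingEnd ℂ (hermMatrix σ A B).det := by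
  rw [← det_complexify, gram_eq_herm hσ hu hAB, Matrix.det_mul, Matrix.det_mul,
    Matrix.det_conjTranspose, det_complexify, Matrix.det_nonsing_inv, Ring.inverse_eq_inv']
  simp

/-- The squared phase in terms of the Hermitian matrix of the frame. -/
theorem phase_ratio {σ : Matrix (Fin n) (Fin n) ℝ} (hσ : σᵀ = σ) (hpos : 0 < σ.det)
    {A B : Matrix (Fin n) (Fin n) ℝ} (hAB : A * Bᵀ = B * Aᵀ) :
    ((Real.sqrt σ.det : ℂ) * (complexify A + Complex.I • complexify (B * σ⁻¹)).det) ^ 2 /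
      (((A * σ * Aᵀ + B * σ⁻¹ * Bᵀ).det : ℝ) : ℂ) =
      (hermMatrix σ A B).det / starRingEnd ℂ (hermMatrix σ A B).det := by
  have hs : ((Real.sqrt σ.det : ℝ) : ℂ) ^ 2 = (σ.det : ℂ) := by
    rw [← Complex.ofReal_pow, Real.sq_sqrt hpos.le]
  have h0 : (σ.det : ℂ) ≠ 0 := by exact_mod_cast hpos.ne'
  -- The numerator equals `(det W)² / det σ` and the denominator `|det W|² / det σ`.
  rw [det_gram hσ hpos.ne'.isUnit hAB, mul_pow, hs, hermMatrix_eq_mul hpos.ne'.isUnit,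
    Matrix.det_mul, det_complexify]
  set d := (complexify A + Complex.I • complexify (B * σ⁻¹)).det
  simp only [map_mul, Complex.conj_ofReal]
  by_cases hd : d = 0
  · simp [hd]
  have hd' : starRingEnd ℂ d ≠ 0 := by simpa using hd
  field_simp

end PhaseAlgebra

/-! ### The matrix `W` of a frame, and its dependence on both charts. -/

section Phase

variable {n : ℕ} {S : Type*} [TopologicalSpace S]
  [ChartedSpace (EuclideanSpace ℝ (Fin n)) S] [IsManifold (𝓡 n) ∞ S]
  {M : Type*} [TopologicalSpace M]
  [ChartedSpace (EuclideanSpace ℝ (Fin n)) M] [IsManifold (𝓡 n) ∞ M]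

/-- The components `dq^k(V_i)` of a family of vectors. -/
def dqMatrix (c : S) (z : CotangentBundle n S) (V : Fin n → TangentSpace (cotangentModel n) z) :
    Matrix (Fin n) (Fin n) ℝ := Matrix.of fun i k => dq c k z (V i)

/-- The components `θ_k(V_i)` of a family of vectors. -/
def thetaMatrix (g : SmoothMetric n S) (c : S) (z : CotangentBundle n S)
    (V : Fin n → TangentSpace (cotangentModel n) z) :
    Matrix (Fin n) (Fin n) ℝ := Matrix.of fun i k => theta g c k z (V i)

/-- The Hermitian matrix of a family of vectors in the chart around `c`. -/
def phaseMatrix (g : SmoothMetric n S) (c : S) (z : CotangentBundle n S)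
    (V : Fin n → TangentSpace (cotangentModel n) z) : Matrix (Fin n) (Fin n) ℂ :=
  hermMatrix (metricMatrix g c z.proj) (dqMatrix c z V) (thetaMatrix g c z V)

/-- The linear form `σ(dq(V), ·) + √-1 θ(V)` in the chart around `c`. -/
def phaseForm (g : SmoothMetric n S) (c : S) (z : CotangentBundle n S)
    (V : TangentSpace (cotangentModel n) z) (u : Model n) : ℂ :=
  (gform g c (extChartAt (𝓡 n) c z.proj) (dCot c z V).1 u : ℂ) +
    Complex.I * (thetaForm g c z V u : ℂ)

theorem phaseMatrix_apply (g : SmoothMetric n S) {c : S} {z : CotangentBundle n S}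
    (hz : z.proj ∈ (chartAt (Model n) c).source) (V : Fin n → TangentSpace (cotangentModel n) z)
    (i k : Fin n) :
    phaseMatrix g c z V i k = phaseForm g c z (V i) (EuclideanSpace.single k 1) := by
  have h1 : (dqMatrix c z V * metricMatrix g c z.proj) i k =
      gform g c (extChartAt (𝓡 n) c z.proj) (dCot c z (V i)).1 (EuclideanSpace.single k 1) := by
    rw [Matrix.mul_apply]
    conv_rhs => rw [← sum_smul_single (dCot c z (V i)).1]
    simp only [map_sum, map_smul, sum_apply, smul_apply, smul_eq_mul, dqMatrix, Matrix.of_apply,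
      dq_eq hz, metricMatrix_eq g hz]
  simp only [phaseMatrix, hermMatrix, phaseForm, Matrix.add_apply, Matrix.smul_apply,
    RingHom.mapMatrix_apply, Matrix.map_apply, h1, smul_eq_mul]
  rw [← theta_eq g hz]
  rfl

theorem phaseForm_sum_vec (g : SmoothMetric n S) (c : S) (z : CotangentBundle n S)
    (V : TangentSpace (cotangentModel n) z) (a : Fin n → ℝ) (u : Fin n → Model n) :
    phaseForm g c z V (∑ i, a i • u i) = ∑ i, phaseForm g c z V (u i) * (a i : ℂ) := by
  unfold phaseForm
  rw [thetaForm_sum]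
  simp only [map_sum, map_smul, smul_eq_mul, Complex.ofReal_sum, Complex.ofReal_mul,
    Finset.mul_sum, ← Finset.sum_add_distrib]
  exact Finset.sum_congr rfl fun i _ => by ring

theorem thetaForm_add (g : SmoothMetric n S) (c : S) (z : CotangentBundle n S)
    (V W : TangentSpace (cotangentModel n) z) (u : Model n) :
    thetaForm g c z (V + W) u = thetaForm g c z V u + thetaForm g c z W u := by
  unfold thetaForm christoffelForm
  rw [dCot_add]
  simp only [Prod.fst_add, Prod.snd_add, map_add, add_apply]
  ring

theorem thetaForm_smul (g : SmoothMetric n S) (c : S) (z : CotangentBundle n S) (r : ℝ)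
    (V : TangentSpace (cotangentModel n) z) (u : Model n) :
    thetaForm g c z (r • V) u = r * thetaForm g c z V u := by
  unfold thetaForm christoffelForm
  rw [dCot_smul]
  simp only [Prod.smul_fst, Prod.smul_snd, map_smul, smul_apply, smul_eq_mul]
  ring

/-- `phaseForm` as a linear map in the tangent vector. -/
def phaseFormₗ (g : SmoothMetric n S) (c : S) (z : CotangentBundle n S) (u : Model n) :
    TangentSpace (cotangentModel n) z →ₗ[ℝ] ℂ where
  toFun V := phaseForm g c z V u
  map_add' V W := by
    unfold phaseForm
    rw [thetaForm_add, dCot_add, Prod.fst_add, map_add, add_apply]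
    push_cast
    ring
  map_smul' r V := by
    unfold phaseForm
    rw [thetaForm_smul, dCot_smul, Prod.smul_fst, map_smul, smul_apply, smul_eq_mul]
    simp only [RingHom.id_apply, Complex.real_smul]
    push_cast
    ring

theorem phaseForm_transition (g : SmoothMetric n S) {c c' : S} {z : CotangentBundle n S}
    (hz : z.proj ∈ (chartAt (Model n) c).source) (hz' : z.proj ∈ (chartAt (Model n) c').source)
    (V : TangentSpace (cotangentModel n) z) (u : Model n) :
    phaseForm g c z V u = phaseForm g c' z V
      (fderiv ℝ (transition c c') (extChartAt (𝓡 n) c z.proj) u) := by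
  unfold phaseForm
  rw [thetaForm_transition g hz hz', gform_transition g hz hz', ← dCot_fst_transition hz hz']

/-- The Jacobian matrix of the change of coordinates. -/
def jacobian (c c' x : S) : Matrix (Fin n) (Fin n) ℝ := Matrix.of fun a k =>
  fderiv ℝ (transition (n := n) c c') (extChartAt (𝓡 n) c x) (EuclideanSpace.single k 1) a

/-- Columns belong to coordinate directions of the base, hence a real factor on the right. -/
theorem phaseMatrix_transition (g : SmoothMetric n S) {c c' : S} {z : CotangentBundle n S}
    (hz : z.proj ∈ (chartAt (Model n) c).source) (hz' : z.proj ∈ (chartAt (Model n) c').source)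
    (V : Fin n → TangentSpace (cotangentModel n) z) :
    phaseMatrix g c z V = phaseMatrix g c' z V * complexify (jacobian c c' z.proj) := by
  ext i k
  rw [Matrix.mul_apply, phaseMatrix_apply g hz, phaseForm_transition g hz hz']
  rw [← sum_smul_single (fderiv ℝ (transition (n := n) c c') (extChartAt (𝓡 n) c z.proj)
    (EuclideanSpace.single k 1)), phaseForm_sum_vec]
  exact Finset.sum_congr rfl fun a _ => by rw [phaseMatrix_apply g hz']; rfl

theorem coordVec_transition {c c' x : S} (hx : x ∈ (chartAt (Model n) c).source)
    (hx' : x ∈ (chartAt (Model n) c').source) (i : Fin n) :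
    coordVec c i x = ∑ j, jacobian c c' x j i • coordVec c' j x := by
  have hlin := map_sum ((trivializationAt (EuclideanSpace ℝ (Fin n))
    (TangentSpace (𝓡 n) : S → Type _) c').symmL ℝ x)
    (fun j => jacobian c c' x j i • EuclideanSpace.single j (1 : ℝ)) Finset.univ
  rw [coordVec_eq_vec, vec_transition hx hx', ← sum_smul_single (fderiv ℝ (transition (n := n) c c')
    (extChartAt (𝓡 n) c x) (EuclideanSpace.single i 1))]
  refine Eq.trans hlin (Finset.sum_congr rfl fun j _ => ?_)
  rw [map_smul]
  rfl

theorem frame_transition (F : M → CotangentBundle n S) {c c' x : M}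
    (hx : x ∈ (chartAt (Model n) c).source) (hx' : x ∈ (chartAt (Model n) c').source) (i : Fin n) :
    frame F c i x = ∑ j, jacobian c c' x j i • frame F c' j x := by
  unfold frame dF
  rw [coordVec_transition hx hx', map_sum]
  exact Finset.sum_congr rfl fun j _ => map_smul _ _ _

/-- Rows belong to the vectors of the frame, hence a real factor on the left. -/
theorem phaseMatrix_frame_transition (g : SmoothMetric n S) (F : M → CotangentBundle n S)
    {c : S} {b b' x : M} (hz : (F x).proj ∈ (chartAt (Model n) c).source)
    (hx : x ∈ (chartAt (Model n) b).source) (hx' : x ∈ (chartAt (Model n) b').source) :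
    phaseMatrix g c (F x) (fun i => frame F b i x) =
      complexify (jacobian b b' x)ᵀ * phaseMatrix g c (F x) (fun i => frame F b' i x) := by
  ext i k
  rw [Matrix.mul_apply, phaseMatrix_apply g hz, frame_transition F hx hx']
  refine (map_sum (phaseFormₗ g c (F x) (EuclideanSpace.single k 1)) _ _).trans ?_
  refine Finset.sum_congr rfl fun j _ => ?_
  rw [map_smul, phaseMatrix_apply g hz, Complex.real_smul]
  rfl

end Phase

/-! ### Jacobi's formula and the trace identity behind `μ = dθ`. -/

section TraceIdentity

variable {n : ℕ}

/-- Laplace expansion along the replaced row: its cofactors are those of `W`, that is, entries of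
the adjugate. -/
theorem sum_det_updateRow (W D : Matrix (Fin n) (Fin n) ℂ) :
    ∑ i, (W.updateRow i (D i)).det = (W.adjugate * D).trace := by
  rw [Matrix.trace_mul_comm, Matrix.trace]
  refine Finset.sum_congr rfl fun i _ => ?_
  rw [Matrix.diag_apply, Matrix.mul_apply]
  have h := Matrix.cramer_transpose_apply W (D i) i
  rw [← h, Matrix.cramer_eq_adjugate_mulVec, ← Matrix.adjugate_transpose]
  simp only [Matrix.mulVec, dotProduct, Matrix.transpose_apply]
  exact Finset.sum_congr rfl fun j _ => mul_comm _ _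

/-- Jacobi's formula for the derivative of a determinant. -/
theorem hasFDerivAt_det {E : Type*} [NormedAddCommGroup E] [NormedSpace ℝ E]
    {W : E → Matrix (Fin n) (Fin n) ℂ} {D : Matrix (Fin n) (Fin n) (E →L[ℝ] ℂ)} {y : E}
    (h : ∀ i j, HasFDerivAt (fun y => W y i j) (D i j) y) :
    ∃ L : E →L[ℝ] ℂ, HasFDerivAt (fun y => (W y).det) L y ∧
      ∀ v, L v = ((W y).adjugate * Matrix.of fun i j => D i j v).trace := by
  -- The determinant is complex multilinear in the rows; scalars are restricted because the
  -- parameter space is real.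
  let f : ContinuousMultilinearMap ℝ (fun _ : Fin n => Fin n → ℂ) ℂ :=
    ContinuousMultilinearMap.restrictScalars ℝ
      (⟨(Matrix.detRowAlternating (R := ℂ) (n := Fin n)).toMultilinearMap,
        Continuous.matrix_det (A := fun a : Fin n → Fin n → ℂ => a) continuous_id⟩ :
        ContinuousMultilinearMap ℂ (fun _ : Fin n => Fin n → ℂ) ℂ)
  have h1 : ∀ i, HasFDerivAt (fun y => W y i) (ContinuousLinearMap.pi (D i)) y := fun i =>
    hasFDerivAt_pi.2 (h i)
  refine ⟨_, HasFDerivAt.multilinear_comp (f := f) h1, fun v => ?_⟩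
  rw [← sum_det_updateRow, sum_apply]
  refine Finset.sum_congr rfl fun i _ => ?_
  rfl

/-- Here `A'`, `B'` are the covariant and `D₁`, `D₂`, `D₃` the ordinary derivatives of `A`, `B`,
`σ`, and `L` is the connection matrix; the condition on `D₃` is metric compatibility. The left side
becomes the mean curvature form, the right side the Maslov form. They agree since the connection
contributes only the real number `tr L`. -/
theorem trace_inv_gram {σ : Matrix (Fin n) (Fin n) ℝ} (hσ : σᵀ = σ) (hu : IsUnit σ.det)
    {A B A' B' L D₁ D₂ D₃ : Matrix (Fin n) (Fin n) ℝ} (hAB : A * Bᵀ = B * Aᵀ)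
    (hW : (hermMatrix σ A B).det ≠ 0)
    (hA' : A' = D₁ + A * Lᵀ) (hB' : B' = D₂ - B * L) (hL : D₃ = Lᵀ * σ + σ * L) :
    ((A * σ * Aᵀ + B * σ⁻¹ * Bᵀ)⁻¹ * (B' * Aᵀ - A' * Bᵀ)).trace =
      ((hermMatrix σ A B)⁻¹ *
        (complexify (D₁ * σ + A * D₃) + Complex.I • complexify D₂)).trace.im := by
  set G := A * σ * Aᵀ + B * σ⁻¹ * Bᵀ with hG
  set W := hermMatrix σ A B with hWdef
  set D := complexify (D₁ * σ + A * D₃) + Complex.I • complexify D₂ with hD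
  have hWu : IsUnit W.det := hW.isUnit
  have hWH : IsUnit (Wᴴ).det := by
    rw [Matrix.det_conjTranspose]; exact (star_ne_zero.2 hW).isUnit
  have hcu : IsUnit (complexify σ).det := by
    rw [det_complexify]; exact (by exact_mod_cast hu.ne_zero : (σ.det : ℂ) ≠ 0).isUnit
  have hcinv : complexify σ⁻¹ * complexify σ = 1 := by
    rw [← map_mul, Matrix.nonsing_inv_mul _ hu, map_one]
  have hcinv' : complexify σ * complexify σ⁻¹ = 1 := by
    rw [← map_mul, Matrix.mul_nonsing_inv _ hu, map_one]
  have hGW : complexify G = W * complexify σ⁻¹ * Wᴴ := gram_eq_herm hσ hu hAB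
  have hGdet : IsUnit G.det := by
    have : (G.det : ℂ) ≠ 0 := by
      rw [hG, det_gram hσ hu hAB]
      refine mul_ne_zero (mul_ne_zero hW (inv_ne_zero (by exact_mod_cast hu.ne_zero))) ?_
      simpa using hW
    exact (by exact_mod_cast this : G.det ≠ 0).isUnit
  have hGinv : complexify G⁻¹ = (Wᴴ)⁻¹ * complexify σ * W⁻¹ := by
    have h1 : complexify G⁻¹ * complexify G = 1 := by
      rw [← map_mul, Matrix.nonsing_inv_mul _ hGdet, map_one]
    have h2 : complexify G * ((Wᴴ)⁻¹ * complexify σ * W⁻¹) = 1 := by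
      rw [hGW]
      calc W * complexify σ⁻¹ * Wᴴ * ((Wᴴ)⁻¹ * complexify σ * W⁻¹)
          = W * complexify σ⁻¹ * (Wᴴ * (Wᴴ)⁻¹) * complexify σ * W⁻¹ := by
            simp only [Matrix.mul_assoc]
        _ = 1 := by
            rw [Matrix.mul_nonsing_inv _ hWH, Matrix.mul_one, Matrix.mul_assoc W, hcinv,
              Matrix.mul_one, Matrix.mul_nonsing_inv _ hWu]
    calc complexify G⁻¹ = complexify G⁻¹ * (complexify G * ((Wᴴ)⁻¹ * complexify σ * W⁻¹)) := by
          rw [h2, Matrix.mul_one]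
      _ = _ := by rw [← Matrix.mul_assoc, h1, Matrix.one_mul]
  -- the Hermitian matrix of the covariant derivative
  have hW' : hermMatrix σ A' B' = D - W * complexify L := by
    have e : A' * σ = D₁ * σ + A * D₃ - A * σ * L := by
      rw [hA', hL, add_mul, mul_add]
      simp only [Matrix.mul_assoc]
      abel
    rw [hWdef, hD]
    unfold hermMatrix
    rw [e, hB', add_mul, Matrix.smul_mul, ← map_mul, ← map_mul, map_sub, map_sub, smul_sub]
    abel
  -- The polarized form of `gram_eq_herm`; its imaginary part is the matrix whose trace against
  -- `G⁻¹` is wanted.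
  have hX : hermMatrix σ A' B' * complexify σ⁻¹ * Wᴴ =
      complexify (A' * σ * Aᵀ + B' * σ⁻¹ * Bᵀ) +
        Complex.I • complexify (B' * Aᵀ - A' * Bᵀ) := by
    rw [hWdef, hermMatrix_conjTranspose hσ]
    unfold hermMatrix
    have h1 : A' * σ * σ⁻¹ = A' := by
      rw [Matrix.mul_assoc, Matrix.mul_nonsing_inv _ hu, Matrix.mul_one]
    have h2 : B' * σ⁻¹ * (σ * Aᵀ) = B' * Aᵀ := by
      rw [Matrix.mul_assoc, ← Matrix.mul_assoc σ⁻¹, Matrix.nonsing_inv_mul _ hu, Matrix.one_mul]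
    have h3 : Complex.I • Complex.I • complexify (B' * σ⁻¹ * Bᵀ) =
        - complexify (B' * σ⁻¹ * Bᵀ) := by
      rw [smul_smul, Complex.I_mul_I, neg_smul, one_smul]
    simp only [add_mul, mul_sub, Matrix.smul_mul, Matrix.mul_smul, ← map_mul, h1, h2]
    rw [h3, ← Matrix.mul_assoc, map_add, map_sub, smul_sub]
    abel
  have hre : ∀ P : Matrix (Fin n) (Fin n) ℝ, (complexify P).trace = (P.trace : ℂ) := by
    intro P
    simp [Matrix.trace]
  have key : (complexify G⁻¹ * (hermMatrix σ A' B' * complexify σ⁻¹ * Wᴴ)).trace =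
      (W⁻¹ * D).trace - (L.trace : ℂ) := by
    rw [hGinv]
    have e1 : (Wᴴ)⁻¹ * complexify σ * W⁻¹ * (hermMatrix σ A' B' * complexify σ⁻¹ * Wᴴ) =
        (Wᴴ)⁻¹ * (complexify σ * (W⁻¹ * hermMatrix σ A' B') * complexify σ⁻¹ * Wᴴ) := by
      simp only [Matrix.mul_assoc]
    rw [e1, Matrix.trace_mul_comm, Matrix.mul_assoc, Matrix.mul_nonsing_inv _ hWH, Matrix.mul_one,
      Matrix.trace_mul_comm, ← Matrix.mul_assoc, hcinv, Matrix.one_mul, hW', mul_sub,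
      ← Matrix.mul_assoc, Matrix.nonsing_inv_mul _ hWu, Matrix.one_mul, Matrix.trace_sub, hre]
  -- Imaginary parts discard both the real part of `hX` and `tr L`.
  have h := congrArg Complex.im key
  rw [hX, mul_add, Matrix.mul_smul, ← map_mul, ← map_mul, Matrix.trace_add, Matrix.trace_smul,
    hre, hre] at h
  simpa using h

end TraceIdentity

/-! ### Smoothness of determinants and inverse matrices. -/

section Smoothness

variable {n : ℕ}

variable {X : Type*} [NormedAddCommGroup X] [NormedSpace ℝ X] {s : Set X} {k : WithTop ℕ∞}

theorem contDiffWithinAt_det {R : Type*} [NormedCommRing R] [NormedAlgebra ℝ R]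
    {P : X → Matrix (Fin n) (Fin n) R} {x : X}
    (h : ∀ i j, ContDiffWithinAt ℝ k (fun x => P x i j) s x) :
    ContDiffWithinAt ℝ k (fun x => (P x).det) s x := by
  simp_rw [Matrix.det_apply']
  refine ContDiffWithinAt.sum fun π _ => contDiffWithinAt_const.mul ?_
  exact contDiffWithinAt_prod fun i _ => h _ _

theorem contDiffOn_det {R : Type*} [NormedCommRing R] [NormedAlgebra ℝ R]
    {P : X → Matrix (Fin n) (Fin n) R}
    (h : ∀ i j, ContDiffOn ℝ k (fun x => P x i j) s) : ContDiffOn ℝ k (fun x => (P x).det) s :=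
  fun x hx => contDiffWithinAt_det fun i j => h i j x hx

theorem contDiffOn_inv_apply {P : X → Matrix (Fin n) (Fin n) ℝ}
    (h : ∀ i j, ContDiffOn ℝ k (fun x => P x i j) s) (h0 : ∀ x ∈ s, (P x).det ≠ 0) (i j : Fin n) :
    ContDiffOn ℝ k (fun x => (P x)⁻¹ i j) s := by
  simp_rw [Matrix.inv_def, Matrix.smul_apply, Ring.inverse_eq_inv', smul_eq_mul,
    Matrix.adjugate_apply]
  refine ((contDiffOn_det h).inv h0).mul (contDiffOn_det fun a b => ?_)
  by_cases hab : a = j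
  · subst hab
    simp only [Matrix.updateRow_self]
    exact contDiffOn_const
  · simp only [Matrix.updateRow_ne hab]
    exact h a b

end Smoothness

/-! ### The form `θ` as a smooth function on the model space. -/

section ModelTheta

variable {n : ℕ} {S : Type*} [TopologicalSpace S]
  [ChartedSpace (EuclideanSpace ℝ (Fin n)) S] [IsManifold (𝓡 n) ∞ S]

/-- The Gram matrix of the metric in the chart around `c`. -/
def gramMatrix (g : SmoothMetric n S) (c : S) (y : Model n) : Matrix (Fin n) (Fin n) ℝ :=
  Matrix.of fun i j => gform g c y (EuclideanSpace.single i 1) (EuclideanSpace.single j 1)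

theorem gramMatrix_extChartAt (g : SmoothMetric n S) {c x : S}
    (hx : x ∈ (chartAt (Model n) c).source) :
    gramMatrix g c (extChartAt (𝓡 n) c x) = metricMatrix g c x := by
  ext i j; rw [metricMatrix_eq g hx]; rfl

theorem contDiffOn_gramMatrix (g : SmoothMetric n S) (c : S) (i j : Fin n) :
    ContDiffOn ℝ ∞ (fun y => gramMatrix g c y i j) (extChartAt (𝓡 n) c).target :=
  ((contDiffOn_gform g c).clm_apply contDiffOn_const).clm_apply contDiffOn_const

/-- `raise` in the canonical chart. -/
def modelRaise (g : SmoothMetric n S) (c : S) (a : PhaseModel n) : Model n :=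
  WithLp.toLp 2 ((gramMatrix g c a.1)⁻¹ *ᵥ fun k => a.2 (EuclideanSpace.single k 1))

/-- `thetaForm` in the canonical chart, at the point `a`, for the tangent vector `w`. -/
def modelTheta (g : SmoothMetric n S) (c : S) (a w : PhaseModel n) (u : Model n) : ℝ :=
  w.2 u - christoffelForm (gform g c) a.1 (modelRaise g c a) u w.1

theorem thetaForm_eq_modelTheta (g : SmoothMetric n S) {c : S} {z : CotangentBundle n S}
    (hz : z.proj ∈ (chartAt (Model n) c).source) (V : TangentSpace (cotangentModel n) z)
    (u : Model n) : thetaForm g c z V u = modelTheta g c (cotChart c z) (dCot c z V) u := by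
  unfold thetaForm modelTheta
  rw [cotChart_fst]
  congr 2
  unfold raise modelRaise
  rw [cotChart_fst, gramMatrix_extChartAt g hz]
  simp_rw [p_eq hz]

theorem det_gramMatrix_ne_zero (g : SmoothMetric n S) {c : S} {y : Model n}
    (hy : y ∈ (extChartAt (𝓡 n) c).target) : (gramMatrix g c y).det ≠ 0 := by
  have h1 := (extChartAt (𝓡 n) c).map_target hy
  have h2 : (extChartAt (𝓡 n) c).symm y ∈ (chartAt (Model n) c).source := by simpa using h1
  have h3 := isUnit_det_metricMatrix g h2
  rw [← gramMatrix_extChartAt g h2, (extChartAt (𝓡 n) c).right_inv hy] at h3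
  exact h3.ne_zero

-- Smoothness is joint in the point and the tangent vector, since both vary along an immersion.
set_option maxSynthPendingDepth 3 in
theorem contDiffOn_modelTheta (g : SmoothMetric n S) (c : S) (u : Model n) :
    ContDiffOn ℝ ∞ (fun b : PhaseModel n × PhaseModel n => modelTheta g c b.1 b.2 u)
      {b | b.1.1 ∈ (extChartAt (𝓡 n) c).target} := by
  set s : Set (PhaseModel n × PhaseModel n) := {b | b.1.1 ∈ (extChartAt (𝓡 n) c).target}
  have hmaps : Set.MapsTo (fun b : PhaseModel n × PhaseModel n => b.1.1) s
      (extChartAt (𝓡 n) c).target := fun b hb => hb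
  have hq : ContDiffOn ℝ ∞ (fun b : PhaseModel n × PhaseModel n => b.1.1) s :=
    (contDiff_fst.fst).contDiffOn
  have hw1 : ContDiffOn ℝ ∞ (fun b : PhaseModel n × PhaseModel n => b.2.1) s :=
    (contDiff_snd.fst).contDiffOn
  have hw2 : ContDiffOn ℝ ∞ (fun b : PhaseModel n × PhaseModel n => b.2.2) s :=
    (contDiff_snd.snd).contDiffOn
  have hp : ContDiffOn ℝ ∞ (fun b : PhaseModel n × PhaseModel n => b.1.2) s :=
    (contDiff_fst.snd).contDiffOn
  have hinv : ∀ i j, ContDiffOn ℝ ∞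
      (fun b : PhaseModel n × PhaseModel n => (gramMatrix g c b.1.1)⁻¹ i j) s := fun i j =>
    contDiffOn_inv_apply (fun i j => (contDiffOn_gramMatrix g c i j).comp hq hmaps)
      (fun b hb => det_gramMatrix_ne_zero g hb) i j
  have hr : ContDiffOn ℝ ∞ (fun b : PhaseModel n × PhaseModel n => modelRaise g c b.1) s := by
    rw [contDiffOn_euclidean]
    intro i
    simp only [modelRaise, Matrix.mulVec, dotProduct]
    exact ContDiffOn.sum fun j _ => (hinv i j).mul (hp.clm_apply contDiffOn_const)
  have hG : ContDiffOn ℝ ∞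
      (fun b : PhaseModel n × PhaseModel n => fderiv ℝ (gform g c) b.1.1) s :=
    ((contDiffOn_gform g c).fderiv_of_isOpen (isOpen_extChartAt_target c) (m := ∞)
      (by simp)).comp hq hmaps
  have hu : ContDiffOn ℝ ∞ (fun _ : PhaseModel n × PhaseModel n => u) s := contDiffOn_const
  unfold modelTheta christoffelForm
  refine (hw2.clm_apply hu).sub (contDiffOn_const.mul ?_)
  exact (((((hG.clm_apply hu).clm_apply hw1).clm_apply hr)).add
    (((hG.clm_apply hw1).clm_apply hu).clm_apply hr)).sub
    (((hG.clm_apply hr).clm_apply hu).clm_apply hw1)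

end ModelTheta

/-! ### Relations between the Sasaki metric, `J` and `ω`. -/

section AlmostKahler

variable {n : ℕ} {S : Type*} [TopologicalSpace S]
  [ChartedSpace (EuclideanSpace ℝ (Fin n)) S] [IsManifold (𝓡 n) ∞ S]

/-- `dq^i` as a linear form. -/
def dqₗ (c : S) (i : Fin n) (z : CotangentBundle n S) :
    TangentSpace (cotangentModel n) z →ₗ[ℝ] ℝ where
  toFun := dq c i z
  map_add' V W := map_add (mfderiv (cotangentModel n) 𝓘(ℝ, ℝ) (q c i) z) V W
  map_smul' r V := map_smul (mfderiv (cotangentModel n) 𝓘(ℝ, ℝ) (q c i) z) r V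

theorem dqₗ_apply (c : S) (i : Fin n) (z : CotangentBundle n S)
    (V : TangentSpace (cotangentModel n) z) : dqₗ c i z V = dq c i z V := rfl

/-- `dp_i` as a linear form. -/
def dpₗ (c : S) (i : Fin n) (z : CotangentBundle n S) :
    TangentSpace (cotangentModel n) z →ₗ[ℝ] ℝ where
  toFun := dp c i z
  map_add' V W := map_add (mfderiv (cotangentModel n) 𝓘(ℝ, ℝ) (p c i) z) V W
  map_smul' r V := map_smul (mfderiv (cotangentModel n) 𝓘(ℝ, ℝ) (p c i) z) r V

/-- `θ_i` as a linear form. -/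
def thetaₗ (g : SmoothMetric n S) (c : S) (i : Fin n) (z : CotangentBundle n S) :
    TangentSpace (cotangentModel n) z →ₗ[ℝ] ℝ :=
  dpₗ c i z - ∑ h, ∑ k, (christoffel g c z.proj k i h * p c k z) • dqₗ c h z

theorem thetaₗ_apply (g : SmoothMetric n S) (c : S) (i : Fin n) (z : CotangentBundle n S)
    (V : TangentSpace (cotangentModel n) z) : thetaₗ g c i z V = theta g c i z V := by
  simp only [thetaₗ, LinearMap.sub_apply, LinearMap.sum_apply, LinearMap.smul_apply, smul_eq_mul]
  rfl

theorem dq_delQ {c : S} {z : CotangentBundle n S} (hz : z.proj ∈ (chartAt (Model n) c).source)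
    (k i : Fin n) : dq c k z (delQ c i z) = if k = i then 1 else 0 := by
  rw [dq_eq hz, dCot_delQ hz]
  simp

theorem dq_delP {c : S} {z : CotangentBundle n S} (hz : z.proj ∈ (chartAt (Model n) c).source)
    (k i : Fin n) : dq c k z (delP c i z) = 0 := by
  rw [dq_eq hz, dCot_delP hz]
  simp

theorem dp_delQ {c : S} {z : CotangentBundle n S} (hz : z.proj ∈ (chartAt (Model n) c).source)
    (k i : Fin n) : dp c k z (delQ c i z) = 0 := by
  rw [dp_eq hz, dCot_delQ hz]
  simp

theorem dp_delP {c : S} {z : CotangentBundle n S} (hz : z.proj ∈ (chartAt (Model n) c).source)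
    (k i : Fin n) : dp c k z (delP c i z) = if k = i then 1 else 0 := by
  rw [dp_eq hz, dCot_delP hz]
  simp [eq_comm]

theorem dq_horX (g : SmoothMetric n S) {c : S} {z : CotangentBundle n S}
    (hz : z.proj ∈ (chartAt (Model n) c).source) (k i : Fin n) :
    dq c k z (horX g c i z) = if k = i then 1 else 0 := by
  rw [← dqₗ_apply, horX, map_add, map_sum]
  simp only [map_smul, dqₗ_apply, dq_delP hz, dq_delQ hz]
  simp

theorem theta_delP (g : SmoothMetric n S) {c : S} {z : CotangentBundle n S}
    (hz : z.proj ∈ (chartAt (Model n) c).source) (k i : Fin n) :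
    theta g c k z (delP c i z) = if k = i then 1 else 0 := by
  simp [theta, dq_delP hz, dp_delP hz]

/-- The lower indices appear in opposite orders in `X_i` and in `θ_k`; the symmetry of the
connection makes the two terms cancel. -/
theorem theta_horX (g : SmoothMetric n S) {c : S} {z : CotangentBundle n S}
    (hz : z.proj ∈ (chartAt (Model n) c).source) (k i : Fin n) :
    theta g c k z (horX g c i z) = 0 := by
  have h : dp c k z (horX g c i z) = ∑ m, christoffel g c z.proj m i k * p c m z := by
    change dpₗ c k z (horX g c i z) = _
    rw [horX, map_add, map_sum]
    simp only [map_smul]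
    change dp c k z (delQ c i z) + ∑ h, _ • dp c k z (delP c h z) = _
    simp only [dp_delQ hz, dp_delP hz]
    simp
  simp only [theta, h, dq_horX g hz]
  simp [christoffel_symm g c _ _ i k]

/-- The frame `X_i, ∂/∂p_i` is dual to `dq^i, θ_i`. This and the next lemma read off the components
of `J` and of the connection. -/
theorem dq_frame_sum (g : SmoothMetric n S) {c : S} {z : CotangentBundle n S}
    (hz : z.proj ∈ (chartAt (Model n) c).source) (a b : Fin n → ℝ) (k : Fin n) :
    dq c k z (∑ i, a i • horX g c i z + ∑ i, b i • delP c i z) = a k := by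
  rw [← dqₗ_apply]
  simp only [map_add, map_sum, map_smul, dqₗ_apply, dq_horX g hz, dq_delP hz]
  simp

theorem theta_frame_sum (g : SmoothMetric n S) {c : S} {z : CotangentBundle n S}
    (hz : z.proj ∈ (chartAt (Model n) c).source) (a b : Fin n → ℝ) (k : Fin n) :
    theta g c k z (∑ i, a i • horX g c i z + ∑ i, b i • delP c i z) = b k := by
  rw [← thetaₗ_apply]
  simp only [map_add, map_sum, map_smul, thetaₗ_apply, theta_horX g hz, theta_delP g hz]
  simp

theorem mem_own_chart (z : CotangentBundle n S) :
    z.proj ∈ (chartAt (Model n) z.proj).source := mem_chart_source _ _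

theorem complexJ_eq (g : SmoothMetric n S) (z : CotangentBundle n S)
    (V : TangentSpace (cotangentModel n) z) :
    complexJ g z V =
      ∑ j, (-∑ i, (metricMatrix g z.proj z.proj)⁻¹ i j * theta g z.proj i z V) • horX g z.proj j z +
      ∑ j, (∑ i, metricMatrix g z.proj z.proj i j * dq z.proj i z V) • delP z.proj j z := by
  unfold complexJ
  rw [Finset.sum_comm, ← Finset.sum_add_distrib]
  refine Finset.sum_congr rfl fun j _ => ?_
  rw [Finset.sum_sub_distrib, ← Finset.sum_smul, ← Finset.sum_smul, neg_smul]
  abel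

theorem dq_complexJ (g : SmoothMetric n S) (z : CotangentBundle n S)
    (V : TangentSpace (cotangentModel n) z) (k : Fin n) :
    dq z.proj k z (complexJ g z V) =
      -∑ i, (metricMatrix g z.proj z.proj)⁻¹ i k * theta g z.proj i z V := by
  rw [complexJ_eq, dq_frame_sum g (mem_own_chart z)]

theorem theta_complexJ (g : SmoothMetric n S) (z : CotangentBundle n S)
    (V : TangentSpace (cotangentModel n) z) (k : Fin n) :
    theta g z.proj k z (complexJ g z V) =
      ∑ i, metricMatrix g z.proj z.proj i k * dq z.proj i z V := by
  rw [complexJ_eq, theta_frame_sum g (mem_own_chart z)]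

/-- The symplectic form in terms of `dq` and `θ`. -/
theorem omega_eq_theta (g : SmoothMetric n S) (z : CotangentBundle n S)
    (V W : TangentSpace (cotangentModel n) z) :
    omega z V W = ∑ i, (dq z.proj i z V * theta g z.proj i z W -
      theta g z.proj i z V * dq z.proj i z W) := by
  have h : ∀ i (U : TangentSpace (cotangentModel n) z), theta g z.proj i z U = dp z.proj i z U -
    ∑ h, (∑ k, christoffel g z.proj z.proj k i h * p z.proj k z) * dq z.proj h z U := by
    intro i U
    simp only [theta, Finset.sum_mul]
  set C : Fin n → Fin n → ℝ := fun i h => ∑ k, christoffel g z.proj z.proj k i h * p z.proj k z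
    with hC
  -- The forms `dp` and `θ` differ by `C_{ih} dq^h` with symmetric `C`, so the correction cancels
  -- upon antisymmetrization.
  have hs : ∀ i h, C i h = C h i := fun i h => by
    simp only [hC, fun k => christoffel_symm g z.proj z.proj k i h]
  unfold omega
  simp only [h]
  have e : ∑ i, ∑ h, C i h * dq z.proj i z V * dq z.proj h z W =
      ∑ i, ∑ h, C i h * dq z.proj h z V * dq z.proj i z W := by
    rw [Finset.sum_comm]
    exact Finset.sum_congr rfl fun i _ => Finset.sum_congr rfl fun h _ => by rw [hs i h]
  rw [← sub_eq_zero, ← Finset.sum_sub_distrib]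
  have e2 : ∀ i, (dq z.proj i z V * dp z.proj i z W - dp z.proj i z V * dq z.proj i z W -
      (dq z.proj i z V * (dp z.proj i z W - ∑ h, C i h * dq z.proj h z W) -
        (dp z.proj i z V - ∑ h, C i h * dq z.proj h z V) * dq z.proj i z W)) =
      ∑ h, C i h * dq z.proj i z V * dq z.proj h z W -
      ∑ h, C i h * dq z.proj h z V * dq z.proj i z W := by
    intro i
    have a1 : ∑ h, C i h * dq z.proj i z V * dq z.proj h z W =
        dq z.proj i z V * ∑ h, C i h * dq z.proj h z W := by
      rw [Finset.mul_sum]; exact Finset.sum_congr rfl fun h _ => by ring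
    have a2 : ∑ h, C i h * dq z.proj h z V * dq z.proj i z W =
        (∑ h, C i h * dq z.proj h z V) * dq z.proj i z W := by
      rw [Finset.sum_mul]
    rw [a1, a2]
    ring
  rw [Finset.sum_congr rfl fun i _ => e2 i, Finset.sum_sub_distrib, e, sub_self]

theorem metricMatrix_transpose (g : SmoothMetric n S) (c x : S) :
    (metricMatrix g c x)ᵀ = metricMatrix g c x := by
  ext i j; exact metricMatrix_symm g c x j i

theorem metricMatrix_inv_symm (g : SmoothMetric n S) (c x : S) (i j : Fin n) :
    (metricMatrix g c x)⁻¹ i j = (metricMatrix g c x)⁻¹ j i := by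
  have h := Matrix.transpose_nonsing_inv (metricMatrix g c x)
  rw [metricMatrix_transpose] at h
  have := congrFun (congrFun h j) i
  exact this

/-- `⟨V, JW⟩ = -ω(V, W)`. -/
theorem sasaki_complexJ (g : SmoothMetric n S) (z : CotangentBundle n S)
    (V W : TangentSpace (cotangentModel n) z) :
    sasaki g z V (complexJ g z W) = -omega z V W := by
  set σ := metricMatrix g z.proj z.proj with hσ
  have hu : IsUnit σ.det := isUnit_det_metricMatrix g (mem_own_chart z)
  rw [omega_eq_theta g]
  unfold sasaki
  simp only [dq_complexJ, theta_complexJ]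
  have h1 : ∀ i, ∑ j, σ i j * ∑ l, σ⁻¹ l j * theta g z.proj l z W = theta g z.proj i z W := by
    intro i
    have h := congrFun (Matrix.mulVec_mulVec (fun l => theta g z.proj l z W) σ σ⁻¹) i
    rw [Matrix.mul_nonsing_inv _ hu, Matrix.one_mulVec] at h
    conv_rhs => rw [← h]
    simp only [Matrix.mulVec, dotProduct]
    refine Finset.sum_congr rfl fun j _ => ?_
    congr 1
    exact Finset.sum_congr rfl fun l _ => by rw [hσ, metricMatrix_inv_symm]
  have h2 : ∀ i, ∑ j, σ⁻¹ i j * ∑ l, σ l j * dq z.proj l z W = dq z.proj i z W := by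
    intro i
    have h := congrFun (Matrix.mulVec_mulVec (fun l => dq z.proj l z W) σ⁻¹ σ) i
    rw [Matrix.nonsing_inv_mul _ hu, Matrix.one_mulVec] at h
    conv_rhs => rw [← h]
    simp only [Matrix.mulVec, dotProduct]
    refine Finset.sum_congr rfl fun j _ => ?_
    congr 1
    exact Finset.sum_congr rfl fun l _ => by rw [hσ, metricMatrix_symm]
  rw [← Finset.sum_neg_distrib]
  refine Finset.sum_congr rfl fun i _ => ?_
  conv_rhs => rw [← h1 i, ← h2 i]
  rw [Finset.sum_add_distrib, Finset.mul_sum, Finset.mul_sum, neg_sub, sub_eq_neg_add,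
    ← Finset.sum_neg_distrib]
  congr 1
  · exact Finset.sum_congr rfl fun j _ => by ring
  · exact Finset.sum_congr rfl fun j _ => by ring

/-- `ω(JV, W) = -⟨V, W⟩`. -/
theorem omega_complexJ (g : SmoothMetric n S) (z : CotangentBundle n S)
    (V W : TangentSpace (cotangentModel n) z) :
    omega z (complexJ g z V) W = -sasaki g z V W := by
  rw [omega_eq_theta g]
  unfold sasaki
  simp only [dq_complexJ, theta_complexJ]
  simp only [neg_mul, Finset.sum_mul, ← Finset.sum_neg_distrib, ← Finset.sum_sub_distrib]
  rw [Finset.sum_comm]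
  refine Finset.sum_congr rfl fun i _ => Finset.sum_congr rfl fun j _ => ?_
  ring

/-- `ω(·, W)` as a linear form. -/
def omegaₗ (z : CotangentBundle n S) (W : TangentSpace (cotangentModel n) z) :
    TangentSpace (cotangentModel n) z →ₗ[ℝ] ℝ :=
  ∑ i, (dp z.proj i z W • dqₗ z.proj i z - dq z.proj i z W • dpₗ z.proj i z)

theorem omegaₗ_apply (z : CotangentBundle n S) (V W : TangentSpace (cotangentModel n) z) :
    omegaₗ z W V = omega z V W := by
  simp only [omegaₗ, LinearMap.sum_apply, LinearMap.sub_apply, LinearMap.smul_apply, smul_eq_mul,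
    omega]
  refine Finset.sum_congr rfl fun i _ => ?_
  change dp z.proj i z W * dq z.proj i z V - dq z.proj i z W * dp z.proj i z V = _
  ring

theorem sasaki_self_pos (g : SmoothMetric n S) (z : CotangentBundle n S)
    {V : TangentSpace (cotangentModel n) z} (hV : V ≠ 0) : 0 < sasaki g z V V := by
  have hz := mem_own_chart z
  set σ := metricMatrix g z.proj z.proj with hσ
  have hpos : σ.PosDef := metricMatrix_posDef g hz
  have hdot : ∀ (P : Matrix (Fin n) (Fin n) ℝ) (a : Fin n → ℝ),
      a ⬝ᵥ (P *ᵥ a) = ∑ i, ∑ j, P i j * a i * a j := by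
    intro P a
    simp only [Matrix.mulVec, dotProduct, Finset.mul_sum]
    exact Finset.sum_congr rfl fun i _ => Finset.sum_congr rfl fun j _ => by ring
  have hsplit : sasaki g z V V = (fun i => dq z.proj i z V) ⬝ᵥ (σ *ᵥ fun i => dq z.proj i z V) +
      (fun i => theta g z.proj i z V) ⬝ᵥ (σ⁻¹ *ᵥ fun i => theta g z.proj i z V) := by
    rw [hdot, hdot, ← Finset.sum_add_distrib]
    exact Finset.sum_congr rfl fun i _ => by rw [← Finset.sum_add_distrib]
  have h1 := hpos.posSemidef.dotProduct_mulVec_nonneg (fun i => dq z.proj i z V)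
  have h2 := hpos.inv.posSemidef.dotProduct_mulVec_nonneg (fun i => theta g z.proj i z V)
  rw [star_trivial] at h1 h2
  rw [hsplit]
  by_cases hq : (fun i => dq z.proj i z V) = 0
  -- If `dq(V) = 0`, then `θ(V) = dp(V)`, so the joint vanishing of both forces `V = 0`.
  · by_cases ht : (fun i => theta g z.proj i z V) = 0
    · exfalso
      refine hV (dCot_injective hz ?_)
      have e1 : (dCot z.proj z V).1 = 0 := by
        ext i
        rw [← dq_eq hz]
        exact congrFun hq i
      have e2 : ∀ i : Fin n, (dCot z.proj z V).2 (EuclideanSpace.single i 1) = 0 := by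
        intro i
        rw [← dp_eq hz]
        have a := congrFun ht i
        simp only [theta, fun h => show dq z.proj h z V = 0 from congrFun hq h] at a
        simpa using a
      refine Prod.ext e1 (ContinuousLinearMap.ext fun w => ?_)
      rw [← sum_smul_single w]
      simp [map_sum, e2]
    · have h3 := hpos.inv.dotProduct_mulVec_pos ht
      rw [star_trivial] at h3
      linarith
  · have h3 := hpos.dotProduct_mulVec_pos hq
    rw [star_trivial] at h3
    linarith

end AlmostKahler

/-! ### Lagrangian immersions: induced metric and squared phase. -/

section Immersion

variable {n : ℕ} {S : Type*} [TopologicalSpace S]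
  [ChartedSpace (EuclideanSpace ℝ (Fin n)) S] [IsManifold (𝓡 n) ∞ S]
  {M : Type*} [TopologicalSpace M]
  [ChartedSpace (EuclideanSpace ℝ (Fin n)) M] [IsManifold (𝓡 n) ∞ M]

theorem sasaki_symm (g : SmoothMetric n S) (z : CotangentBundle n S)
    (V W : TangentSpace (cotangentModel n) z) : sasaki g z V W = sasaki g z W V := by
  unfold sasaki
  rw [Finset.sum_comm]
  refine Finset.sum_congr rfl fun i _ => Finset.sum_congr rfl fun j _ => ?_
  rw [metricMatrix_symm g _ _ j i, metricMatrix_inv_symm g _ _ j i]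
  ring

/-- `⟨V, ·⟩` as a linear form. -/
def sasakiₗ (g : SmoothMetric n S) (z : CotangentBundle n S)
    (V : TangentSpace (cotangentModel n) z) : TangentSpace (cotangentModel n) z →ₗ[ℝ] ℝ :=
  ∑ i, ∑ j, ((metricMatrix g z.proj z.proj i j * dq z.proj i z V) • dqₗ z.proj j z +
    ((metricMatrix g z.proj z.proj)⁻¹ i j * theta g z.proj i z V) • thetaₗ g z.proj j z)

theorem sasakiₗ_apply (g : SmoothMetric n S) (z : CotangentBundle n S)
    (V W : TangentSpace (cotangentModel n) z) : sasakiₗ g z V W = sasaki g z V W := by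
  simp only [sasakiₗ, LinearMap.sum_apply, LinearMap.add_apply, LinearMap.smul_apply, smul_eq_mul,
    thetaₗ_apply, dqₗ_apply, sasaki]

theorem inducedMatrix_eq (g : SmoothMetric n S) (F : M → CotangentBundle n S) (x : M) :
    inducedMatrix g F x =
      dqMatrix (F x).proj (F x) (fun i => frame F x i x) *
        metricMatrix g (F x).proj (F x).proj *
        (dqMatrix (F x).proj (F x) (fun i => frame F x i x))ᵀ +
      thetaMatrix g (F x).proj (F x) (fun i => frame F x i x) *
        (metricMatrix g (F x).proj (F x).proj)⁻¹ *
        (thetaMatrix g (F x).proj (F x) (fun i => frame F x i x))ᵀ := by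
  ext i j
  simp only [inducedMatrix, sasaki, Matrix.of_apply, Matrix.add_apply, Matrix.mul_apply,
    Matrix.transpose_apply, dqMatrix, thetaMatrix, Finset.sum_mul]
  rw [Finset.sum_comm, ← Finset.sum_add_distrib]
  refine Finset.sum_congr rfl fun k _ => ?_
  rw [← Finset.sum_add_distrib]
  exact Finset.sum_congr rfl fun l _ => by ring

theorem dqMatrix_mul_thetaMatrix (g : SmoothMetric n S) {F : M → CotangentBundle n S}
    (hF : IsLagrangianImmersion F) (x : M) :
    dqMatrix (F x).proj (F x) (fun i => frame F x i x) *
      (thetaMatrix g (F x).proj (F x) (fun i => frame F x i x))ᵀ =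
    thetaMatrix g (F x).proj (F x) (fun i => frame F x i x) *
      (dqMatrix (F x).proj (F x) (fun i => frame F x i x))ᵀ := by
  ext i j
  have h := hF.isotropic x (coordVec x i x) (coordVec x j x)
  rw [omega_eq_theta g, Finset.sum_sub_distrib, sub_eq_zero] at h
  simpa [Matrix.mul_apply, dqMatrix, thetaMatrix, frame] using h

theorem inducedMatrix_symm (g : SmoothMetric n S) (F : M → CotangentBundle n S) (x : M) :
    (inducedMatrix g F x)ᵀ = inducedMatrix g F x := by
  ext i j; exact sasaki_symm _ _ _ _

theorem inducedMatrix_inv_symm (g : SmoothMetric n S) (F : M → CotangentBundle n S) (x : M)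
    (i j : Fin n) : (inducedMatrix g F x)⁻¹ i j = (inducedMatrix g F x)⁻¹ j i := by
  have h := Matrix.transpose_nonsing_inv (inducedMatrix g F x)
  rw [inducedMatrix_symm] at h
  exact congrFun (congrFun h j) i

theorem vec_eq_sum (b x : M) (v : Model n) : vec b x v = ∑ i, v i • coordVec b i x := by
  have h := map_sum ((trivializationAt (EuclideanSpace ℝ (Fin n))
    (TangentSpace (𝓡 n) : M → Type _) b).symmL ℝ x)
    (fun j => v j • EuclideanSpace.single j (1 : ℝ)) Finset.univ
  conv_lhs => rw [← sum_smul_single v]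
  refine Eq.trans h (Finset.sum_congr rfl fun j _ => ?_)
  rw [map_smul]
  rfl

theorem frame_sum (F : M → CotangentBundle n S) (b x : M) (v : Model n) :
    dF F x (vec b x v) = ∑ i, v i • frame F b i x := by
  rw [vec_eq_sum]
  unfold frame dF
  rw [map_sum]
  exact Finset.sum_congr rfl fun j _ => map_smul _ _ _

/-- A kernel vector of the Gram matrix would give a nonzero tangent vector of length zero. -/
theorem det_inducedMatrix_ne_zero (g : SmoothMetric n S) {F : M → CotangentBundle n S}
    (hF : IsLagrangianImmersion F) (x : M) : (inducedMatrix g F x).det ≠ 0 := by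
  intro h0
  obtain ⟨v, hv, h⟩ := Matrix.exists_mulVec_eq_zero_iff.2 h0
  have hx : x ∈ (chartAt (Model n) x).source := mem_chart_source _ _
  set V := dF F x (vec x x (WithLp.toLp 2 v)) with hV
  have hV0 : V ≠ 0 := by
    intro e
    have h1 : vec x x (WithLp.toLp 2 v) = 0 := by
      refine hF.injective x ?_
      rw [← hV, e]
      exact (map_zero _).symm
    have h2 : (WithLp.toLp 2 v : Model n) = 0 := by
      refine vec_injective hx (h1.trans ?_)
      simp [vec]
    exact hv (by simpa using h2)
  have h3 := sasaki_self_pos g (F x) hV0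
  have hVs : V = ∑ i, v i • frame F x i x := frame_sum F x x _
  have h4 : sasaki g (F x) V V = v ⬝ᵥ (inducedMatrix g F x *ᵥ v) := by
    rw [← sasakiₗ_apply, hVs, map_sum]
    simp only [map_smul, dotProduct, smul_eq_mul, Matrix.mulVec]
    refine Finset.sum_congr rfl fun i _ => ?_
    rw [sasakiₗ_apply, sasaki_symm, ← sasakiₗ_apply, map_sum]
    congr 1
    refine Finset.sum_congr rfl fun j _ => ?_
    rw [map_smul, sasakiₗ_apply, smul_eq_mul, mul_comm]
    rfl
  rw [h, dotProduct_zero] at h4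
  linarith

theorem phaseSq_own (g : SmoothMetric n S) {F : M → CotangentBundle n S}
    (hF : IsLagrangianImmersion F) (x : M) :
    phaseSq g F x = (phaseMatrix g (F x).proj (F x) (fun i => frame F x i x)).det /
      starRingEnd ℂ (phaseMatrix g (F x).proj (F x) (fun i => frame F x i x)).det := by
  have hz := mem_own_chart (F x)
  unfold phaseMatrix
  rw [← phase_ratio (metricMatrix_transpose g _ _) (metricMatrix_posDef g hz).det_pos
    (dqMatrix_mul_thetaMatrix g hF x), ← inducedMatrix_eq]
  unfold phaseSq OmegaForm
  congr 4
  ext i k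
  simp only [Matrix.of_apply, Matrix.add_apply, Matrix.smul_apply, RingHom.mapMatrix_apply,
    Matrix.map_apply, smul_eq_mul, dqMatrix, Matrix.mul_apply, thetaMatrix]
  congr 3
  refine Finset.sum_congr rfl fun j _ => ?_
  rw [metricMatrix_inv_symm, mul_comm]

theorem det_phaseMatrix_own_ne_zero (g : SmoothMetric n S) {F : M → CotangentBundle n S}
    (hF : IsLagrangianImmersion F) (x : M) :
    (phaseMatrix g (F x).proj (F x) (fun i => frame F x i x)).det ≠ 0 := by
  intro h
  have hz := mem_own_chart (F x)
  have h1 := det_gram (metricMatrix_transpose g _ _) (isUnit_det_metricMatrix g hz)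
    (dqMatrix_mul_thetaMatrix g hF x)
  rw [← inducedMatrix_eq] at h1
  unfold phaseMatrix at h
  rw [h, zero_mul, zero_mul] at h1
  exact det_inducedMatrix_ne_zero g hF x (by exact_mod_cast h1)

/-- The factor is a product of two Jacobian determinants. All that matters is that it is real. -/
theorem phaseMatrix_own_factor (g : SmoothMetric n S) (F : M → CotangentBundle n S)
    {c : S} {b x : M} (hz : (F x).proj ∈ (chartAt (Model n) c).source)
    (hx : x ∈ (chartAt (Model n) b).source) :
    ∃ r : ℝ, (phaseMatrix g (F x).proj (F x) (fun i => frame F x i x)).det =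
      (r : ℂ) * (phaseMatrix g c (F x) (fun i => frame F b i x)).det := by
  refine ⟨(jacobian (n := n) x b x)ᵀ.det * (jacobian (n := n) (F x).proj c (F x).proj).det, ?_⟩
  rw [phaseMatrix_transition g (mem_own_chart (F x)) hz,
    phaseMatrix_frame_transition g F hz (mem_chart_source _ x) hx, Matrix.det_mul, Matrix.det_mul,
    det_complexify, det_complexify]
  push_cast
  ring

theorem det_phaseMatrix_ne_zero (g : SmoothMetric n S) {F : M → CotangentBundle n S}
    (hF : IsLagrangianImmersion F) {c : S} {b x : M}
    (hz : (F x).proj ∈ (chartAt (Model n) c).source) (hx : x ∈ (chartAt (Model n) b).source) :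
    (phaseMatrix g c (F x) (fun i => frame F b i x)).det ≠ 0 := by
  obtain ⟨r, hr⟩ := phaseMatrix_own_factor g F hz hx
  intro h
  exact det_phaseMatrix_own_ne_zero g hF x (by rw [hr, h, mul_zero])

/-- The squared phase in arbitrary charts. -/
theorem phaseSq_eq (g : SmoothMetric n S) {F : M → CotangentBundle n S}
    (hF : IsLagrangianImmersion F) {c : S} {b x : M}
    (hz : (F x).proj ∈ (chartAt (Model n) c).source) (hx : x ∈ (chartAt (Model n) b).source) :
    phaseSq g F x = (phaseMatrix g c (F x) (fun i => frame F b i x)).det /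
      starRingEnd ℂ (phaseMatrix g c (F x) (fun i => frame F b i x)).det := by
  obtain ⟨r, hr⟩ := phaseMatrix_own_factor g F hz hx
  have h0 := det_phaseMatrix_own_ne_zero g hF x
  rw [phaseSq_own g hF, hr, map_mul, Complex.conj_ofReal]
  -- A real nonzero factor cancels between a number and its conjugate.
  refine mul_div_mul_left _ _ ?_
  rintro h
  rw [hr, h, zero_mul] at h0
  exact h0 rfl

theorem norm_phaseSq (g : SmoothMetric n S) {F : M → CotangentBundle n S}
    (hF : IsLagrangianImmersion F) (x : M) :
    starRingEnd ℂ (phaseSq g F x) * phaseSq g F x = 1 := by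
  rw [phaseSq_own g hF]
  have h0 := det_phaseMatrix_own_ne_zero g hF x
  set d := (phaseMatrix g (F x).proj (F x) (fun i => frame F x i x)).det
  have h1 : starRingEnd ℂ d ≠ 0 := by simpa using h0
  rw [map_div₀, Complex.conj_conj]
  field_simp

end Immersion

/-! ### The derivative of the phase of a complex function. -/

section RatioDerivative

/-- The logarithmic derivative of `d / conj d`. -/
theorem im_conj_ratio_mul_fderiv {E : Type*} [NormedAddCommGroup E] [NormedSpace ℝ E] {d : E → ℂ}
    {L : E →L[ℝ] ℂ} {y : E} (hd : HasFDerivAt d L y) (h0 : d y ≠ 0) (v : E) :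
    (1 / 2 : ℝ) * (starRingEnd ℂ (d y / starRingEnd ℂ (d y)) *
      fderiv ℝ (fun y => d y / starRingEnd ℂ (d y)) y v).im = (L v / d y).im := by
  have hc : starRingEnd ℂ (d y) ≠ 0 := by simpa using h0
  have hcd : DifferentiableAt ℝ (fun y => starRingEnd ℂ (d y)) y :=
    (Complex.conjCLE.differentiable.differentiableAt).comp y hd.differentiableAt
  have hdiff : DifferentiableAt ℝ (fun y => d y / starRingEnd ℂ (d y)) y := by
    simp_rw [div_eq_mul_inv]
    exact hd.differentiableAt.mul (hcd.inv hc)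
  have hline : HasDerivAt (fun t : ℝ => y + t • v) v 0 := by
    simpa using ((hasDerivAt_id (0 : ℝ)).smul_const v).const_add y
  have h1 : HasDerivAt (fun t : ℝ => d (y + t • v)) (L v) 0 :=
    HasFDerivAt.comp_hasDerivAt (f := fun t : ℝ => y + t • v) (0 : ℝ) (by simpa using hd) hline
  have h2 : HasDerivAt (fun t : ℝ => starRingEnd ℂ (d (y + t • v))) (starRingEnd ℂ (L v)) 0 :=
    h1.star
  have h3 := h1.div h2 (by simpa using hc)
  have h4 : HasDerivAt (fun t : ℝ => d (y + t • v) / starRingEnd ℂ (d (y + t • v)))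
      (fderiv ℝ (fun y => d y / starRingEnd ℂ (d y)) y v) 0 :=
    HasFDerivAt.comp_hasDerivAt (l := fun y => d y / starRingEnd ℂ (d y))
      (f := fun t : ℝ => y + t • v) (0 : ℝ) (by simpa using hdiff.hasFDerivAt) hline
  have h5 := h4.unique h3
  simp only [zero_smul, add_zero] at h5
  rw [h5, map_div₀, Complex.conj_conj]
  -- The logarithmic derivative of `d / conj d` is `w - conj w = 2√-1 Im w` with `w = L v / d`; this
  -- explains the factor `1/2`.
  have h6 : starRingEnd ℂ (d y) / d y * ((L v * starRingEnd ℂ (d y) -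
      d y * starRingEnd ℂ (L v)) / starRingEnd ℂ (d y) ^ 2) =
      L v / d y - starRingEnd ℂ (L v / d y) := by
    rw [map_div₀]
    field_simp
  rw [h6, Complex.sub_im, Complex.conj_im]
  ring

end RatioDerivative

/-! ### Immersions and their matrix `W` in fixed charts. -/

section LocalRepresentation

variable {n : ℕ} {S : Type*} [TopologicalSpace S]
  [ChartedSpace (EuclideanSpace ℝ (Fin n)) S] [IsManifold (𝓡 n) ∞ S]
  {M : Type*} [TopologicalSpace M]
  [ChartedSpace (EuclideanSpace ℝ (Fin n)) M] [IsManifold (𝓡 n) ∞ M]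

theorem mfderiv_of_eventuallyEq_chart {E' : Type*} [NormedAddCommGroup E'] [NormedSpace ℝ E']
    {f : M → E'} {f' : Model n → E'} {b x : M} (hx : x ∈ (chartAt (Model n) b).source)
    (h : f =ᶠ[nhds x] f' ∘ extChartAt (𝓡 n) b)
    (hf' : DifferentiableAt ℝ f' (extChartAt (𝓡 n) b x)) :
    MDifferentiableAt (𝓡 n) 𝓘(ℝ, E') f x ∧ ∀ v, mfderiv (𝓡 n) 𝓘(ℝ, E') f x (vec b x v) =
      fderiv ℝ f' (extChartAt (𝓡 n) b x) v := by
  have h1 : MDifferentiableAt (𝓡 n) 𝓘(ℝ, E') (f' ∘ extChartAt (𝓡 n) b) x :=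
    MDifferentiableAt.comp x hf'.mdifferentiableAt (mdifferentiableAt_extChartAt hx)
  refine ⟨h1.congr_of_eventuallyEq h, fun v => ?_⟩
  rw [h.mfderiv_eq]
  refine (mfderiv_real_vec hx h1 v).trans ?_
  have h2 : (f' ∘ extChartAt (𝓡 n) b) ∘ (extChartAt (𝓡 n) b).symm
      =ᶠ[nhds (extChartAt (𝓡 n) b x)] f' := by
    filter_upwards [(isOpen_extChartAt_target b).mem_nhds
      ((extChartAt (𝓡 n) b).map_source (by simpa using hx))] with y hy
    simp only [Function.comp_apply, (extChartAt (𝓡 n) b).right_inv hy]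
  rw [h2.fderiv_eq]

/-- A map into the cotangent bundle in the charts around `b` and `c`. -/
def localRep (c : S) (b : M) (F : M → CotangentBundle n S) : Model n → PhaseModel n :=
  cotChart c ∘ F ∘ (extChartAt (𝓡 n) b).symm

theorem localRep_extChartAt (c : S) {b x : M} (F : M → CotangentBundle n S)
    (hx : x ∈ (chartAt (Model n) b).source) :
    localRep c b F (extChartAt (𝓡 n) b x) = cotChart c (F x) := by
  simp only [localRep, Function.comp_apply]
  rw [(extChartAt (𝓡 n) b).left_inv (by simpa using hx)]

theorem contDiffAt_localRep {c : S} {b x : M} {F : M → CotangentBundle n S}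
    (hF : ContMDiffAt (𝓡 n) (cotangentModel n) ∞ F x)
    (hx : x ∈ (chartAt (Model n) b).source) (hz : (F x).proj ∈ (chartAt (Model n) c).source) :
    ContDiffAt ℝ ∞ (localRep c b F) (extChartAt (𝓡 n) b x) := by
  have hx' : x ∈ (extChartAt (𝓡 n) b).source := by simpa using hx
  have h0 : (extChartAt (𝓡 n) b).symm (extChartAt (𝓡 n) b x) = x :=
    (extChartAt (𝓡 n) b).left_inv hx'
  have h1 : ContMDiffAt 𝓘(ℝ, Model n) (𝓡 n) ∞ (extChartAt (𝓡 n) b).symm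
      (extChartAt (𝓡 n) b x) :=
    (contMDiffOn_extChartAt_symm b).contMDiffAt ((isOpen_extChartAt_target b).mem_nhds
      ((extChartAt (𝓡 n) b).map_source hx'))
  have h2 : ContMDiffAt (𝓡 n) 𝓘(ℝ, PhaseModel n) ∞ (cotChart c ∘ F) x :=
    (contMDiffAt_cotChart hz).comp x hF
  rw [← contMDiffAt_iff_contDiffAt]
  refine ContMDiffAt.comp (g := cotChart c ∘ F) _ ?_ h1
  rw [h0]
  exact h2

theorem dCot_dF {c : S} {b x : M} {F : M → CotangentBundle n S}
    (hF : MDifferentiableAt (𝓡 n) (cotangentModel n) F x)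
    (hx : x ∈ (chartAt (Model n) b).source) (hz : (F x).proj ∈ (chartAt (Model n) c).source)
    (v : Model n) :
    dCot c (F x) (dF F x (vec b x v)) = fderiv ℝ (localRep c b F) (extChartAt (𝓡 n) b x) v := by
  have h := mfderiv_real_vec hx ((mdifferentiableAt_cotChart hz).comp x hF) v
  rw [mfderiv_comp (I' := cotangentModel n) x (mdifferentiableAt_cotChart hz) hF] at h
  exact h

/-- `phaseMatrix` in the canonical chart. -/
def modelPhase (g : SmoothMetric n S) (c : S) (a : PhaseModel n) (w : Fin n → PhaseModel n) :
    Matrix (Fin n) (Fin n) ℂ :=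
  hermMatrix (gramMatrix g c a.1) (Matrix.of fun i j => (w i).1 j)
    (Matrix.of fun i j => modelTheta g c a (w i) (EuclideanSpace.single j 1))

theorem phaseMatrix_eq_modelPhase (g : SmoothMetric n S) {c : S} {z : CotangentBundle n S}
    (hz : z.proj ∈ (chartAt (Model n) c).source)
    (V : Fin n → TangentSpace (cotangentModel n) z) :
    phaseMatrix g c z V = modelPhase g c (cotChart c z) (fun i => dCot c z (V i)) := by
  unfold phaseMatrix modelPhase
  rw [cotChart_fst, gramMatrix_extChartAt g hz]
  congr 1
  · ext i j; simp [dqMatrix, dq_eq hz]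
  · ext i j; simp [thetaMatrix, theta_eq g hz, thetaForm_eq_modelTheta g hz]

theorem phaseMatrix_frame_eq (g : SmoothMetric n S) {c : S} {b x : M} {F : M → CotangentBundle n S}
    (hF : MDifferentiableAt (𝓡 n) (cotangentModel n) F x)
    (hx : x ∈ (chartAt (Model n) b).source) (hz : (F x).proj ∈ (chartAt (Model n) c).source) :
    phaseMatrix g c (F x) (fun i => frame F b i x) =
      modelPhase g c (localRep c b F (extChartAt (𝓡 n) b x)) (fun i =>
        fderiv ℝ (localRep c b F) (extChartAt (𝓡 n) b x) (EuclideanSpace.single i 1)) := by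
  rw [phaseMatrix_eq_modelPhase g hz, localRep_extChartAt c F hx]
  congr 1
  funext i
  rw [← dCot_dF hF hx hz]
  rfl

theorem eventually_charts {c : S} {b x : M} {F : M → CotangentBundle n S}
    (hF : ContinuousAt F x)
    (hx : x ∈ (chartAt (Model n) b).source) (hz : (F x).proj ∈ (chartAt (Model n) c).source) :
    ∀ᶠ y in nhds x, y ∈ (chartAt (Model n) b).source ∧
      (F y).proj ∈ (chartAt (Model n) c).source :=
  Filter.Eventually.and ((chartAt (Model n) b).open_source.mem_nhds hx)
    (hF.eventually ((isOpen_proj_preimage c).mem_nhds hz))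

/-- Point and frame vectors are independent variables here, so the lemma serves single immersions
and time-dependent families alike. -/
theorem contDiffOn_modelPhase_apply (g : SmoothMetric n S) (c : S) (i j : Fin n) :
    ContDiffOn ℝ ∞ (fun b : PhaseModel n × (Fin n → PhaseModel n) => modelPhase g c b.1 b.2 i j)
      {b | b.1.1 ∈ (extChartAt (𝓡 n) c).target} := by
  set s : Set (PhaseModel n × (Fin n → PhaseModel n)) :=
    {b | b.1.1 ∈ (extChartAt (𝓡 n) c).target}
  have hq : ContDiffOn ℝ ∞ (fun b : PhaseModel n × (Fin n → PhaseModel n) => b.1.1) s :=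
    (contDiff_fst.fst).contDiffOn
  have hw : ∀ i, ContDiff ℝ ∞ (fun b : PhaseModel n × (Fin n → PhaseModel n) => b.2 i) :=
    fun i => (contDiff_apply ℝ (PhaseModel n) i).comp contDiff_snd
  have hw1 : ∀ i j, ContDiffOn ℝ ∞
      (fun b : PhaseModel n × (Fin n → PhaseModel n) => (b.2 i).1 j) s := fun i j =>
    (contDiffOn_euclidean.1 ((hw i).fst).contDiffOn j)
  have hθ : ∀ i j, ContDiffOn ℝ ∞ (fun b : PhaseModel n × (Fin n → PhaseModel n) =>
      modelTheta g c b.1 (b.2 i) (EuclideanSpace.single j 1)) s := fun i j =>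
    (contDiffOn_modelTheta g c _).comp (contDiff_fst.prodMk (hw i)).contDiffOn (fun b hb => hb)
  have hre : ContDiff ℝ ∞ (fun r : ℝ => (r : ℂ)) := Complex.ofRealCLM.contDiff
  have e : (fun b : PhaseModel n × (Fin n → PhaseModel n) => modelPhase g c b.1 b.2 i j) =
      fun b => ((∑ l, (b.2 i).1 l * gramMatrix g c b.1.1 l j : ℝ) : ℂ) +
        Complex.I * (modelTheta g c b.1 (b.2 i) (EuclideanSpace.single j 1) : ℂ) := by
    funext b
    simp only [modelPhase, hermMatrix, Matrix.add_apply, Matrix.smul_apply,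
      RingHom.mapMatrix_apply, Matrix.map_apply, Matrix.mul_apply, Matrix.of_apply, smul_eq_mul]
    rfl
  rw [e]
  refine (hre.comp_contDiffOn (ContDiffOn.sum fun l _ => (hw1 i l).mul
    ((contDiffOn_gramMatrix g c l j).comp hq fun b hb => hb))).add
    (contDiffOn_const.mul (hre.comp_contDiffOn (hθ i j)))

end LocalRepresentation

/-! ### The generalized mean curvature form is the Maslov form. -/

section MeanCurvature

variable {n : ℕ} {S : Type*} [TopologicalSpace S]
  [ChartedSpace (EuclideanSpace ℝ (Fin n)) S] [IsManifold (𝓡 n) ∞ S]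
  {M : Type*} [TopologicalSpace M]
  [ChartedSpace (EuclideanSpace ℝ (Fin n)) M] [IsManifold (𝓡 n) ∞ M]

/-- The matrix `phaseMatrix` of the tangent frame of `F`, as a function on the model space. -/
def phaseRep (g : SmoothMetric n S) (c : S) (b : M) (F : M → CotangentBundle n S) (y : Model n) :
    Matrix (Fin n) (Fin n) ℂ :=
  modelPhase g c (localRep c b F y) fun i =>
    fderiv ℝ (localRep c b F) y (EuclideanSpace.single i 1)

theorem fst_localRep_mem_target {c : S} {b x : M} (F : M → CotangentBundle n S)
    (hx : x ∈ (chartAt (Model n) b).source) (hz : (F x).proj ∈ (chartAt (Model n) c).source) :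
    (localRep c b F (extChartAt (𝓡 n) b x)).1 ∈ (extChartAt (𝓡 n) c).target := by
  rw [localRep_extChartAt c F hx, cotChart_fst]
  exact (extChartAt (𝓡 n) c).map_source (by simpa using hz)

theorem isOpen_model_domain {Y : Type*} [TopologicalSpace Y] (c : S) :
    IsOpen {b : PhaseModel n × Y | b.1.1 ∈ (extChartAt (𝓡 n) c).target} :=
  (isOpen_extChartAt_target c).preimage (continuous_fst.comp continuous_fst)

theorem contDiffAt_fderiv_localRep {c : S} {b x : M} {F : M → CotangentBundle n S}
    (hF : ContMDiffAt (𝓡 n) (cotangentModel n) ∞ F x)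
    (hx : x ∈ (chartAt (Model n) b).source) (hz : (F x).proj ∈ (chartAt (Model n) c).source)
    (v : Model n) :
    ContDiffAt ℝ ∞ (fun y => fderiv ℝ (localRep c b F) y v) (extChartAt (𝓡 n) b x) :=
  ((contDiffAt_localRep hF hx hz).fderiv_right (m := ∞) (by simp)).clm_apply contDiffAt_const

theorem contDiffAt_phaseRep (g : SmoothMetric n S) {c : S} {b x : M} {F : M → CotangentBundle n S}
    (hF : ContMDiffAt (𝓡 n) (cotangentModel n) ∞ F x)
    (hx : x ∈ (chartAt (Model n) b).source) (hz : (F x).proj ∈ (chartAt (Model n) c).source)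
    (i j : Fin n) :
    ContDiffAt ℝ ∞ (fun y => phaseRep g c b F y i j) (extChartAt (𝓡 n) b x) := by
  have h1 := (contDiffOn_modelPhase_apply g c i j).contDiffAt
    ((isOpen_model_domain c).mem_nhds (show (localRep c b F (extChartAt (𝓡 n) b x), fun i =>
      fderiv ℝ (localRep c b F) (extChartAt (𝓡 n) b x) (EuclideanSpace.single i 1)) ∈ _ from
      fst_localRep_mem_target F hx hz))
  exact h1.comp (extChartAt (𝓡 n) b x) (f := fun y => (localRep c b F y, fun i =>
    fderiv ℝ (localRep c b F) y (EuclideanSpace.single i 1)))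
    ((contDiffAt_localRep hF hx hz).prodMk
      (contDiffAt_pi.2 fun i => contDiffAt_fderiv_localRep hF hx hz _))

/-- The definition uses different charts at every point; chart independence replaces them by fixed
ones near `x`, where one can differentiate. -/
theorem phaseSq_eventuallyEq (g : SmoothMetric n S) {F : M → CotangentBundle n S}
    (hF : IsLagrangianImmersion F) {c : S} {b x : M} (hx : x ∈ (chartAt (Model n) b).source)
    (hz : (F x).proj ∈ (chartAt (Model n) c).source) :
    phaseSq g F =ᶠ[nhds x] (fun y => (phaseRep g c b F y).det /
      starRingEnd ℂ (phaseRep g c b F y).det) ∘ extChartAt (𝓡 n) b := by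
  filter_upwards [eventually_charts hF.contMDiff.continuous.continuousAt hx hz] with y ⟨h1, h2⟩
  rw [phaseSq_eq g hF h2 h1,
    phaseMatrix_frame_eq g (hF.contMDiff.contMDiffAt.mdifferentiableAt (by simp)) h1 h2]
  rfl

theorem det_phaseRep_ne_zero (g : SmoothMetric n S) {F : M → CotangentBundle n S}
    (hF : IsLagrangianImmersion F) {c : S} {b x : M} (hx : x ∈ (chartAt (Model n) b).source)
    (hz : (F x).proj ∈ (chartAt (Model n) c).source) :
    (phaseRep g c b F (extChartAt (𝓡 n) b x)).det ≠ 0 := by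
  have h := det_phaseMatrix_ne_zero g hF hz hx
  rwa [phaseMatrix_frame_eq g (hF.contMDiff.contMDiffAt.mdifferentiableAt (by simp)) hx hz] at h

theorem differentiableAt_div_conj {E : Type*} [NormedAddCommGroup E] [NormedSpace ℝ E]
    {d : E → ℂ} {y : E} (hd : DifferentiableAt ℝ d y) (h0 : d y ≠ 0) :
    DifferentiableAt ℝ (fun y => d y / starRingEnd ℂ (d y)) y := by
  have hcd : DifferentiableAt ℝ (fun y => starRingEnd ℂ (d y)) y :=
    (Complex.conjCLE.differentiable.differentiableAt).comp y hd
  simp_rw [div_eq_mul_inv]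
  exact hd.mul (hcd.inv (by simpa using h0))

/-- The Maslov form as a logarithmic derivative. -/
theorem maslovForm_eq_trace (g : SmoothMetric n S) {F : M → CotangentBundle n S}
    (hF : IsLagrangianImmersion F) {c : S} {b x : M} (hx : x ∈ (chartAt (Model n) b).source)
    (hz : (F x).proj ∈ (chartAt (Model n) c).source) (v : Model n) :
    maslovForm g F x (vec b x v) =
      ((phaseRep g c b F (extChartAt (𝓡 n) b x))⁻¹ * Matrix.of fun i j =>
        fderiv ℝ (fun y => phaseRep g c b F y i j) (extChartAt (𝓡 n) b x) v).trace.im := by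
  have h0 := det_phaseRep_ne_zero g hF hx hz
  obtain ⟨L, hL, hLv⟩ := hasFDerivAt_det fun i j =>
    ((contDiffAt_phaseRep g hF.contMDiff.contMDiffAt hx hz i j).differentiableAt
      (by simp)).hasFDerivAt
  have hev := phaseSq_eventuallyEq g hF hx hz
  have hd := (mfderiv_of_eventuallyEq_chart hx hev
    (differentiableAt_div_conj hL.differentiableAt h0)).2 v
  have hval := hev.eq_of_nhds
  have h1 := im_conj_ratio_mul_fderiv hL h0 v
  unfold maslovForm dirDerivC
  rw [hval]
  simp only [Function.comp_apply]
  refine (congrArg (fun w : ℂ => (1 / 2 : ℝ) * (starRingEnd ℂ _ * w).im) hd).trans ?_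
  rw [h1, hLv, Matrix.inv_def, Matrix.smul_mul, Matrix.trace_smul, Ring.inverse_eq_inv',
    smul_eq_mul, div_eq_inv_mul]

theorem fderiv_gramMatrix_eq (g : SmoothMetric n S) {c x : S}
    (hx : x ∈ (chartAt (Model n) c).source) (w : Model n) (j k : Fin n) :
    fderiv ℝ (gform g c) (extChartAt (𝓡 n) c x) w (EuclideanSpace.single j 1)
      (EuclideanSpace.single k 1) = ∑ h, w h * metricDeriv g c x h j k := by
  conv_lhs => rw [← sum_smul_single w]
  simp only [map_sum, map_smul, sum_apply, smul_apply, smul_eq_mul, metricDeriv_eq g hx]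

/-- Use `⟨V, JW⟩ = -ω(V, W)` and express `ω` through `dq` and `θ`. -/
theorem meanCurvatureForm_eq_trace (g : SmoothMetric n S) (F : M → CotangentBundle n S) (x : M)
    (u : TangentSpace (𝓡 n) x) :
    meanCurvatureForm g F x u = ((inducedMatrix g F x)⁻¹ *
      (thetaMatrix g (F x).proj (F x) (fun k => nablaAlong g F x u (frame F x k)) *
        (dqMatrix (F x).proj (F x) (fun i => frame F x i x))ᵀ -
      dqMatrix (F x).proj (F x) (fun k => nablaAlong g F x u (frame F x k)) *
        (thetaMatrix g (F x).proj (F x) (fun i => frame F x i x))ᵀ)).trace := by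
  unfold meanCurvatureForm
  rw [Finset.sum_comm, Matrix.trace]
  refine Finset.sum_congr rfl fun l _ => ?_
  rw [Matrix.diag_apply, Matrix.mul_apply]
  refine Finset.sum_congr rfl fun k _ => ?_
  rw [inducedMatrix_inv_symm, sasaki_complexJ, omega_eq_theta g, Matrix.sub_apply,
    Matrix.mul_apply, Matrix.mul_apply, ← Finset.sum_sub_distrib, ← Finset.sum_neg_distrib]
  congr 1
  refine Finset.sum_congr rfl fun m _ => ?_
  simp only [thetaMatrix, dqMatrix, Matrix.of_apply, Matrix.transpose_apply]
  ring

theorem dq_nablaAlong (g : SmoothMetric n S) (F : M → CotangentBundle n S) (x : M)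
    (u : TangentSpace (𝓡 n) x) (Y : (y : M) → TangentSpace (cotangentModel n) (F y)) (k : Fin n) :
    dq (F x).proj k (F x) (nablaAlong g F x u Y) =
      dirDeriv (fun y => dq (F x).proj k (F y) (Y y)) x u +
      ∑ i, ∑ j, christoffel g (F x).proj (F x).proj k j i *
        dq (F x).proj j (F x) (dF F x u) * dq (F x).proj i (F x) (Y x) :=
  dq_frame_sum g (mem_own_chart (F x)) _ _ k

theorem theta_nablaAlong (g : SmoothMetric n S) (F : M → CotangentBundle n S) (x : M)
    (u : TangentSpace (𝓡 n) x) (Y : (y : M) → TangentSpace (cotangentModel n) (F y)) (k : Fin n) :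
    theta g (F x).proj k (F x) (nablaAlong g F x u Y) =
      dirDeriv (fun y => theta g (F x).proj k (F y) (Y y)) x u -
      ∑ i, ∑ j, christoffel g (F x).proj (F x).proj i j k *
        dq (F x).proj j (F x) (dF F x u) * theta g (F x).proj i (F x) (Y x) :=
  theta_frame_sum g (mem_own_chart (F x)) _ _ k

/-- The generalized mean curvature form of a Lagrangian immersion is its Maslov form. -/
theorem meanCurvatureForm_eq_maslovForm (g : SmoothMetric n S) {F : M → CotangentBundle n S}
    (hF : IsLagrangianImmersion F) (x : M) (u : TangentSpace (𝓡 n) x) :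
    meanCurvatureForm g F x u = maslovForm g F x u := by
  have hx : x ∈ (chartAt (Model n) x).source := mem_chart_source _ _
  have hz := mem_own_chart (F x)
  obtain ⟨v, rfl⟩ := vec_surjective hx u
  set c := (F x).proj with hc
  set y₀ := extChartAt (𝓡 n) x x with hy₀
  set Φ := localRep c x F with hΦ
  have hFd : ∀ y, MDifferentiableAt (𝓡 n) (cotangentModel n) F y := fun y =>
    hF.contMDiff.contMDiffAt.mdifferentiableAt (by simp)
  have hΦd := contDiffAt_localRep hF.contMDiff.contMDiffAt hx hz
  have hΦ' := fun w => contDiffAt_fderiv_localRep hF.contMDiff.contMDiffAt hx hz w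
  have hev := eventually_charts hF.contMDiff.continuous.continuousAt hx hz
  have hΦ0 : Φ y₀ = cotChart c (F x) := localRep_extChartAt c F hx
  -- derivatives of the components of the frame
  let Af : Fin n → Fin n → Model n → ℝ := fun i k y => (fderiv ℝ Φ y (EuclideanSpace.single i 1)).1 k
  let Bf : Fin n → Fin n → Model n → ℝ := fun i k y =>
    modelTheta g c (Φ y) (fderiv ℝ Φ y (EuclideanSpace.single i 1)) (EuclideanSpace.single k 1)
  let Gf : Fin n → Fin n → Model n → ℝ := fun j k y => gramMatrix g c (Φ y).1 j k
  have hAf : ∀ i k, DifferentiableAt ℝ (Af i k) y₀ := fun i k =>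
    ((contDiffAt_euclidean.1 ((hΦ' (EuclideanSpace.single i 1)).fst) k)).differentiableAt (by simp)
  have hmem : (Φ y₀).1 ∈ (extChartAt (𝓡 n) c).target := fst_localRep_mem_target F hx hz
  have hBf : ∀ i k, DifferentiableAt ℝ (Bf i k) y₀ := fun i k => by
    have h1 := (contDiffOn_modelTheta g c (EuclideanSpace.single k 1)).contDiffAt
      ((isOpen_model_domain c).mem_nhds (show (Φ y₀, fderiv ℝ Φ y₀ (EuclideanSpace.single i 1)) ∈ _
        from hmem))
    exact (h1.comp y₀ (f := fun y => (Φ y, fderiv ℝ Φ y (EuclideanSpace.single i 1)))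
      (hΦd.prodMk (hΦ' _))).differentiableAt (by simp)
  have hgd : HasFDerivAt (fun y => gform g c (Φ y).1)
      ((fderiv ℝ (gform g c) (extChartAt (𝓡 n) c c)).comp
        ((ContinuousLinearMap.fst ℝ _ _).comp (fderiv ℝ Φ y₀))) y₀ := by
    have h1 : HasFDerivAt (fun y => (Φ y).1)
        ((ContinuousLinearMap.fst ℝ _ _).comp (fderiv ℝ Φ y₀)) y₀ :=
      (hΦd.differentiableAt (by simp)).hasFDerivAt.fst
    refine HasFDerivAt.comp (g := gform g c) y₀ ?_ h1
    rw [hΦ0, cotChart_fst]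
    exact (differentiableAt_gform g hz).hasFDerivAt
  have hGf : ∀ j k, HasFDerivAt (Gf j k) (fderiv ℝ (Gf j k) y₀) y₀ ∧ fderiv ℝ (Gf j k) y₀ v =
      fderiv ℝ (gform g c) (extChartAt (𝓡 n) c c) (fderiv ℝ Φ y₀ v).1
        (EuclideanSpace.single j 1) (EuclideanSpace.single k 1) := fun j k => by
    have h1 := (hgd.clm_apply (hasFDerivAt_const (EuclideanSpace.single j (1 : ℝ)) y₀)).clm_apply
      (hasFDerivAt_const (EuclideanSpace.single k (1 : ℝ)) y₀)
    refine ⟨h1.differentiableAt.hasFDerivAt, ?_⟩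
    have h2 := h1.fderiv
    refine (congrArg (fun L => L v) h2).trans ?_
    simp
  let D₁ : Matrix (Fin n) (Fin n) ℝ := Matrix.of fun i k => fderiv ℝ (Af i k) y₀ v
  let D₂ : Matrix (Fin n) (Fin n) ℝ := Matrix.of fun i k => fderiv ℝ (Bf i k) y₀ v
  let D₃ : Matrix (Fin n) (Fin n) ℝ := Matrix.of fun j k => fderiv ℝ (Gf j k) y₀ v
  let ξ : Fin n → ℝ := fun j => dq c j (F x) (dF F x (vec x x v))
  -- The connection matrix in the direction `u`. It enters the `dq`-components as `Lᵀ` and, dually,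
  -- the `θ`-components as `-L`.
  let L : Matrix (Fin n) (Fin n) ℝ := Matrix.of fun m i => ∑ j, christoffel g c c m j i * ξ j
  have hξ : ∀ j, ξ j = (fderiv ℝ Φ y₀ v).1 j := fun j => by
    simp only [ξ]
    rw [dq_eq hz, dCot_dF (hFd x) hx hz]
  set A := dqMatrix c (F x) (fun i => frame F x i x) with hA
  set B := thetaMatrix g c (F x) (fun i => frame F x i x) with hB
  set σ := metricMatrix g c c with hσ
  have hA' : dqMatrix c (F x) (fun k => nablaAlong g F x (vec x x v) (frame F x k)) =
      D₁ + A * Lᵀ := by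
    ext i k
    simp only [dqMatrix, Matrix.of_apply, Matrix.add_apply, Matrix.mul_apply,
      Matrix.transpose_apply]
    rw [dq_nablaAlong]
    congr 1
    · refine (mfderiv_of_eventuallyEq_chart hx ?_ (hAf i k)).2 v
      filter_upwards [hev] with y ⟨h1, h2⟩
      rw [dq_eq h2]
      have := dCot_dF (hFd y) h1 h2 (EuclideanSpace.single i 1)
      exact congrArg (fun w : PhaseModel n => w.1 k) this
    · refine Finset.sum_congr rfl fun m _ => ?_
      simp only [hA, L, dqMatrix, Matrix.of_apply, ξ, Finset.mul_sum]
      exact Finset.sum_congr rfl fun j _ => by ring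
  have hB' : thetaMatrix g c (F x) (fun k => nablaAlong g F x (vec x x v) (frame F x k)) =
      D₂ - B * L := by
    ext i k
    simp only [thetaMatrix, Matrix.of_apply, Matrix.sub_apply, Matrix.mul_apply]
    rw [theta_nablaAlong]
    congr 1
    · refine (mfderiv_of_eventuallyEq_chart hx ?_ (hBf i k)).2 v
      filter_upwards [hev] with y ⟨h1, h2⟩
      rw [theta_eq g h2, thetaForm_eq_modelTheta g h2]
      have := dCot_dF (hFd y) h1 h2 (EuclideanSpace.single i 1)
      have h3 := localRep_extChartAt c F h1
      simp only [Function.comp_apply, Bf, hΦ]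
      rw [h3, ← this]
      rfl
    · refine Finset.sum_congr rfl fun m _ => ?_
      simp only [hB, L, thetaMatrix, Matrix.of_apply, ξ, Finset.mul_sum]
      exact Finset.sum_congr rfl fun j _ => by ring
  -- Compatibility of the Levi-Civita connection with `σ`, along the projection of `u` to the base.
  have hD₃ : D₃ = Lᵀ * σ + σ * L := by
    ext i k
    simp only [D₃, Matrix.of_apply]
    rw [(hGf i k).2, fderiv_gramMatrix_eq g hz]
    simp only [metricDeriv_eq_christoffel g hz, Matrix.add_apply, Matrix.mul_apply,
      Matrix.transpose_apply, L, Matrix.of_apply, mul_add, Finset.sum_add_distrib, ← hξ]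
    congr 1
    · simp only [Finset.mul_sum, Finset.sum_mul]
      rw [Finset.sum_comm]
      refine Finset.sum_congr rfl fun m _ => Finset.sum_congr rfl fun j _ => ?_
      rw [hσ, metricMatrix_symm g c c k m]
      ring
    · simp only [Finset.mul_sum]
      rw [Finset.sum_comm]
      refine Finset.sum_congr rfl fun m _ => Finset.sum_congr rfl fun j _ => ?_
      ring
  rw [maslovForm_eq_trace g hF hx hz, meanCurvatureForm_eq_trace, inducedMatrix_eq]
  have hWeq : phaseRep g c x F y₀ = hermMatrix σ A B :=
    (phaseMatrix_frame_eq g (hFd x) hx hz).symm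
  have hW0 : (hermMatrix σ A B).det ≠ 0 := by
    rw [← hWeq]; exact det_phaseRep_ne_zero g hF hx hz
  have hmain := trace_inv_gram (metricMatrix_transpose g c c) (isUnit_det_metricMatrix g hz)
    (dqMatrix_mul_thetaMatrix g hF x) hW0 hA' hB' hD₃
  -- What remains is the Leibniz rule: the derivative of `Aσ + √-1 B` is `D₁σ + A D₃ + √-1 D₂`.
  refine hmain.trans ?_
  rw [hWeq]
  congr 4
  ext i k
  have hAv : ∀ l, Af i l y₀ = A i l := fun l => by
    simp only [Af, hA, dqMatrix, Matrix.of_apply]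
    rw [dq_eq hz, ← dCot_dF (hFd x) hx hz]
    rfl
  have hGv : ∀ l, Gf l k y₀ = σ l k := fun l => by
    simp only [Gf]
    rw [hΦ0, cotChart_fst, gramMatrix_extChartAt g hz]
  have e : (fun y => phaseRep g c x F y i k) =
      fun y => ((∑ l, Af i l y * Gf l k y : ℝ) : ℂ) + Complex.I * (Bf i k y : ℂ) := by
    funext y
    simp only [phaseRep, modelPhase, hermMatrix, Matrix.add_apply, Matrix.smul_apply,
      RingHom.mapMatrix_apply, Matrix.map_apply, Matrix.mul_apply, Matrix.of_apply, smul_eq_mul]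
    rfl
  have hsum : HasFDerivAt (fun y => ∑ l, Af i l y * Gf l k y)
      (∑ l, (Af i l y₀ • fderiv ℝ (Gf l k) y₀ + Gf l k y₀ • fderiv ℝ (Af i l) y₀)) y₀ :=
    HasFDerivAt.fun_sum fun l _ => (hAf i l).hasFDerivAt.mul (hGf l k).1
  have hder : HasFDerivAt (fun y => phaseRep g c x F y i k)
      (Complex.ofRealCLM.comp (∑ l, (Af i l y₀ • fderiv ℝ (Gf l k) y₀ +
        Gf l k y₀ • fderiv ℝ (Af i l) y₀)) +
        Complex.I • Complex.ofRealCLM.comp (fderiv ℝ (Bf i k) y₀)) y₀ := by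
    rw [e]
    exact (Complex.ofRealCLM.hasFDerivAt.comp y₀ hsum).add
      ((Complex.ofRealCLM.hasFDerivAt.comp y₀ (hBf i k).hasFDerivAt).const_mul Complex.I)
  rw [Matrix.of_apply, hder.fderiv]
  simp only [add_apply, smul_apply, ContinuousLinearMap.comp_apply, sum_apply, smul_eq_mul,
    Complex.ofRealCLM_apply, Matrix.add_apply, Matrix.smul_apply, RingHom.mapMatrix_apply,
    Matrix.map_apply, Matrix.mul_apply, hAv, hGv]
  congr 1
  simp only [← Finset.sum_add_distrib, D₁, D₃, Matrix.of_apply]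
  refine congrArg (fun r : ℝ => (r : ℂ)) (Finset.sum_congr rfl fun l _ => ?_)
  ring

end MeanCurvature

/-! ### Integrating primitives in time. -/

section Transport

variable {E : Type*} [NormedAddCommGroup E] [NormedSpace ℝ E]

/-- If `∂_s a = dφ`, then differentiation under the integral gives `d(f₀ + ∫ φ) = a(0) + ∫ ∂_s a =
a(τ)`. It is applied to both forms. -/
theorem hasFDerivAt_transport [ProperSpace E] {V : Set E} (hV : IsOpen V) {I : Set ℝ}
    [hI : I.OrdConnected] (h0 : (0 : ℝ) ∈ I) (hnn : ∀ s ∈ I, 0 ≤ s)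
    {φ : E → ℝ → ℝ} {β : E → ℝ → E →L[ℝ] ℝ} {a : E → ℝ → E → ℝ} {f₀ : E → ℝ}
    (hφc : ContinuousOn (fun z : E × ℝ => φ z.1 z.2) (V ×ˢ I))
    (hβc : ContinuousOn (fun z : E × ℝ => β z.1 z.2) (V ×ˢ I))
    (hφ : ∀ y ∈ V, ∀ s ∈ I, HasFDerivAt (fun y => φ y s) (β y s) y)
    (ha : ∀ y ∈ V, ∀ s ∈ I, ∀ v, HasDerivWithinAt (fun s => a y s v) (β y s v) I s)
    {y : E} (hy : y ∈ V) {L₀ : E →L[ℝ] ℝ} (hf₀ : HasFDerivAt f₀ L₀ y) (hL₀ : ∀ v, L₀ v = a y 0 v)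
    {τ : ℝ} (hτ : τ ∈ I) :
    ∃ L : E →L[ℝ] ℝ, HasFDerivAt (fun y => f₀ y + ∫ s in (0 : ℝ)..τ, φ y s) L y ∧
      ∀ v, L v = a y τ v := by
  have hτ0 : 0 ≤ τ := hnn τ hτ
  have hIcc : Set.Icc 0 τ ⊆ I := hI.out h0 hτ
  have hφs : ∀ y ∈ V, ContinuousOn (φ y) (Set.Icc 0 τ) := fun y hy =>
    hφc.comp (Continuous.prodMk_right y).continuousOn fun s hs => ⟨hy, hIcc hs⟩
  have hβs : ContinuousOn (β y) (Set.Icc 0 τ) :=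
    hβc.comp (Continuous.prodMk_right y).continuousOn fun s hs => ⟨hy, hIcc hs⟩
  obtain ⟨r, hr, hrV⟩ := Metric.isOpen_iff.1 hV y hy
  have hball : Metric.closedBall y (r / 2) ⊆ V :=
    (Metric.closedBall_subset_ball (by linarith)).trans hrV
  -- The dominating constant comes from compactness of a closed ball times `[0, τ]`.
  obtain ⟨C, hC⟩ := ((isCompact_closedBall y (r / 2)).prod (isCompact_Icc (a := 0) (b := τ))
    ).exists_bound_of_continuousOn (hβc.mono (Set.prod_mono hball hIcc))
  have hu : Set.uIoc 0 τ ⊆ Set.Icc 0 τ := by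
    rw [Set.uIoc_of_le hτ0]; exact Set.Ioc_subset_Icc_self
  have hint := intervalIntegral.hasFDerivAt_integral_of_dominated_of_fderiv_le
    (μ := MeasureTheory.volume) (F := φ) (F' := β) (x₀ := y) (a := 0) (b := τ)
    (bound := fun _ => C) (s := Metric.closedBall y (r / 2))
    (Metric.closedBall_mem_nhds y (by linarith))
    (by
      filter_upwards [hV.mem_nhds hy] with y' hy'
      exact ((hφs y' hy').mono hu).aestronglyMeasurable measurableSet_uIoc)
    (ContinuousOn.intervalIntegrable (by rw [Set.uIcc_of_le hτ0]; exact hφs y hy))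
    ((hβs.mono hu).aestronglyMeasurable measurableSet_uIoc)
    (Filter.Eventually.of_forall fun s hs y' hy' => hC (y', s) ⟨hy', hu hs⟩)
    intervalIntegrable_const
    (Filter.Eventually.of_forall fun s hs y' hy' => hφ y' (hball hy') s (hIcc (hu hs)))
  refine ⟨_, hf₀.add hint, fun v => ?_⟩
  have hβi : IntervalIntegrable (β y) MeasureTheory.volume 0 τ :=
    ContinuousOn.intervalIntegrable (by rw [Set.uIcc_of_le hτ0]; exact hβs)
  have hβv : ContinuousOn (fun s => β y s v) (Set.Icc 0 τ) :=
    hβs.clm_apply continuousOn_const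
  rw [add_apply, ContinuousLinearMap.intervalIntegral_apply hβi, hL₀,
    intervalIntegral.integral_eq_sub_of_hasDerivAt_of_le hτ0 (f := fun s => a y s v)]
  · ring
  · exact fun s hs => ((ha y hy s (hIcc hs) v).continuousWithinAt).mono hIcc
  · intro s hs
    exact (ha y hy s (hIcc (Set.Ioo_subset_Icc_self hs)) v).hasDerivAt
      (Filter.mem_of_superset (Icc_mem_nhds hs.1 hs.2) hIcc)
  · exact ContinuousOn.intervalIntegrable (by rw [Set.uIcc_of_le hτ0]; exact hβv)

/-- Needed because the primitive of the Maslov form is itself part of an integrand later. -/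
theorem continuousOn_transport {X : Type*} [TopologicalSpace X] [FirstCountableTopology X]
    {V : Set X} {I : Set ℝ} [hI : I.OrdConnected]
    (h0 : (0 : ℝ) ∈ I) (hmax : ∀ s ∈ I, ∃ t ∈ I, s < t) (hnn : ∀ s ∈ I, 0 ≤ s)
    {φ : X → ℝ → ℝ} {f₀ : X → ℝ} (hf₀ : ContinuousOn f₀ V)
    (hφc : ContinuousOn (fun z : X × ℝ => φ z.1 z.2) (V ×ˢ I)) :
    ContinuousOn (fun z : X × ℝ => f₀ z.1 + ∫ s in (0 : ℝ)..z.2, φ z.1 s) (V ×ˢ I) := by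
  rintro ⟨y, s⟩ ⟨hy, hs⟩
  obtain ⟨t, ht, hst⟩ := hmax s hs
  have hIcc : Set.Icc 0 t ⊆ I := hI.out h0 ht
  have h0t : 0 ≤ t := hnn t ht
  -- Clamping time to `[0, t]` with `t > s` makes the integrand continuous for all real times,
  -- without changing the integral near `(y, s)`.
  have hclamp : Continuous fun z : (V × ℝ) × ℝ => φ z.1.1 (Set.projIcc 0 t h0t z.2) := by
    refine ContinuousOn.comp_continuous (s := V ×ˢ I)
      (f := fun z : (V × ℝ) × ℝ => ((z.1.1 : X), (Set.projIcc 0 t h0t z.2 : ℝ))) hφc ?_ ?_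
    · exact (continuous_subtype_val.comp (continuous_fst.comp continuous_fst)).prodMk
        (continuous_subtype_val.comp (continuous_projIcc.comp continuous_snd))
    · exact fun z => ⟨z.1.1.2, hIcc (Set.projIcc 0 t h0t z.2).2⟩
  have hint : Continuous fun z : V × ℝ =>
      ∫ r in (0 : ℝ)..z.2, φ z.1 (Set.projIcc 0 t h0t r) :=
    intervalIntegral.continuous_parametric_intervalIntegral_of_continuous
      (f := fun (z : V × ℝ) r => φ z.1 (Set.projIcc 0 t h0t r)) hclamp continuous_snd
  have hon : ContinuousOn (fun z : X × ℝ => ∫ r in (0 : ℝ)..z.2,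
      φ z.1 (Set.projIcc 0 t h0t r)) (V ×ˢ Set.univ) := by
    rw [continuousOn_iff_continuous_domRestrict]
    exact hint.comp (f := fun z : V ×ˢ (Set.univ : Set ℝ) =>
      ((⟨z.1.1, z.2.1⟩ : V), z.1.2)) (by fun_prop)
  have hc : ContinuousWithinAt (fun z : X × ℝ => f₀ z.1 + ∫ r in (0 : ℝ)..z.2,
      φ z.1 (Set.projIcc 0 t h0t r)) (V ×ˢ I) (y, s) :=
    ((hf₀ y hy).comp continuousWithinAt_fst fun z hz => hz.1).add
      ((hon (y, s) ⟨hy, trivial⟩).mono (Set.prod_mono subset_rfl (Set.subset_univ _)))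
  refine hc.congr_of_eventuallyEq ?_ ?_
  · have h1 : ∀ᶠ z : X × ℝ in nhdsWithin (y, s) (V ×ˢ I), z.2 < t :=
      nhdsWithin_le_nhds (continuousAt_snd.eventually (gt_mem_nhds hst))
    filter_upwards [h1, self_mem_nhdsWithin] with z hz hz'
    congr 1
    refine intervalIntegral.integral_congr fun r hr => ?_
    rw [Set.uIcc_of_le (hnn _ hz'.2)] at hr
    rw [Set.projIcc_of_mem h0t ⟨hr.1, hr.2.trans hz.le⟩]
  · congr 1
    refine intervalIntegral.integral_congr fun r hr => ?_
    rw [Set.uIcc_of_le (hnn _ hs)] at hr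
    rw [Set.projIcc_of_mem h0t ⟨hr.1, hr.2.trans hst.le⟩]

end Transport

/-! ### Exchanging space and time derivatives up to the initial time. -/

section MixedPartials

variable {E F : Type*} [NormedAddCommGroup E] [NormedSpace ℝ E] [NormedAddCommGroup F]
  [NormedSpace ℝ F]

theorem hasFDerivAt_slice {f : E × ℝ → F} {f' : E × ℝ →L[ℝ] F} {I : Set ℝ} {y : E} {s : ℝ}
    (hs : s ∈ I) (h : HasFDerivWithinAt f f' (Set.univ ×ˢ I) (y, s)) :
    HasFDerivAt (fun y => f (y, s)) (f'.comp (ContinuousLinearMap.inl ℝ E ℝ)) y := by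
  rw [← hasFDerivWithinAt_univ]
  exact HasFDerivWithinAt.comp (g := f) (f := fun y => (y, s)) (t := Set.univ ×ˢ I) y h
    (hasFDerivAt_prodMk_left y s).hasFDerivWithinAt fun z _ => ⟨trivial, hs⟩

theorem hasDerivWithinAt_slice {f : E × ℝ → F} {f' : E × ℝ →L[ℝ] F} {I : Set ℝ} {y : E} {s : ℝ}
    (h : HasFDerivWithinAt f f' (Set.univ ×ˢ I) (y, s)) :
    HasDerivWithinAt (fun s => f (y, s)) (f' (0, 1)) I s :=
  h.comp_hasDerivWithinAt s ((hasDerivAt_const s y).prodMk (hasDerivAt_id s)).hasDerivWithinAt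
    fun _ hz => ⟨trivial, hz⟩

theorem uniqueDiffOn_slab {I : Set ℝ} (hI : UniqueDiffOn ℝ I) :
    UniqueDiffOn ℝ ((Set.univ : Set E) ×ˢ I) := uniqueDiffOn_univ.prod hI

/-- The derivative in time of the space derivative is the space derivative of the time
derivative. -/
theorem mixed_partials {f : E × ℝ → F} {I : Set ℝ} (hI : UniqueDiffOn ℝ I) {y : E} {s : ℝ}
    (hs : s ∈ I) (hcl : s ∈ closure (interior I))
    (hf : ContDiffWithinAt ℝ ∞ f (Set.univ ×ˢ I) (y, s)) :
    ∃ B : E →L[ℝ] F, HasFDerivAt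
        (fun y => fderivWithin ℝ f (Set.univ ×ˢ I) (y, s) (0, 1)) B y ∧
      ∀ v, HasDerivWithinAt (fun s => fderivWithin ℝ f (Set.univ ×ˢ I) (y, s) (v, 0)) (B v) I s := by
  have hQ := uniqueDiffOn_slab (E := E) hI
  have hmem : (y, s) ∈ (Set.univ : Set E) ×ˢ I := ⟨trivial, hs⟩
  have h1 := (hf.fderivWithin_right hQ (m := ∞) (by simp) hmem).differentiableWithinAt
    (by simp) |>.hasFDerivWithinAt
  -- At a boundary time the symmetry is inherited from interior points, hence the closure condition.
  have hsymm : IsSymmSndFDerivWithinAt ℝ f (Set.univ ×ˢ I) (y, s) :=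
    hf.isSymmSndFDerivWithinAt minSmoothness_two_le hQ
      (by
        rw [interior_prod_eq, interior_univ, closure_prod_eq, closure_univ]
        exact ⟨trivial, hcl⟩) hmem
  have h2 : ∀ w, HasFDerivWithinAt (fun z => fderivWithin ℝ f (Set.univ ×ˢ I) z w) _
      (Set.univ ×ˢ I) (y, s) := fun w => h1.clm_apply (hasFDerivWithinAt_const w _ _)
  refine ⟨_, hasFDerivAt_slice hs (h2 (0, 1)), fun v => ?_⟩
  have h3 := hasDerivWithinAt_slice (h2 (v, 0))
  convert h3 using 1
  simp
  exact hsymm (v, 0) (0, 1)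

theorem contDiffWithinAt_fderivWithin_apply {f : E × ℝ → F} {I : Set ℝ} (hI : UniqueDiffOn ℝ I)
    {y : E} {s : ℝ} (hs : s ∈ I) (hf : ContDiffWithinAt ℝ ∞ f (Set.univ ×ˢ I) (y, s))
    (w : E × ℝ) :
    ContDiffWithinAt ℝ ∞ (fun z => fderivWithin ℝ f (Set.univ ×ˢ I) z w) (Set.univ ×ˢ I) (y, s) :=
  (hf.fderivWithin_right (uniqueDiffOn_slab hI) (m := ∞) (by simp) ⟨trivial, hs⟩).clm_apply
    contDiffWithinAt_const

end MixedPartials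

/-! ### Time derivatives of the angle form and of the action form. -/

section Slab

variable {E F : Type*} [NormedAddCommGroup E] [NormedSpace ℝ E] [NormedAddCommGroup F]
  [NormedSpace ℝ F]

/-- Half the imaginary part of `conj p * w`: the derivative of half the argument of `p` along `w`,
if `p` has modulus one. -/
def angleRate (p w : ℂ) : ℝ := (1 / 2 : ℝ) * (starRingEnd ℂ p * w).im

theorem hasFDerivWithinAt_angleRate {f h : E → ℂ} {f' h' : E →L[ℝ] ℂ} {s : Set E} {y : E}
    (hf : HasFDerivWithinAt f f' s y) (hh : HasFDerivWithinAt h h' s y) :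
    ∃ L : E →L[ℝ] ℝ, HasFDerivWithinAt (fun y => angleRate (f y) (h y)) L s y ∧
      ∀ v, L v = angleRate (f' v) (h y) + angleRate (f y) (h' v) := by
  have h1 := (Complex.conjCLE.toContinuousLinearMap.hasFDerivAt (x := f y)).comp_hasFDerivWithinAt
    y hf
  have h2 := ((Complex.imCLM.hasFDerivAt (x := starRingEnd ℂ (f y) * h y)).comp_hasFDerivWithinAt
    y (h1.mul hh)).const_mul (1 / 2 : ℝ)
  refine ⟨_, h2, fun v => ?_⟩
  simp [angleRate]
  ring

theorem contDiffWithinAt_angleRate {f h : E → ℂ} {s : Set E} {y : E}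
    (hf : ContDiffWithinAt ℝ ∞ f s y) (hh : ContDiffWithinAt ℝ ∞ h s y) :
    ContDiffWithinAt ℝ ∞ (fun y => angleRate (f y) (h y)) s y := by
  have h1 : ContDiffWithinAt ℝ ∞ (fun y => starRingEnd ℂ (f y)) s y :=
    Complex.conjCLE.contDiff.contDiffAt.comp_contDiffWithinAt y hf
  exact contDiffWithinAt_const.mul
    (Complex.imCLM.contDiff.contDiffAt.comp_contDiffWithinAt y (h1.mul hh))

theorem re_conj_mul_fderivWithin_eq_zero {f : E → ℂ} {s : Set E} (hs : UniqueDiffOn ℝ s) {y : E}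
    (hy : y ∈ s) (hf : DifferentiableWithinAt ℝ f s y)
    (h1 : ∀ z ∈ s, starRingEnd ℂ (f z) * f z = 1) (v : E) :
    (starRingEnd ℂ (f y) * fderivWithin ℝ f s y v).re = 0 := by
  have hf' := hf.hasFDerivWithinAt
  have h2 := ((Complex.conjCLE.toContinuousLinearMap.hasFDerivAt (x := f y)).comp_hasFDerivWithinAt
    y hf').mul hf'
  have h3 : HasFDerivWithinAt (fun _ : E => (1 : ℂ)) _ s y :=
    h2.congr (fun z hz => (h1 z hz).symm) (h1 y hy).symm
  have h4 := congrArg (fun L : E →L[ℝ] ℂ => (L v).re)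
    ((hs y hy).eq h3 (hasFDerivWithinAt_const (1 : ℂ) y s))
  simp at h4 ⊢
  linarith

/-- Both `a` and `b` are imaginary multiples of `p`, so `conj a * b` is real. -/
theorem angleRate_eq_zero {p a b : ℂ} (hp : starRingEnd ℂ p * p = 1)
    (ha : (starRingEnd ℂ p * a).re = 0) (hb : (starRingEnd ℂ p * b).re = 0) :
    angleRate a b = 0 := by
  have h : starRingEnd ℂ a * b = starRingEnd ℂ (starRingEnd ℂ p * a) * (starRingEnd ℂ p * b) := by
    rw [map_mul, Complex.conj_conj]
    linear_combination (-(starRingEnd ℂ a * b)) * hp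
  rw [angleRate, h, Complex.mul_im, Complex.conj_re, ha, hb]
  ring

/-- This is `∂_t(dθ) = d(∂_t θ)` written without a branch of `θ`. The products of first derivatives
vanish as `f` has modulus one, and mixed derivatives of `f` commute. -/
theorem phase_mixed_partials {f : E × ℝ → ℂ} {I : Set ℝ} (hI : UniqueDiffOn ℝ I) {y : E} {s : ℝ}
    (hs : s ∈ I) (hcl : s ∈ closure (interior I))
    (hf : ContDiffWithinAt ℝ ∞ f (Set.univ ×ˢ I) (y, s))
    (h1 : ∀ z ∈ (Set.univ : Set E) ×ˢ I, starRingEnd ℂ (f z) * f z = 1) :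
    ∃ B : E →L[ℝ] ℝ, HasFDerivAt
        (fun y => angleRate (f (y, s)) (fderivWithin ℝ f (Set.univ ×ˢ I) (y, s) (0, 1))) B y ∧
      ∀ v, HasDerivWithinAt
        (fun s => angleRate (f (y, s)) (fderivWithin ℝ f (Set.univ ×ˢ I) (y, s) (v, 0)))
        (B v) I s := by
  obtain ⟨B, hB, hBv⟩ := mixed_partials hI hs hcl hf
  have hQ := uniqueDiffOn_slab (E := E) hI
  have hmem : (y, s) ∈ (Set.univ : Set E) ×ˢ I := ⟨trivial, hs⟩
  have hfd := hf.differentiableWithinAt (by simp)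
  have hre := re_conj_mul_fderivWithin_eq_zero hQ hmem hfd h1
  obtain ⟨L, hL, hLv⟩ := hasFDerivWithinAt_angleRate
    (hasFDerivAt_slice hs hfd.hasFDerivWithinAt).hasFDerivWithinAt (hB.hasFDerivWithinAt
      (s := Set.univ))
  refine ⟨L, hasFDerivWithinAt_univ.1 hL, fun v => ?_⟩
  obtain ⟨K, hK, hKv⟩ := hasFDerivWithinAt_angleRate
    (hasDerivWithinAt_slice hfd.hasFDerivWithinAt).hasFDerivWithinAt (hBv v).hasFDerivWithinAt
  have h2 := hK.hasDerivWithinAt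
  convert h2 using 1
  rw [hKv, hLv, angleRate_eq_zero (h1 _ hmem) (by simpa using hre (v, 0)) (hre _),
    angleRate_eq_zero (h1 _ hmem) (by simpa using hre (0, 1)) (hre _)]
  simp

/-- Cartan's formula for `p dq` in canonical coordinates: the exact part `B` is `d(p(∂_t q))`, the
rest is `-ω(∂_t f, ∂_v f)`. -/
theorem action_mixed_partials {f : E × ℝ → F × (F →L[ℝ] ℝ)} {I : Set ℝ} (hI : UniqueDiffOn ℝ I)
    {y : E} {s : ℝ} (hs : s ∈ I) (hcl : s ∈ closure (interior I))
    (hf : ContDiffWithinAt ℝ ∞ f (Set.univ ×ˢ I) (y, s)) :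
    ∃ B : E →L[ℝ] ℝ, HasFDerivAt
        (fun y => (f (y, s)).2 (fderivWithin ℝ f (Set.univ ×ˢ I) (y, s) (0, 1)).1) B y ∧
      ∀ v, HasDerivWithinAt
        (fun s => (f (y, s)).2 (fderivWithin ℝ f (Set.univ ×ˢ I) (y, s) (v, 0)).1)
        (B v + ((fderivWithin ℝ f (Set.univ ×ˢ I) (y, s) (0, 1)).2
            (fderivWithin ℝ f (Set.univ ×ˢ I) (y, s) (v, 0)).1 -
          (fderivWithin ℝ f (Set.univ ×ˢ I) (y, s) (v, 0)).2
            (fderivWithin ℝ f (Set.univ ×ˢ I) (y, s) (0, 1)).1)) I s := by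
  obtain ⟨B, hB, hBv⟩ := mixed_partials hI hs hcl hf
  have hfd := (hf.differentiableWithinAt (by simp)).hasFDerivWithinAt
  refine ⟨_, (hasFDerivAt_slice hs hfd).snd.clm_apply hB.fst, fun v => ?_⟩
  have h2 := (HasFDerivWithinAt.clm_apply (hasDerivWithinAt_slice hfd).hasFDerivWithinAt.snd
    (hBv v).hasFDerivWithinAt.fst).hasDerivWithinAt
  refine h2.congr_deriv ?_
  simp

end Slab

/-! ### The right-open time interval. -/

section TimeInterval

variable {T : EReal} {s t : ℝ}

instance : (timeInterval T).OrdConnected :=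
  ⟨fun _ ha _ hb _ hc => ⟨ha.1.trans hc.1, (EReal.coe_le_coe_iff.2 hc.2).trans_lt hb.2⟩⟩

theorem zero_mem_timeInterval (ht : t ∈ timeInterval T) : (0 : ℝ) ∈ timeInterval T :=
  ⟨le_rfl, (EReal.coe_le_coe_iff.2 ht.1).trans_lt ht.2⟩

theorem exists_gt_mem_timeInterval (hs : s ∈ timeInterval T) : ∃ t ∈ timeInterval T, s < t := by
  obtain ⟨t, h1, h2⟩ := EReal.lt_iff_exists_real_btwn.1 hs.2
  have h3 := EReal.coe_lt_coe_iff.1 h1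
  exact ⟨t, ⟨hs.1.trans h3.le, h2⟩, h3⟩

theorem uniqueDiffOn_timeInterval (T : EReal) : UniqueDiffOn ℝ (timeInterval T) := fun s hs => by
  obtain ⟨t, ht, hst⟩ := exists_gt_mem_timeInterval hs
  exact (uniqueDiffOn_Icc (hs.1.trans_lt hst) s ⟨hs.1, hst.le⟩).mono
    (Set.OrdConnected.out inferInstance (zero_mem_timeInterval hs) ht)

theorem mem_closure_interior_timeInterval (hs : s ∈ timeInterval T) :
    s ∈ closure (interior (timeInterval T)) := by
  obtain ⟨t, ht, hst⟩ := exists_gt_mem_timeInterval hs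
  have h : Set.Ioo 0 t ⊆ interior (timeInterval T) := interior_maximal
    (Set.Ioo_subset_Icc_self.trans
      (Set.OrdConnected.out inferInstance (zero_mem_timeInterval hs) ht)) isOpen_Ioo
  refine closure_mono h ?_
  rw [closure_Ioo (hs.1.trans_lt hst).ne]
  exact ⟨hs.1, hst.le⟩

end TimeInterval

/-! ### Families of maps in charts, and the duality between `Ĥ` and the Maslov form. -/

section Flow

variable {n : ℕ} {S : Type*} [TopologicalSpace S]
  [ChartedSpace (EuclideanSpace ℝ (Fin n)) S] [IsManifold (𝓡 n) ∞ S]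
  {M : Type*} [TopologicalSpace M]
  [ChartedSpace (EuclideanSpace ℝ (Fin n)) M] [IsManifold (𝓡 n) ∞ M]
  {F : M × ℝ → CotangentBundle n S} {I : Set ℝ}

/-- A family of maps into the cotangent bundle, in the charts around `b` and `c`. -/
def flowRep (c : S) (b : M) (F : M × ℝ → CotangentBundle n S) (z : Model n × ℝ) : PhaseModel n :=
  cotChart c (F ((extChartAt (𝓡 n) b).symm z.1, z.2))

/-- The velocity `∂F/∂t`. -/
def velocity (F : M × ℝ → CotangentBundle n S) (I : Set ℝ) (x : M) (t : ℝ) :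
    TangentSpace (cotangentModel n) (F (x, t)) :=
  mfderivWithin 𝓘(ℝ, ℝ) (cotangentModel n) (fun s : ℝ => F (x, s)) I t (1 : ℝ)

theorem symm_extChartAt_mem {b : M} {y : Model n} (hy : y ∈ (extChartAt (𝓡 n) b).target) :
    (extChartAt (𝓡 n) b).symm y ∈ (chartAt (Model n) b).source := by
  simpa using (extChartAt (𝓡 n) b).map_target hy

theorem contMDiffWithinAt_flow_symm
    (hF : ContMDiffOn ((𝓡 n).prod 𝓘(ℝ, ℝ)) (cotangentModel n) ∞ F (Set.univ ×ˢ I))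
    {b : M} {y : Model n} (hy : y ∈ (extChartAt (𝓡 n) b).target) {t : ℝ} (ht : t ∈ I) :
    ContMDiffWithinAt 𝓘(ℝ, Model n × ℝ) (cotangentModel n) ∞
      (fun z : Model n × ℝ => F ((extChartAt (𝓡 n) b).symm z.1, z.2)) (Set.univ ×ˢ I) (y, t) := by
  have h1 : ContMDiffAt 𝓘(ℝ, Model n) (𝓡 n) ∞ (extChartAt (𝓡 n) b).symm y :=
    (contMDiffOn_extChartAt_symm b).contMDiffAt ((isOpen_extChartAt_target b).mem_nhds hy)
  have h2 : ContMDiffAt 𝓘(ℝ, Model n × ℝ) (𝓡 n) ∞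
      (fun z : Model n × ℝ => (extChartAt (𝓡 n) b).symm z.1) (y, t) :=
    ContMDiffAt.comp (g := (extChartAt (𝓡 n) b).symm) (f := Prod.fst) (y, t) h1
      contDiff_fst.contMDiff.contMDiffAt
  have h3 : ContMDiffAt 𝓘(ℝ, Model n × ℝ) 𝓘(ℝ, ℝ) ∞ (fun z : Model n × ℝ => z.2) (y, t) :=
    contDiff_snd.contMDiff.contMDiffAt
  exact ContMDiffWithinAt.comp₂ (h := F) (hF _ ⟨trivial, ht⟩) h2.contMDiffWithinAt
    h3.contMDiffWithinAt fun z hz => ⟨trivial, hz.2⟩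

theorem contDiffWithinAt_flowRep
    (hF : ContMDiffOn ((𝓡 n).prod 𝓘(ℝ, ℝ)) (cotangentModel n) ∞ F (Set.univ ×ˢ I))
    {c : S} {b : M} {y : Model n} (hy : y ∈ (extChartAt (𝓡 n) b).target) {t : ℝ} (ht : t ∈ I)
    (hz : (F ((extChartAt (𝓡 n) b).symm y, t)).proj ∈ (chartAt (Model n) c).source) :
    ContDiffWithinAt ℝ ∞ (flowRep c b F) (Set.univ ×ˢ I) (y, t) := by
  rw [← contMDiffWithinAt_iff_contDiffWithinAt]
  exact ContMDiffAt.comp_contMDiffWithinAt (g := cotChart c)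
    (f := fun z : Model n × ℝ => F ((extChartAt (𝓡 n) b).symm z.1, z.2)) (y, t)
    (contMDiffAt_cotChart hz) (contMDiffWithinAt_flow_symm hF hy ht)

theorem eventually_flow_charts
    (hF : ContMDiffOn ((𝓡 n).prod 𝓘(ℝ, ℝ)) (cotangentModel n) ∞ F (Set.univ ×ˢ I))
    {c : S} {b : M} {y : Model n} (hy : y ∈ (extChartAt (𝓡 n) b).target) {t : ℝ} (ht : t ∈ I)
    (hz : (F ((extChartAt (𝓡 n) b).symm y, t)).proj ∈ (chartAt (Model n) c).source) :
    ∀ᶠ z : Model n × ℝ in nhdsWithin (y, t) (Set.univ ×ˢ I), z.1 ∈ (extChartAt (𝓡 n) b).target ∧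
      z.2 ∈ I ∧ (F ((extChartAt (𝓡 n) b).symm z.1, z.2)).proj ∈ (chartAt (Model n) c).source := by
  have h1 : ∀ᶠ z : Model n × ℝ in nhdsWithin (y, t) (Set.univ ×ˢ I),
      z.1 ∈ (extChartAt (𝓡 n) b).target := nhdsWithin_le_nhds
    (continuousAt_fst.eventually ((isOpen_extChartAt_target b).mem_nhds hy))
  have h2 := (contMDiffWithinAt_flow_symm hF hy ht).continuousWithinAt.eventually
    ((isOpen_proj_preimage c).mem_nhds hz)
  filter_upwards [h1, h2, self_mem_nhdsWithin] with z hz1 hz2 hz3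
  exact ⟨hz1, hz3.2, hz2⟩

theorem fderiv_localRep_eq
    (hF : ContMDiffOn ((𝓡 n).prod 𝓘(ℝ, ℝ)) (cotangentModel n) ∞ F (Set.univ ×ˢ I))
    {c : S} {b : M} {y : Model n} (hy : y ∈ (extChartAt (𝓡 n) b).target) {t : ℝ} (ht : t ∈ I)
    (hz : (F ((extChartAt (𝓡 n) b).symm y, t)).proj ∈ (chartAt (Model n) c).source) (v : Model n) :
    fderiv ℝ (localRep c b fun x => F (x, t)) y v =
      fderivWithin ℝ (flowRep c b F) (Set.univ ×ˢ I) (y, t) (v, 0) := by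
  have h := hasFDerivAt_slice ht ((contDiffWithinAt_flowRep hF hy ht hz).differentiableWithinAt
    (by simp)).hasFDerivWithinAt
  have h2 : HasFDerivAt (localRep c b fun x => F (x, t)) _ y := h
  rw [h2.fderiv]
  simp

theorem contMDiffWithinAt_time_slice
    (hF : ContMDiffOn ((𝓡 n).prod 𝓘(ℝ, ℝ)) (cotangentModel n) ∞ F (Set.univ ×ˢ I))
    (x : M) {t : ℝ} (ht : t ∈ I) :
    ContMDiffWithinAt 𝓘(ℝ, ℝ) (cotangentModel n) ∞ (fun s : ℝ => F (x, s)) I t :=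
  ContMDiffWithinAt.comp₂ (h := F) (hF _ ⟨trivial, ht⟩) contMDiffWithinAt_const
    contMDiffWithinAt_id fun _ hz => ⟨trivial, hz⟩

theorem dCot_velocity (hI : UniqueDiffOn ℝ I)
    (hF : ContMDiffOn ((𝓡 n).prod 𝓘(ℝ, ℝ)) (cotangentModel n) ∞ F (Set.univ ×ˢ I))
    {c : S} {b : M} {y : Model n} (hy : y ∈ (extChartAt (𝓡 n) b).target) {t : ℝ} (ht : t ∈ I)
    (hz : (F ((extChartAt (𝓡 n) b).symm y, t)).proj ∈ (chartAt (Model n) c).source) :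
    dCot c (F ((extChartAt (𝓡 n) b).symm y, t)) (velocity F I ((extChartAt (𝓡 n) b).symm y) t) =
      fderivWithin ℝ (flowRep c b F) (Set.univ ×ˢ I) (y, t) (0, 1) := by
  set x := (extChartAt (𝓡 n) b).symm y with hx
  have h1 := hasDerivWithinAt_slice ((contDiffWithinAt_flowRep hF hy ht hz).differentiableWithinAt
    (by simp)).hasFDerivWithinAt
  have h2 := HasMFDerivAt.comp_hasMFDerivWithinAt (g := cotChart c) (f := fun s : ℝ => F (x, s)) t
    (mdifferentiableAt_cotChart hz).hasMFDerivAt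
    ((contMDiffWithinAt_time_slice hF x ht).mdifferentiableWithinAt (by simp)).hasMFDerivWithinAt
  let D : ℝ →L[ℝ] PhaseModel n :=
    (mfderiv (cotangentModel n) 𝓘(ℝ, PhaseModel n) (cotChart c) (F (x, t))).comp
      (mfderivWithin 𝓘(ℝ, ℝ) (cotangentModel n) (fun s : ℝ => F (x, s)) I t)
  have h3 : HasFDerivWithinAt (fun s => flowRep c b F (y, s)) D I t :=
    hasMFDerivWithinAt_iff_hasFDerivWithinAt.1 h2
  have h4 := congrArg (fun L : ℝ →L[ℝ] PhaseModel n => L 1)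
    ((hI t ht).eq h3 h1.hasFDerivWithinAt)
  refine Eq.trans (b := D 1) rfl (h4.trans ?_)
  simp

theorem liouville_eq {c : S} {z : CotangentBundle n S}
    (hz : z.proj ∈ (chartAt (Model n) c).source) (V : TangentSpace (cotangentModel n) z) :
    liouville z V = (cotChart c z).2 (dCot c z V).1 := by
  have hproj : MDifferentiableAt (cotangentModel n) (𝓡 n)
      (fun w : CotangentBundle n S => w.proj) z :=
    ((Bundle.contMDiff_proj (n := ∞) (fun x : S => TangentSpace (𝓡 n) x →L[ℝ]
      Bundle.Trivial S ℝ x)).contMDiffAt).mdifferentiableAt (by simp)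
  obtain ⟨v, hv⟩ := vec_surjective hz (mfderiv (cotangentModel n) (𝓡 n)
    (fun w : CotangentBundle n S => w.proj) z V)
  have hchart : MDifferentiableAt (𝓡 n) 𝓘(ℝ, Model n) (extChartAt (𝓡 n) c) z.proj :=
    mdifferentiableAt_extChartAt hz
  have h1 := mfderiv_comp_apply (I' := 𝓡 n) (g := extChartAt (𝓡 n) c)
    (f := fun w : CotangentBundle n S => w.proj) z hchart hproj V
  have h2 : (extChartAt (𝓡 n) c) ∘ (fun w : CotangentBundle n S => w.proj) =
      ContinuousLinearMap.fst ℝ (Model n) (Model n →L[ℝ] ℝ) ∘ cotChart c := by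
    funext w; exact (cotChart_fst c w).symm
  have h3 : mfderiv (cotangentModel n) 𝓘(ℝ, Model n)
      ((extChartAt (𝓡 n) c) ∘ (fun w : CotangentBundle n S => w.proj)) z V = (dCot c z V).1 := by
    rw [h2, mfderiv_comp (I' := 𝓘(ℝ, PhaseModel n)) z
      (ContinuousLinearMap.mdifferentiableAt _) (mdifferentiableAt_cotChart hz),
      ContinuousLinearMap.mfderiv_eq]
    rfl
  have h4 : mfderiv (𝓡 n) 𝓘(ℝ, Model n) (extChartAt (𝓡 n) c) z.proj (vec c z.proj v) = v := by
    have h := (mfderiv_of_eventuallyEq_chart (f' := fun y => y) hz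
      (Filter.EventuallyEq.rfl (f := extChartAt (𝓡 n) c)) differentiableAt_fun_id).2 v
    rw [h, fderiv_fun_id]
    rfl
  have h5 : (dCot c z V).1 = v := by
    rw [← h3, h1, ← h4, hv]
  rw [h5, cotChart_snd hz, hv]
  rfl

theorem omega_eq_dCot (z : CotangentBundle n S) (V W : TangentSpace (cotangentModel n) z) :
    omega z V W = (dCot z.proj z W).2 (dCot z.proj z V).1 -
      (dCot z.proj z V).2 (dCot z.proj z W).1 := by
  have hz := mem_own_chart z
  have h : ∀ V W : TangentSpace (cotangentModel n) z, (dCot z.proj z W).2 (dCot z.proj z V).1 =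
      ∑ i, dq z.proj i z V * dp z.proj i z W := fun V W => by
    conv_lhs => rw [← sum_smul_single (dCot z.proj z V).1]
    simp only [map_sum, map_smul, smul_eq_mul, dq_eq hz, dp_eq hz]
  rw [h, h, ← Finset.sum_sub_distrib]
  exact Finset.sum_congr rfl fun i _ => by ring

theorem maslovForm_vec (g : SmoothMetric n S) (F : M → CotangentBundle n S) (b x : M)
    (v : Model n) : maslovForm g F x (vec b x v) = ∑ i, v i * maslovForm g F x (coordVec b i x) := by
  let L : TangentSpace (𝓡 n) x →ₗ[ℝ] ℂ := (mfderiv (𝓡 n) 𝓘(ℝ, ℂ) (phaseSq g F) x).toLinearMap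
  let m : TangentSpace (𝓡 n) x →ₗ[ℝ] ℝ :=
    (1 / 2 : ℝ) • (Complex.imLm ∘ₗ LinearMap.mulLeft ℝ (starRingEnd ℂ (phaseSq g F x)) ∘ₗ L)
  have hm : ∀ u, maslovForm g F x u = m u := fun u => rfl
  simp only [hm]
  rw [vec_eq_sum, map_sum]
  exact Finset.sum_congr rfl fun i _ => map_smul _ _ _

/-- The generalized mean curvature vector is dual to minus the generalized mean curvature form. -/
theorem omega_meanCurvatureVector (g : SmoothMetric n S) {F : M → CotangentBundle n S}
    (hF : IsLagrangianImmersion F) (x : M) (u : TangentSpace (𝓡 n) x) :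
    omega (F x) (meanCurvatureVector g F x) (dF F x u) = -maslovForm g F x u := by
  obtain ⟨v, rfl⟩ := vec_surjective (mem_chart_source _ x) u
  have hinv : (inducedMatrix g F x)⁻¹ * inducedMatrix g F x = 1 :=
    Matrix.nonsing_inv_mul _ (isUnit_iff_ne_zero.2 (det_inducedMatrix_ne_zero g hF x))
  have hω : ∀ j, omega (F x) (complexJ g (F x) (frame F x j x)) (dF F x (vec x x v)) =
      -∑ k, v k * inducedMatrix g F x j k := fun j => by
    rw [omega_complexJ, frame_sum, ← sasakiₗ_apply, map_sum]
    congr 1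
    refine Finset.sum_congr rfl fun k _ => ?_
    rw [map_smul, sasakiₗ_apply]
    rfl
  rw [maslovForm_vec, ← omegaₗ_apply, meanCurvatureVector]
  simp only [map_sum, map_smul, omegaₗ_apply, smul_eq_mul, hω]
  rw [← Finset.sum_neg_distrib]
  refine Finset.sum_congr rfl fun i _ => ?_
  -- The inverse metric in `Ĥ` cancels the metric produced by `ω(J F_j, F_k) = -G_{jk}`.
  have h : ∑ j, (inducedMatrix g F x)⁻¹ i j * ∑ k, v k * inducedMatrix g F x j k = v i := by
    simp only [Finset.mul_sum]
    rw [Finset.sum_comm]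
    have h1 : ∀ k, ∑ j, (inducedMatrix g F x)⁻¹ i j * (v k * inducedMatrix g F x j k) =
        v k * (1 : Matrix (Fin n) (Fin n) ℝ) i k := fun k => by
      rw [← hinv, Matrix.mul_apply, Finset.mul_sum]
      exact Finset.sum_congr rfl fun j _ => by ring
    simp [h1, Matrix.one_apply]
  rw [← meanCurvatureForm_eq_maslovForm g hF]
  conv_rhs => rw [← h]
  rw [Finset.sum_mul, ← Finset.sum_neg_distrib]
  exact Finset.sum_congr rfl fun j _ => by ring

end Flow

/-! ### Continuity and limits on slices of the space-time slab. -/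

section SlabSlices

variable {E F : Type*} [NormedAddCommGroup E] [NormedSpace ℝ E] [NormedAddCommGroup F]
  [NormedSpace ℝ F] {I : Set ℝ}

theorem tendsto_space_slice {y : E} {s : ℝ} (hs : s ∈ I) :
    Filter.Tendsto (fun y' => (y', s)) (nhds y) (nhdsWithin (y, s) ((Set.univ : Set E) ×ˢ I)) :=
  tendsto_nhdsWithin_iff.2 ⟨(Continuous.prodMk_left s).tendsto y,
    Filter.Eventually.of_forall fun _ => ⟨trivial, hs⟩⟩

theorem tendsto_time_slice (y : E) (s : ℝ) :
    Filter.Tendsto (fun s' => (y, s')) (nhdsWithin s I)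
      (nhdsWithin (y, s) ((Set.univ : Set E) ×ˢ I)) :=
  tendsto_nhdsWithin_iff.2 ⟨((Continuous.prodMk_right y).tendsto s).mono_left nhdsWithin_le_nhds,
    by filter_upwards [self_mem_nhdsWithin] with s' hs' using ⟨trivial, hs'⟩⟩

theorem continuousOn_slab {V : Set E} {φ : E × ℝ → F}
    (h : ∀ y ∈ V, ∀ s ∈ I, ContDiffWithinAt ℝ ∞ φ (Set.univ ×ˢ I) (y, s)) :
    ContinuousOn φ (V ×ˢ I) := fun z hz =>
  (h z.1 hz.1 z.2 hz.2).continuousWithinAt.mono (Set.prod_mono (Set.subset_univ _) subset_rfl)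

theorem continuousOn_slab_fderiv (hI : UniqueDiffOn ℝ I) {V : Set E} {φ : E × ℝ → F}
    (h : ∀ y ∈ V, ∀ s ∈ I, ContDiffWithinAt ℝ ∞ φ (Set.univ ×ˢ I) (y, s)) :
    ContinuousOn (fun z => fderiv ℝ (fun y => φ (y, z.2)) z.1) (V ×ˢ I) := by
  have h1 : ContinuousOn (fun z => (fderivWithin ℝ φ (Set.univ ×ˢ I) z).comp
      (ContinuousLinearMap.inl ℝ E ℝ)) (V ×ˢ I) := fun z hz => by
    have h2 := ((h z.1 hz.1 z.2 hz.2).fderivWithin_right (uniqueDiffOn_slab hI) (m := ∞) (by simp)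
      ⟨trivial, hz.2⟩).continuousWithinAt.mono (Set.prod_mono (Set.subset_univ V) subset_rfl)
    exact h2.clm_comp continuousWithinAt_const
  refine h1.congr fun z hz => ?_
  exact (hasFDerivAt_slice hz.2 ((h z.1 hz.1 z.2 hz.2).differentiableWithinAt
    (by simp)).hasFDerivWithinAt).fderiv

end SlabSlices

/-! ### Evolution of the Maslov form and of the Liouville form. -/

section Flow

variable {n : ℕ} {S : Type*} [TopologicalSpace S]
  [ChartedSpace (EuclideanSpace ℝ (Fin n)) S] [IsManifold (𝓡 n) ∞ S]
  {M : Type*} [TopologicalSpace M]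
  [ChartedSpace (EuclideanSpace ℝ (Fin n)) M] [IsManifold (𝓡 n) ∞ M]
  {F : M × ℝ → CotangentBundle n S} {I : Set ℝ}

/-- The squared phase of a family of immersions, in the chart around `b`. -/
def phaseFlow (g : SmoothMetric n S) (b : M) (F : M × ℝ → CotangentBundle n S)
    (z : Model n × ℝ) : ℂ :=
  phaseSq g (fun x => F (x, z.2)) ((extChartAt (𝓡 n) b).symm z.1)

/-- The time derivative of the Lagrangian angle. -/
def phaseSpeed (g : SmoothMetric n S) (F : M × ℝ → CotangentBundle n S) (I : Set ℝ) (x : M)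
    (t : ℝ) : ℝ :=
  angleRate (phaseSq g (fun x => F (x, t)) x)
    (derivWithin (fun s => phaseSq g (fun x => F (x, s)) x) I t)

/-- The Liouville form on the velocity of a family of immersions. -/
def actionSpeed (F : M × ℝ → CotangentBundle n S) (I : Set ℝ) (x : M) (t : ℝ) : ℝ :=
  liouville (F (x, t)) (velocity F I x t)

/-- Near `(y, t)` the squared phase is a quotient of determinants in fixed charts, and the spatial
derivatives in it are slab derivatives of the smooth `flowRep`. -/
theorem contDiffWithinAt_phaseFlow (g : SmoothMetric n S) (hI : UniqueDiffOn ℝ I)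
    (hF : ContMDiffOn ((𝓡 n).prod 𝓘(ℝ, ℝ)) (cotangentModel n) ∞ F (Set.univ ×ˢ I))
    (hL : ∀ t ∈ I, IsLagrangianImmersion fun x => F (x, t))
    {b : M} {y : Model n} (hy : y ∈ (extChartAt (𝓡 n) b).target) {t : ℝ} (ht : t ∈ I) :
    ContDiffWithinAt ℝ ∞ (phaseFlow g b F) (Set.univ ×ˢ I) (y, t) := by
  have hz := mem_own_chart (F ((extChartAt (𝓡 n) b).symm y, t))
  set c := (F ((extChartAt (𝓡 n) b).symm y, t)).proj with hc
  let W : Model n × ℝ → Matrix (Fin n) (Fin n) ℂ := fun z => modelPhase g c (flowRep c b F z)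
    fun i => fderivWithin ℝ (flowRep c b F) (Set.univ ×ˢ I) z (EuclideanSpace.single i 1, 0)
  have hrep := contDiffWithinAt_flowRep hF hy ht hz
  have hmem : (flowRep c b F (y, t)).1 ∈ (extChartAt (𝓡 n) c).target := by
    rw [flowRep, cotChart_fst]
    exact (extChartAt (𝓡 n) c).map_source (by rw [extChartAt_source]; exact hz)
  have hW : ∀ i j, ContDiffWithinAt ℝ ∞ (fun z => W z i j) (Set.univ ×ˢ I) (y, t) := fun i j => by
    have h1 := (contDiffOn_modelPhase_apply g c i j).contDiffAt
      ((isOpen_model_domain c).mem_nhds (show (flowRep c b F (y, t), fun i =>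
        fderivWithin ℝ (flowRep c b F) (Set.univ ×ˢ I) (y, t) (EuclideanSpace.single i 1, 0)) ∈ _
        from hmem))
    exact h1.comp_contDiffWithinAt (y, t) (f := fun z => (flowRep c b F z, fun i =>
      fderivWithin ℝ (flowRep c b F) (Set.univ ×ˢ I) z (EuclideanSpace.single i 1, 0)))
      (hrep.prodMk (contDiffWithinAt_pi.2 fun i =>
        contDiffWithinAt_fderivWithin_apply hI ht hrep _))
  have heq : ∀ y' ∈ (extChartAt (𝓡 n) b).target, ∀ t' ∈ I,
      (F ((extChartAt (𝓡 n) b).symm y', t')).proj ∈ (chartAt (Model n) c).source →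
      phaseMatrix g c (F ((extChartAt (𝓡 n) b).symm y', t'))
        (fun i => frame (fun x => F (x, t')) b i ((extChartAt (𝓡 n) b).symm y')) = W (y', t') := by
    intro y' hy' t' ht' hz'
    have h1 := phaseMatrix_frame_eq g (F := fun x => F (x, t')) ((hL t'
      ht').contMDiff.contMDiffAt.mdifferentiableAt (by simp)) (symm_extChartAt_mem hy') hz'
    rw [(extChartAt (𝓡 n) b).right_inv hy'] at h1
    refine h1.trans ?_
    simp only [fderiv_localRep_eq hF hy' ht' hz']
    rfl
  have hdet := contDiffWithinAt_det hW
  have h0 : (W (y, t)).det ≠ 0 := by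
    rw [← heq y hy t ht hz]
    exact det_phaseMatrix_ne_zero g (hL t ht) hz (symm_extChartAt_mem hy)
  have hcdet : ContDiffWithinAt ℝ ∞ (fun z => starRingEnd ℂ (W z).det) (Set.univ ×ˢ I) (y, t) :=
    Complex.conjCLE.contDiff.contDiffAt.comp_contDiffWithinAt (y, t) hdet
  have hev : phaseFlow g b F =ᶠ[nhdsWithin (y, t) (Set.univ ×ˢ I)]
      fun z => (W z).det * (starRingEnd ℂ (W z).det)⁻¹ := by
    filter_upwards [eventually_flow_charts hF hy ht hz] with z ⟨h1, h2, h3⟩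
    rw [← heq z.1 h1 z.2 h2 h3, ← div_eq_mul_inv]
    exact phaseSq_eq g (hL z.2 h2) h3 (symm_extChartAt_mem h1)
  exact (hdet.mul (hcdet.inv (by simpa using h0))).congr_of_eventuallyEq_of_mem hev ⟨trivial, ht⟩

theorem phaseFlow_norm (g : SmoothMetric n S) (hL : ∀ t ∈ I, IsLagrangianImmersion fun x => F (x, t))
    (b : M) : ∀ z ∈ (Set.univ : Set (Model n)) ×ˢ I,
      starRingEnd ℂ (phaseFlow g b F z) * phaseFlow g b F z = 1 := fun z hz =>
  norm_phaseSq g (hL z.2 hz.2) _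

theorem maslovForm_flow (g : SmoothMetric n S) (hI : UniqueDiffOn ℝ I)
    (hF : ContMDiffOn ((𝓡 n).prod 𝓘(ℝ, ℝ)) (cotangentModel n) ∞ F (Set.univ ×ˢ I))
    (hL : ∀ t ∈ I, IsLagrangianImmersion fun x => F (x, t))
    {b : M} {y : Model n} (hy : y ∈ (extChartAt (𝓡 n) b).target) {t : ℝ} (ht : t ∈ I)
    (v : Model n) :
    maslovForm g (fun x => F (x, t)) ((extChartAt (𝓡 n) b).symm y)
        (vec b ((extChartAt (𝓡 n) b).symm y) v) =
      angleRate (phaseFlow g b F (y, t))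
        (fderivWithin ℝ (phaseFlow g b F) (Set.univ ×ˢ I) (y, t) (v, 0)) := by
  have hx := symm_extChartAt_mem hy
  have hr := (extChartAt (𝓡 n) b).right_inv hy
  have h1 := hasFDerivAt_slice ht ((contDiffWithinAt_phaseFlow g hI hF hL hy
    ht).differentiableWithinAt (by simp)).hasFDerivWithinAt
  have hev : phaseSq g (fun x => F (x, t)) =ᶠ[nhds ((extChartAt (𝓡 n) b).symm y)]
      (fun y => phaseFlow g b F (y, t)) ∘ extChartAt (𝓡 n) b := by
    filter_upwards [(chartAt (Model n) b).open_source.mem_nhds hx] with x hx'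
    simp only [Function.comp_apply, phaseFlow]
    rw [(extChartAt (𝓡 n) b).left_inv (by simpa using hx')]
  have h2 := (mfderiv_of_eventuallyEq_chart hx hev (by rw [hr]; exact h1.differentiableAt)).2 v
  rw [hr, h1.fderiv] at h2
  unfold maslovForm dirDerivC
  refine (congrArg (fun w : ℂ => (1 / 2 : ℝ) * (starRingEnd ℂ _ * w).im) h2).trans ?_
  simp [angleRate, phaseFlow]

theorem phaseSpeed_flow (g : SmoothMetric n S) (hI : UniqueDiffOn ℝ I)
    (hF : ContMDiffOn ((𝓡 n).prod 𝓘(ℝ, ℝ)) (cotangentModel n) ∞ F (Set.univ ×ˢ I))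
    (hL : ∀ t ∈ I, IsLagrangianImmersion fun x => F (x, t))
    {b : M} {y : Model n} (hy : y ∈ (extChartAt (𝓡 n) b).target) {t : ℝ} (ht : t ∈ I) :
    phaseSpeed g F I ((extChartAt (𝓡 n) b).symm y) t =
      angleRate (phaseFlow g b F (y, t))
        (fderivWithin ℝ (phaseFlow g b F) (Set.univ ×ˢ I) (y, t) (0, 1)) := by
  have h1 := hasDerivWithinAt_slice ((contDiffWithinAt_phaseFlow g hI hF hL hy
    ht).differentiableWithinAt (by simp)).hasFDerivWithinAt
  rw [phaseSpeed]
  congr 1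
  exact h1.derivWithin (hI t ht)

theorem contDiffWithinAt_phaseSpeed (g : SmoothMetric n S) (hI : UniqueDiffOn ℝ I)
    (hF : ContMDiffOn ((𝓡 n).prod 𝓘(ℝ, ℝ)) (cotangentModel n) ∞ F (Set.univ ×ˢ I))
    (hL : ∀ t ∈ I, IsLagrangianImmersion fun x => F (x, t))
    {b : M} {y : Model n} (hy : y ∈ (extChartAt (𝓡 n) b).target) {t : ℝ} (ht : t ∈ I) :
    ContDiffWithinAt ℝ ∞
      (fun z : Model n × ℝ => phaseSpeed g F I ((extChartAt (𝓡 n) b).symm z.1) z.2)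
      (Set.univ ×ˢ I) (y, t) := by
  have h1 := contDiffWithinAt_phaseFlow g hI hF hL hy ht
  refine (contDiffWithinAt_angleRate h1 (contDiffWithinAt_fderivWithin_apply hI ht h1
    (0, 1))).congr_of_eventuallyEq_of_mem ?_ ⟨trivial, ht⟩
  have hz := mem_own_chart (F ((extChartAt (𝓡 n) b).symm y, t))
  filter_upwards [eventually_flow_charts hF hy ht hz] with z ⟨h1, h2, _⟩
  exact phaseSpeed_flow g hI hF hL h1 h2

/-- The Maslov form evolves by the differential of the speed of the Lagrangian angle. -/
theorem hasDerivWithinAt_maslovForm (g : SmoothMetric n S) (hI : UniqueDiffOn ℝ I)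
    (hF : ContMDiffOn ((𝓡 n).prod 𝓘(ℝ, ℝ)) (cotangentModel n) ∞ F (Set.univ ×ˢ I))
    (hL : ∀ t ∈ I, IsLagrangianImmersion fun x => F (x, t))
    {b : M} {y : Model n} (hy : y ∈ (extChartAt (𝓡 n) b).target) {t : ℝ} (ht : t ∈ I)
    (hcl : t ∈ closure (interior I)) (v : Model n) :
    HasDerivWithinAt (fun t => maslovForm g (fun x => F (x, t)) ((extChartAt (𝓡 n) b).symm y)
        (vec b ((extChartAt (𝓡 n) b).symm y) v))
      (fderiv ℝ (fun y => phaseSpeed g F I ((extChartAt (𝓡 n) b).symm y) t) y v) I t := by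
  obtain ⟨B, hB, hBv⟩ := phase_mixed_partials hI ht hcl (contDiffWithinAt_phaseFlow g hI hF hL hy
    ht) (phaseFlow_norm g hL b)
  have h1 : (fun y => phaseSpeed g F I ((extChartAt (𝓡 n) b).symm y) t) =ᶠ[nhds y]
      fun y => angleRate (phaseFlow g b F (y, t))
        (fderivWithin ℝ (phaseFlow g b F) (Set.univ ×ˢ I) (y, t) (0, 1)) := by
    filter_upwards [(isOpen_extChartAt_target b).mem_nhds hy] with y' hy'
    exact phaseSpeed_flow g hI hF hL hy' ht
  rw [h1.fderiv_eq, hB.fderiv]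
  exact (hBv v).congr (fun t' ht' => maslovForm_flow g hI hF hL hy ht' v)
    (maslovForm_flow g hI hF hL hy ht v)

theorem dCot_dF_flow
    (hF : ContMDiffOn ((𝓡 n).prod 𝓘(ℝ, ℝ)) (cotangentModel n) ∞ F (Set.univ ×ˢ I))
    (hL : ∀ t ∈ I, IsLagrangianImmersion fun x => F (x, t))
    {c : S} {b : M} {y : Model n} (hy : y ∈ (extChartAt (𝓡 n) b).target) {t : ℝ} (ht : t ∈ I)
    (hz : (F ((extChartAt (𝓡 n) b).symm y, t)).proj ∈ (chartAt (Model n) c).source) (v : Model n) :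
    dCot c (F ((extChartAt (𝓡 n) b).symm y, t)) (dF (fun x => F (x, t))
        ((extChartAt (𝓡 n) b).symm y) (vec b ((extChartAt (𝓡 n) b).symm y) v)) =
      fderivWithin ℝ (flowRep c b F) (Set.univ ×ˢ I) (y, t) (v, 0) := by
  have h1 := dCot_dF (F := fun x => F (x, t)) ((hL t
    ht).contMDiff.contMDiffAt.mdifferentiableAt (by simp)) (symm_extChartAt_mem hy) hz v
  rw [(extChartAt (𝓡 n) b).right_inv hy, fderiv_localRep_eq hF hy ht hz] at h1
  exact h1

theorem actionSpeed_flow (hI : UniqueDiffOn ℝ I)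
    (hF : ContMDiffOn ((𝓡 n).prod 𝓘(ℝ, ℝ)) (cotangentModel n) ∞ F (Set.univ ×ˢ I))
    {c : S} {b : M} {y : Model n} (hy : y ∈ (extChartAt (𝓡 n) b).target) {t : ℝ} (ht : t ∈ I)
    (hz : (F ((extChartAt (𝓡 n) b).symm y, t)).proj ∈ (chartAt (Model n) c).source) :
    actionSpeed F I ((extChartAt (𝓡 n) b).symm y) t = (flowRep c b F (y, t)).2
      (fderivWithin ℝ (flowRep c b F) (Set.univ ×ˢ I) (y, t) (0, 1)).1 := by
  rw [actionSpeed, liouville_eq hz, dCot_velocity hI hF hy ht hz]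
  rfl

theorem contDiffWithinAt_actionSpeed (hI : UniqueDiffOn ℝ I)
    (hF : ContMDiffOn ((𝓡 n).prod 𝓘(ℝ, ℝ)) (cotangentModel n) ∞ F (Set.univ ×ˢ I))
    {b : M} {y : Model n} (hy : y ∈ (extChartAt (𝓡 n) b).target) {t : ℝ} (ht : t ∈ I) :
    ContDiffWithinAt ℝ ∞
      (fun z : Model n × ℝ => actionSpeed F I ((extChartAt (𝓡 n) b).symm z.1) z.2)
      (Set.univ ×ˢ I) (y, t) := by
  have hz := mem_own_chart (F ((extChartAt (𝓡 n) b).symm y, t))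
  have h1 := contDiffWithinAt_flowRep hF hy ht hz
  refine (h1.snd.clm_apply (contDiffWithinAt_fderivWithin_apply hI ht h1
    (0, 1)).fst).congr_of_eventuallyEq_of_mem ?_ ⟨trivial, ht⟩
  filter_upwards [eventually_flow_charts hF hy ht hz] with z ⟨h1, h2, h3⟩
  exact actionSpeed_flow hI hF h1 h2 h3

/-- Along the generalized mean curvature flow, the pulled-back Liouville form evolves by the
differential of `actionSpeed` and the Maslov form. -/
theorem hasDerivWithinAt_liouville (g : SmoothMetric n S) (hI : UniqueDiffOn ℝ I)
    (hF : ContMDiffOn ((𝓡 n).prod 𝓘(ℝ, ℝ)) (cotangentModel n) ∞ F (Set.univ ×ˢ I))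
    (hL : ∀ t ∈ I, IsLagrangianImmersion fun x => F (x, t))
    (hflow : ∀ x, ∀ t ∈ I, velocity F I x t = meanCurvatureVector g (fun x => F (x, t)) x)
    {b : M} {y : Model n} (hy : y ∈ (extChartAt (𝓡 n) b).target) {t : ℝ} (ht : t ∈ I)
    (hcl : t ∈ closure (interior I)) (v : Model n) :
    HasDerivWithinAt (fun t => liouville (F ((extChartAt (𝓡 n) b).symm y, t))
        (dF (fun x => F (x, t)) ((extChartAt (𝓡 n) b).symm y)
          (vec b ((extChartAt (𝓡 n) b).symm y) v)))
      (fderiv ℝ (fun y => actionSpeed F I ((extChartAt (𝓡 n) b).symm y) t) y v +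
        maslovForm g (fun x => F (x, t)) ((extChartAt (𝓡 n) b).symm y)
          (vec b ((extChartAt (𝓡 n) b).symm y) v)) I t := by
  have hz := mem_own_chart (F ((extChartAt (𝓡 n) b).symm y, t))
  set c := (F ((extChartAt (𝓡 n) b).symm y, t)).proj with hc
  obtain ⟨B, hB, hBv⟩ := action_mixed_partials hI ht hcl (contDiffWithinAt_flowRep hF hy ht hz)
  have hev := eventually_flow_charts hF hy ht hz
  have h1 : (fun y => actionSpeed F I ((extChartAt (𝓡 n) b).symm y) t) =ᶠ[nhds y]
      fun y => (flowRep c b F (y, t)).2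
        (fderivWithin ℝ (flowRep c b F) (Set.univ ×ˢ I) (y, t) (0, 1)).1 := by
    filter_upwards [(tendsto_space_slice ht).eventually hev] with y' ⟨h1, h2, h3⟩
    exact actionSpeed_flow hI hF h1 h2 h3
  have h2 : ∀ t', t' ∈ I → (F ((extChartAt (𝓡 n) b).symm y, t')).proj ∈
      (chartAt (Model n) c).source → liouville (F ((extChartAt (𝓡 n) b).symm y, t'))
        (dF (fun x => F (x, t')) ((extChartAt (𝓡 n) b).symm y)
          (vec b ((extChartAt (𝓡 n) b).symm y) v)) = (flowRep c b F (y, t')).2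
        (fderivWithin ℝ (flowRep c b F) (Set.univ ×ˢ I) (y, t') (v, 0)).1 := by
    intro t' ht' hz'
    rw [liouville_eq hz', dCot_dF_flow hF hL hy ht' hz']
    rfl
  -- The flow equation turns the `ω`-term of Cartan's formula into the Maslov form.
  have h3 := omega_meanCurvatureVector g (hL t ht) ((extChartAt (𝓡 n) b).symm y)
    (vec b ((extChartAt (𝓡 n) b).symm y) v)
  rw [← hflow _ t ht, omega_eq_dCot, ← hc, dCot_dF_flow hF hL hy ht hz,
    dCot_velocity hI hF hy ht hz] at h3
  rw [h1.fderiv_eq, hB.fderiv]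
  refine ((hBv v).congr_deriv ?_).congr_of_eventuallyEq_of_mem ?_ ht
  · linarith
  · filter_upwards [(tendsto_time_slice y t).eventually hev] with t' ⟨_, h4, h5⟩
    exact h2 t' h4 h5

end Flow

/-! ### Exactness of a form tested in charts. -/

section Exactness

variable {n : ℕ} {M : Type*} [TopologicalSpace M]
  [ChartedSpace (EuclideanSpace ℝ (Fin n)) M] [IsManifold (𝓡 n) ∞ M]

/-- A form on a manifold is exact if a function has it as derivative in all charts. -/
theorem isExactForm_of_charts {α : (x : M) → TangentSpace (𝓡 n) x → ℝ} {f : M → ℝ}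
    (hf : ∀ b : M, ∀ y ∈ (extChartAt (𝓡 n) b).target, ∃ L : Model n →L[ℝ] ℝ,
      HasFDerivAt (fun y => f ((extChartAt (𝓡 n) b).symm y)) L y ∧
      ∀ v, L v = α ((extChartAt (𝓡 n) b).symm y) (vec b ((extChartAt (𝓡 n) b).symm y) v))
    (hα : ∀ (b : M) (v : Model n), ContDiffOn ℝ ∞ (fun y => α ((extChartAt (𝓡 n) b).symm y)
      (vec b ((extChartAt (𝓡 n) b).symm y) v)) (extChartAt (𝓡 n) b).target) :
    IsExactForm α := by
  have hsmooth : ∀ b : M, ContDiffOn ℝ ∞ (fun y => f ((extChartAt (𝓡 n) b).symm y))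
      (extChartAt (𝓡 n) b).target := fun b => by
    -- A differentiable function whose differential is smooth is smooth, so smoothness of the
    -- primitive comes from that of `α`.
    refine (contDiffOn_infty_iff_fderiv_of_isOpen (isOpen_extChartAt_target b)).2
      ⟨fun y hy => ?_, contDiffOn_clm_apply.2 fun v => (hα b v).congr fun y hy => ?_⟩
    · obtain ⟨L, hL, _⟩ := hf b y hy
      exact hL.differentiableAt.differentiableWithinAt
    · obtain ⟨L, hL, hLv⟩ := hf b y hy
      rw [hL.fderiv, hLv]
  have hev : ∀ x : M, f =ᶠ[nhds x]
      (fun y => f ((extChartAt (𝓡 n) x).symm y)) ∘ extChartAt (𝓡 n) x := fun x => by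
    filter_upwards [(chartAt (Model n) x).open_source.mem_nhds (mem_chart_source _ x)] with x' hx'
    simp only [Function.comp_apply]
    rw [(extChartAt (𝓡 n) x).left_inv (by simpa using hx')]
  refine ⟨f, fun x => ?_, fun x u => ?_⟩
  · have h1 := (hsmooth x).contDiffAt ((isOpen_extChartAt_target x).mem_nhds
      (mem_extChartAt_target x))
    exact (ContMDiffAt.comp (g := fun y => f ((extChartAt (𝓡 n) x).symm y)) x
      h1.contMDiffAt contMDiffAt_extChartAt).congr_of_eventuallyEq (hev x)
  · obtain ⟨v, rfl⟩ := vec_surjective (mem_chart_source _ x) u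
    obtain ⟨L, hL, hLv⟩ := hf x _ (mem_extChartAt_target x)
    have h2 := (mfderiv_of_eventuallyEq_chart (mem_chart_source _ x) (hev x)
      hL.differentiableAt).2 v
    rw [hL.fderiv, hLv, extChartAt_to_inv] at h2
    exact h2

theorem hasFDerivAt_of_dirDeriv_eq {α : (x : M) → TangentSpace (𝓡 n) x → ℝ} {f : M → ℝ}
    (hf : ContMDiff (𝓡 n) 𝓘(ℝ, ℝ) ∞ f) (hα : ∀ x u, dirDeriv f x u = α x u)
    {b : M} {y : Model n} (hy : y ∈ (extChartAt (𝓡 n) b).target) :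
    ∃ L : Model n →L[ℝ] ℝ, HasFDerivAt (fun y => f ((extChartAt (𝓡 n) b).symm y)) L y ∧
      ∀ v, L v = α ((extChartAt (𝓡 n) b).symm y) (vec b ((extChartAt (𝓡 n) b).symm y) v) := by
  have h1 : ContMDiffAt 𝓘(ℝ, Model n) (𝓡 n) ∞ (extChartAt (𝓡 n) b).symm y :=
    (contMDiffOn_extChartAt_symm b).contMDiffAt ((isOpen_extChartAt_target b).mem_nhds hy)
  have h2 : ContDiffAt ℝ ∞ (f ∘ (extChartAt (𝓡 n) b).symm) y :=
    contMDiffAt_iff_contDiffAt.1 (hf.contMDiffAt.comp y h1)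
  refine ⟨_, (h2.differentiableAt (by simp)).hasFDerivAt, fun v => ?_⟩
  rw [← hα]
  have h3 := mfderiv_real_vec (symm_extChartAt_mem hy)
    (hf.contMDiffAt.mdifferentiableAt (by simp)) v
  rw [(extChartAt (𝓡 n) b).right_inv hy] at h3
  exact h3.symm

end Exactness

/-! ### Primitives of both forms at all times. -/

section Flow

variable {n : ℕ} {S : Type*} [TopologicalSpace S]
  [ChartedSpace (EuclideanSpace ℝ (Fin n)) S] [IsManifold (𝓡 n) ∞ S]
  {M : Type*} [TopologicalSpace M]
  [ChartedSpace (EuclideanSpace ℝ (Fin n)) M] [IsManifold (𝓡 n) ∞ M]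
  {F : M × ℝ → CotangentBundle n S} {I : Set ℝ}

theorem contDiffAt_space_slice {E E' : Type*} [NormedAddCommGroup E] [NormedSpace ℝ E]
    [NormedAddCommGroup E'] [NormedSpace ℝ E'] {f : E × ℝ → E'} {y : E} {t : ℝ} (ht : t ∈ I)
    (hf : ContDiffWithinAt ℝ ∞ f (Set.univ ×ˢ I) (y, t)) :
    ContDiffAt ℝ ∞ (fun y => f (y, t)) y := by
  rw [← contDiffWithinAt_univ]
  exact hf.comp (f := fun y => (y, t)) y (contDiff_prodMk_left t).contDiffWithinAt
    fun _ _ => ⟨trivial, ht⟩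

theorem contDiffOn_maslovForm (g : SmoothMetric n S) (hI : UniqueDiffOn ℝ I)
    (hF : ContMDiffOn ((𝓡 n).prod 𝓘(ℝ, ℝ)) (cotangentModel n) ∞ F (Set.univ ×ˢ I))
    (hL : ∀ t ∈ I, IsLagrangianImmersion fun x => F (x, t)) {t : ℝ} (ht : t ∈ I) (b : M)
    (v : Model n) :
    ContDiffOn ℝ ∞ (fun y => maslovForm g (fun x => F (x, t)) ((extChartAt (𝓡 n) b).symm y)
      (vec b ((extChartAt (𝓡 n) b).symm y) v)) (extChartAt (𝓡 n) b).target := by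
  refine ContDiffOn.congr (f := fun y => angleRate (phaseFlow g b F (y, t))
    (fderivWithin ℝ (phaseFlow g b F) (Set.univ ×ˢ I) (y, t) (v, 0))) (fun y hy => ?_)
    fun y hy => maslovForm_flow g hI hF hL hy ht v
  have h1 := contDiffWithinAt_phaseFlow g hI hF hL hy ht
  exact (contDiffAt_space_slice ht (contDiffWithinAt_angleRate h1
    (contDiffWithinAt_fderivWithin_apply hI ht h1 (v, 0)))).contDiffWithinAt

theorem contDiffOn_liouville (hI : UniqueDiffOn ℝ I)
    (hF : ContMDiffOn ((𝓡 n).prod 𝓘(ℝ, ℝ)) (cotangentModel n) ∞ F (Set.univ ×ˢ I))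
    (hL : ∀ t ∈ I, IsLagrangianImmersion fun x => F (x, t)) {t : ℝ} (ht : t ∈ I) (b : M)
    (v : Model n) :
    ContDiffOn ℝ ∞ (fun y => liouville (F ((extChartAt (𝓡 n) b).symm y, t))
      (dF (fun x => F (x, t)) ((extChartAt (𝓡 n) b).symm y)
        (vec b ((extChartAt (𝓡 n) b).symm y) v))) (extChartAt (𝓡 n) b).target := by
  intro y hy
  have hz := mem_own_chart (F ((extChartAt (𝓡 n) b).symm y, t))
  have h1 := contDiffWithinAt_flowRep hF hy ht hz
  refine ((contDiffAt_space_slice ht (h1.snd.clm_apply (contDiffWithinAt_fderivWithin_apply hI ht h1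
    (v, 0)).fst)).congr_of_eventuallyEq ?_).contDiffWithinAt
  filter_upwards [(tendsto_space_slice ht).eventually (eventually_flow_charts hF hy ht hz)] with
    y' ⟨h2, h3, h4⟩
  rw [liouville_eq h4, dCot_dF_flow hF hL h2 h3 h4]
  rfl

theorem exact_and_vanishing_maslovClass (g : SmoothMetric n S) {T : EReal}
    (hF : IsGeneralizedLagrangianMCF g T F) (hexact : IsExactLagrangian fun x : M => F (x, 0))
    (hmaslov : HasVanishingMaslovClass g fun x : M => F (x, 0)) {t : ℝ} (ht : t ∈ timeInterval T) :
    IsExactLagrangian (fun x : M => F (x, t)) ∧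
      HasVanishingMaslovClass g (fun x : M => F (x, t)) := by
  have hI := uniqueDiffOn_timeInterval T
  have h0 := zero_mem_timeInterval ht
  have hnn : ∀ s ∈ timeInterval T, 0 ≤ s := fun s hs => hs.1
  have hcl : ∀ s ∈ timeInterval T, s ∈ closure (interior (timeInterval T)) :=
    fun s hs => mem_closure_interior_timeInterval hs
  obtain ⟨θ₀, hθ₀, hdθ₀⟩ := hmaslov
  obtain ⟨f₀, hf₀, hdf₀⟩ := hexact
  -- A global Lagrangian angle for each time, up to a constant.
  let θ : M → ℝ → ℝ := fun x s => θ₀ x + ∫ r in (0 : ℝ)..s, phaseSpeed g F (timeInterval T) x r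
  have hphase := fun (b : M) y (hy : y ∈ (extChartAt (𝓡 n) b).target) s
    (hs : s ∈ timeInterval T) => contDiffWithinAt_phaseSpeed g hI hF.smooth hF.lagrangian hy hs
  have haction := fun (b : M) y (hy : y ∈ (extChartAt (𝓡 n) b).target) s
    (hs : s ∈ timeInterval T) => contDiffWithinAt_actionSpeed hI hF.smooth hy hs
  have hθ : ∀ s ∈ timeInterval T, ∀ b : M, ∀ y ∈ (extChartAt (𝓡 n) b).target,
      ∃ L : Model n →L[ℝ] ℝ, HasFDerivAt (fun y => θ ((extChartAt (𝓡 n) b).symm y) s) L y ∧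
      ∀ v, L v = maslovForm g (fun x => F (x, s)) ((extChartAt (𝓡 n) b).symm y)
        (vec b ((extChartAt (𝓡 n) b).symm y) v) := by
    intro s hs b y hy
    obtain ⟨L₀, hL₀, hL₀v⟩ := hasFDerivAt_of_dirDeriv_eq hθ₀ hdθ₀ hy
    exact hasFDerivAt_transport (isOpen_extChartAt_target b) h0 hnn
      (φ := fun y s => phaseSpeed g F (timeInterval T) ((extChartAt (𝓡 n) b).symm y) s)
      (a := fun y s v => maslovForm g (fun x => F (x, s)) ((extChartAt (𝓡 n) b).symm y)
        (vec b ((extChartAt (𝓡 n) b).symm y) v))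
      (continuousOn_slab (hphase b)) (continuousOn_slab_fderiv hI (hphase b))
      (fun y hy s hs => ((contDiffAt_space_slice hs (hphase b y hy s hs)).differentiableAt
        (by simp)).hasFDerivAt)
      (fun y hy s hs v => hasDerivWithinAt_maslovForm g hI hF.smooth hF.lagrangian hy hs
        (hcl s hs) v) hy hL₀ hL₀v hs
  refine ⟨?_, isExactForm_of_charts (f := fun x => θ x t) (hθ t ht)
    (contDiffOn_maslovForm g hI hF.smooth hF.lagrangian ht)⟩
  have hθc : ∀ b : M, ContinuousOn (fun z : Model n × ℝ => θ ((extChartAt (𝓡 n) b).symm z.1) z.2)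
      ((extChartAt (𝓡 n) b).target ×ˢ timeInterval T) := fun b =>
    continuousOn_transport h0 (fun s hs => exists_gt_mem_timeInterval hs) hnn
      (φ := fun y s => phaseSpeed g F (timeInterval T) ((extChartAt (𝓡 n) b).symm y) s)
      (f₀ := fun y => θ₀ ((extChartAt (𝓡 n) b).symm y))
      (hθ₀.continuous.comp_continuousOn (continuousOn_extChartAt_symm b))
      (continuousOn_slab (hphase b))
  -- The spatial differential of `θ` is the Maslov form, which is jointly continuous; the second
  -- integration needs this.
  have hmc : ∀ b : M, ContinuousOn (fun z : Model n × ℝ =>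
      fderiv ℝ (fun y => θ ((extChartAt (𝓡 n) b).symm y) z.2) z.1)
      ((extChartAt (𝓡 n) b).target ×ˢ timeInterval T) := fun b => by
    refine continuousOn_clm_apply.2 fun v => ?_
    refine ContinuousOn.congr (continuousOn_slab fun y hy s hs => ?_) (fun z hz => ?_)
      (f := fun z : Model n × ℝ => angleRate (phaseFlow g b F z)
        (fderivWithin ℝ (phaseFlow g b F) (Set.univ ×ˢ timeInterval T) z (v, 0)))
    · have h1 := contDiffWithinAt_phaseFlow g hI hF.smooth hF.lagrangian hy hs
      exact contDiffWithinAt_angleRate h1 (contDiffWithinAt_fderivWithin_apply hI hs h1 (v, 0))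
    · obtain ⟨L, hL, hLv⟩ := hθ z.2 hz.2 b z.1 hz.1
      rw [hL.fderiv, hLv, maslovForm_flow g hI hF.smooth hF.lagrangian hz.1 hz.2]
  -- The integrand is the primitive of `∂_s(F^*λ)`: the action of the velocity plus the Lagrangian
  -- angle.
  refine isExactForm_of_charts (f := fun x => f₀ x + ∫ s in (0 : ℝ)..t,
    (actionSpeed F (timeInterval T) x s + θ x s)) (fun b y hy => ?_)
    (contDiffOn_liouville hI hF.smooth hF.lagrangian ht)
  obtain ⟨L₀, hL₀, hL₀v⟩ := hasFDerivAt_of_dirDeriv_eq hf₀ hdf₀ hy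
  refine hasFDerivAt_transport (isOpen_extChartAt_target b) h0 hnn
    (φ := fun y s => actionSpeed F (timeInterval T) ((extChartAt (𝓡 n) b).symm y) s +
      θ ((extChartAt (𝓡 n) b).symm y) s)
    (β := fun y s => fderiv ℝ (fun y => actionSpeed F (timeInterval T)
      ((extChartAt (𝓡 n) b).symm y) s) y + fderiv ℝ (fun y => θ ((extChartAt (𝓡 n) b).symm y) s) y)
    (a := fun y s v => liouville (F ((extChartAt (𝓡 n) b).symm y, s))
      (dF (fun x => F (x, s)) ((extChartAt (𝓡 n) b).symm y)
        (vec b ((extChartAt (𝓡 n) b).symm y) v)))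
    ((continuousOn_slab (haction b)).add (hθc b))
    ((continuousOn_slab_fderiv hI (haction b)).add (hmc b))
    (fun y hy s hs => ?_) (fun y hy s hs v => ?_) hy hL₀ hL₀v ht
  · obtain ⟨L, hL, _⟩ := hθ s hs b y hy
    exact ((contDiffAt_space_slice hs (haction b y hy s hs)).differentiableAt
      (by simp)).hasFDerivAt.add hL.differentiableAt.hasFDerivAt
  · obtain ⟨L, hL, hLv⟩ := hθ s hs b y hy
    refine (hasDerivWithinAt_liouville g hI hF.smooth hF.lagrangian hF.evolution hy hs
      (hcl s hs) v).congr_deriv ?_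
    rw [add_apply, hL.fderiv, hLv]

end Flow

end Cotangent

theorem theorem2 (n : ℕ)
    (S : Type*) [TopologicalSpace S] [T2Space S] [CompactSpace S]
    [ChartedSpace (EuclideanSpace ℝ (Fin n)) S] [IsManifold (𝓡 n) ∞ S]
    (g : SmoothMetric n S)
    (M : Type*) [TopologicalSpace M] [T2Space M] [CompactSpace M]
    [ChartedSpace (EuclideanSpace ℝ (Fin n)) M] [IsManifold (𝓡 n) ∞ M]
    (T : EReal) (F : M × ℝ → CotangentBundle n S)
    (hF : Cotangent.IsGeneralizedLagrangianMCF g T F)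
    (hexact : Cotangent.IsExactLagrangian fun x : M => F (x, 0))
    (hmaslov : Cotangent.HasVanishingMaslovClass g fun x : M => F (x, 0)) :
    ∀ t ∈ Cotangent.timeInterval T,
      Cotangent.IsExactLagrangian (fun x : M => F (x, t)) ∧
        Cotangent.HasVanishingMaslovClass g (fun x : M => F (x, t)) :=
  fun _ ht => Cotangent.exact_and_vanishing_maslovClass g hF hexact hmaslov ht

end
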